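/- Let $\mathcal U\subseteq U(2)$ be a compact group of single-qubit unitaries with $\mathsf X,\mathsf Z\in\mathcal U$, let $\rho_0$ be a qubit density matrix, and write $U(\rho)=U\rho U^\dagger$. Let $\eta\in[0,1]$, integers $1\le K\le N$, intensities $\mu_1,\dots,\mu_N\ge 0$, a (possibly randomised) algorithm $\mathcal B$ that maps a set $I\subseteq\{1,\dots,N\}$ to $\mathsf{Accept}$ or $\mathsf{Abort}$, and $\varepsilon\ge0$ be given. **Resource $\mathsf{WCPGenerator}$.** The Sender inputs $U\in\mathcal U$ and $\mu\ge0$, the Receiver inputs $c\in\{0,1\}$ ($c=0$ if honest). If $c=0$, it samples $n\sim\mathrm{Poisson}(\mu\eta)$ and sends $U(\rho_0)^{\otimes n}$ to the Receiver. If $c=1$, it samples $n\sim\mathrm{Poisson}(\mu)$ and sends the Receiver $U(\rho_0)^{\otimes n}$ if $n\le1$, and $n$ with the classical description of $U$ if $n>1$. The number of photons received is visible to the Receiver. **Resource $\mathsf{BatchRSP}$.** The Sender inputs $U_1,\dots,U_K\in\mathcal U$, the Receiver inputs $c,d\in\{0,1\}$ (both $0$ if honest). If $d=1$, the Sender is notified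 of an abort and nothing else happens. If $d=0,c=0$, the Receiver gets $U_1(\rho_0)\otimes\cdots\otimes U_K(\rho_0)$. If $d=0,c=1$, the resource samples $k\in\{1,\dots,K\}$ uniformly and the Receiver gets $k$, the classical descriptions of $(U_j)_{j\ne k}$ and the state $U_k(\rho_0)$. **Protocol.** On input $U_1,\dots,U_K$ the Sender samples a uniform permutation $\pi$ of $\{1,\dots,N\}$, sets $\mu'_i=\mu_{\pi^{-1}(i)}$, samples independent Haar-random $U'_1,\dots,U'_N\in\mathcal U$, and for $i=1,\dots,N$ calls $\mathsf{WCPGenerator}$ with $(U'_i,\mu'_i)$. The Receiver (with $c=0$ in all rounds) lets $\tilde I$ be the set of rounds with at least one photon; if $|\tilde I|<K$ it sends $\mathsf{Abort}$, otherwise it sends a uniformly random $K$-subset $I'\subseteq\tilde I$ and keeps one photon of each pulse in $I'$. The Sender sets $I=\{\pi^{-1}(i):i\in I'\}$ and runs $\mathcal B(I)$; if it returns $\mathsf{Abort}$, the Sender sends $\mathsf{Abort}$. Otherwise the rounds in $I'$ are relabelled $1,\dots,K$ in increasing order, the Sender samples a uniform permutation $\sigma$ of $\{1,\dots,K\}$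 and sends $\sigma$ and $\tilde U_j=U_{\sigma(j)}U_j'^\dagger$, $1\le j\le K$. The Receiver applies $\tilde U_j$ to the $j$-th kept photon, moves it to position $\sigma(j)$, and outputs the $K$ qubits. In all abort cases both parties output an abort. **Correctness game.** Sample independent $n_i\sim\mathrm{Poisson}(\mu_i\eta)$ and let $\tilde I=\{i:n_i\ge1\}$. If $|\tilde I|<K$ return $\mathsf{Abort}$; otherwise return $\mathcal B(I)$ for a uniformly random $K$-subset $I\subseteq\tilde I$. **Security game for a map $\mathcal D$.** Here $\mathcal D$ maps every sequence $(c_k)_{k\in\mathbb N}$ of natural numbers with $\sum_k c_k=N$ to a sequence $(d_k)_{k\in\mathbb N}$ of natural numbers with $d_k\le c_k$ and $\sum_kd_k=K$. Sample independent $n_i\sim\mathrm{Poisson}(\mu_i)$, let $J_k=\{i:n_i=k\}$, $c_k=|J_k|$, $(d_k)=\mathcal D((c_k))$, choose independent uniformly random $I_k\subseteq J_k$ with $|I_k|=d_k$, and let $I=\bigcup_kI_k$. Return $\mathsf{Fail}$ if $\mathcal B(I)$ returns $\mathsf{Accept}$ and $d_0=d_1=0$, otherwise $\mathsf{Success}$.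 **Theorem.** Suppose that the correctness game returns $\mathsf{Abort}$ with probability at most $\varepsilon$, and that for every map $\mathcal D$ the security game returns $\mathsf{Fail}$ with probability at most $\varepsilon$. Then the protocol $\varepsilon$-statistically constructs $\mathsf{BatchRSP}$ from $\mathsf{WCPGenerator}$ in the Abstract Cryptography framework, for an honest Sender and an honest or malicious Receiver. That is: 1. (Correctness) No distinguisher that chooses the Sender's input and gets the outputs of both parties has an advantage greater than $\varepsilon$ in distinguishing the honest execution of the protocol from $\mathsf{BatchRSP}$ with honest Receiver's input $c=d=0$. 2. (Security) There is a simulator $\sigma$, attached to the Receiver's interface of $\mathsf{BatchRSP}$, such that no computationally unbounded quantum distinguisher (with classical memory and quantum memory of arbitrary finite dimension) that chooses the Sender's input, sees the Sender's abort notification and controls the Receiver's interface has an advantage greater than $\varepsilon$ in distinguishing the honest Sender attached to the $N$ calls of $\mathsf{WCPGenerator}$ from $\mathsf{BatchRSP}$ with $\sigma$ attached. The distinguisher may choose the flag $c$ of each call adaptively, depending on everything received in earlier rounds, then sends $\mathsf{Abort}$ or any $K$-subset $I'$, and gets the Sender's last message. The advantage is $|\Pr[\text{output }1\text{ in one world}]-\Pr[\text{output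 }1\text{ in the other}]|$. -/

import Mathlib

open MeasureTheory
open scoped NNReal ENNReal ComplexOrder Kronecker

namespace WCP

noncomputable section

/-! ### States and operations of finite-dimensional quantum systems -/

/-- Index set of the computational basis of `n` qubits. -/
abbrev Qubits (n : ℕ) : Type := Fin n → Fin 2

/-- Linear maps from operators on `ℂ^a` to operators on `ℂ^b`. -/
abbrev Op (a b : Type) : Type := Matrix a a ℂ →ₗ[ℂ] Matrix b b ℂ

/-- Density matrices. -/
def IsDensity {a : Type} [Fintype a] (ρ : Matrix a a ℂ) : Prop :=
  ρ.PosSemidef ∧ ρ.trace = 1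

/-- Effects, the elements of two-outcome POVMs: `0 ≤ E ≤ 1`. -/
def IsEffect {a : Type} [DecidableEq a] (E : Matrix a a ℂ) : Prop :=
  E.PosSemidef ∧ (1 - E).PosSemidef

/-- `Φ ⊗ id_k`. -/
def actLeft {a b : Type} (k : Type) (Φ : Op a b) (A : Matrix (a × k) (a × k) ℂ) :
    Matrix (b × k) (b × k) ℂ :=
  Matrix.of fun p q => Φ (Matrix.of fun i j => A (i, p.2) (j, q.2)) p.1 q.1

/-- `id_k ⊗ Φ`. -/
def actRight {a b : Type} (k : Type) (Φ : Op a b) (A : Matrix (k × a) (k × a) ℂ) :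
    Matrix (k × b) (k × b) ℂ :=
  Matrix.of fun p q => Φ (Matrix.of fun i j => A (p.1, i) (q.1, j)) p.2 q.2

/-- Complete positivity: `Φ ⊗ id` preserves positivity for every finite-dimensional ancilla. -/
def IsCP {a b : Type} (Φ : Op a b) : Prop :=
  ∀ (k : ℕ) (A : Matrix (a × Fin k) (a × Fin k) ℂ), A.PosSemidef → (actLeft (Fin k) Φ A).PosSemidef

/-- The operation `ρ ↦ ρ ⊗ τ`. -/
def appendState {a b : Type} (τ : Matrix b b ℂ) : Op a (a × b) where
  toFun ρ := ρ ⊗ₖ τ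
  map_add' x y := Matrix.add_kronecker x y τ
  map_smul' r x := Matrix.smul_kronecker r x τ

/-- Reordering of tensor factors `D ⊗ (d ⊗ q) → (D ⊗ q) ⊗ d`. -/
def regroup {D d q : Type} (A : Matrix (D × (d × q)) (D × (d × q)) ℂ) :
    Matrix ((D × q) × d) ((D × q) × d) ℂ :=
  Matrix.of fun x y => A (x.1.1, (x.2, x.1.2)) (y.1.1, (y.2, y.1.2))

/-- The probability `tr (E ρ)` that the effect `E` occurs in the (subnormalised) state `ρ`. -/
def prob {a : Type} [Fintype a] (E ρ : Matrix a a ℂ) : ℝ≥0∞ :=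
  ENNReal.ofReal (E * ρ).trace.re

/-- The product state `τ 0 ⊗ ⋯ ⊗ τ (n - 1)` of `n` qubits. -/
def prodState {n : ℕ} (τ : Fin n → Matrix (Fin 2) (Fin 2) ℂ) : Matrix (Qubits n) (Qubits n) ℂ :=
  Matrix.of fun x y => ∏ i, τ i (x i) (y i)

/-- The state of the first of `n` qubits (partial trace over the others); `0` if there is none. -/
def firstQubit : (n : ℕ) → Matrix (Qubits n) (Qubits n) ℂ → Matrix (Fin 2) (Fin 2) ℂ
  | 0, _ => 0
  | _ + 1, A => Matrix.of fun a b => ∑ r, A (Fin.cons a r) (Fin.cons b r)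

/-- The Pauli matrix `X`. -/
def pauliX : Matrix (Fin 2) (Fin 2) ℂ := !![0, 1; 1, 0]

/-- The Pauli matrix `Z`. -/
def pauliZ : Matrix (Fin 2) (Fin 2) ℂ := !![1, 0; 0, -1]

/-- `U(ρ) = U ρ U†`. -/
def conjU {𝒰 : Subgroup (Matrix.unitaryGroup (Fin 2) ℂ)} (U : 𝒰) (ρ : Matrix (Fin 2) (Fin 2) ℂ) :
    Matrix (Fin 2) (Fin 2) ℂ :=
  (U.1 : Matrix (Fin 2) (Fin 2) ℂ) * ρ * (U.1 : Matrix (Fin 2) (Fin 2) ℂ).conjTranspose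

/-! ### Classical randomness -/

/-- A group of unitaries carries its Borel σ-algebra. -/
instance (𝒰 : Subgroup (Matrix.unitaryGroup (Fin 2) ℂ)) : MeasurableSpace 𝒰 := borel 𝒰

instance (𝒰 : Subgroup (Matrix.unitaryGroup (Fin 2) ℂ)) : BorelSpace 𝒰 := ⟨rfl⟩

instance (n : ℕ) : MeasurableSpace (Equiv.Perm (Fin n)) := ⊤

/-- The normalised Haar measure of a compact group of unitaries. -/
def haar (𝒰 : Subgroup (Matrix.unitaryGroup (Fin 2) ℂ)) [CompactSpace 𝒰] : Measure 𝒰 :=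
  Measure.haarMeasure ⊤

/-- Expected value of `f` at a uniformly random element of the (nonempty) finite set `s`. -/
def unifAvg {α : Type} (s : Finset α) (f : α → ℝ≥0∞) : ℝ≥0∞ := (∑ a ∈ s, f a) / s.card

/-- Joint law of independent photon numbers with Poisson means `r i`. -/
def photonLaw {N : ℕ} (r : Fin N → ℝ≥0) : Measure (Fin N → ℕ) :=
  Measure.pi fun i => ProbabilityTheory.poissonMeasure (r i)

/-- The sets of `K` rounds out of `N`. -/
abbrev KSubset (N K : ℕ) : Type := {I : Finset (Fin N) // I.card = K}

/-- What the Receiver sends to the Sender: `none` is `Abort`, `some I'` acknowledges the rounds in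
`I'`. -/
abbrev Ack (N K : ℕ) : Type := Option (KSubset N K)

/-- Relabelling of the rounds in `I` from `1` to `K`, in increasing order. -/
def kept {N K : ℕ} (I : KSubset N K) (j : Fin K) : Fin N := I.1.orderEmbOfFin I.2 j

/-- An estimation algorithm: on input `I` it returns a random bit; `true` is `Accept`, `false` is
`Abort`. -/
abbrev Estimator (N : ℕ) : Type := Finset (Fin N) → PMF Bool

/-- The intensity of the `i`-th pulse sent, when pulse `i` of the original list is moved to
position `π i`. -/
def permuted {N : ℕ} (μ : Fin N → ℝ≥0) (π : Equiv.Perm (Fin N)) (i : Fin N) : ℝ≥0 := μ (π⁻¹ i)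

/-- `I = {π⁻¹ i | i ∈ I'}`. -/
def unpermute {N : ℕ} (π : Equiv.Perm (Fin N)) (I' : Finset (Fin N)) : Finset (Fin N) :=
  I'.map (π⁻¹).toEmbedding

/-! ### The two classical games -/

/-- Probability that the correctness game returns `Abort`. -/
def gameCorAbort {N : ℕ} (K : ℕ) (η : ℝ≥0) (μ : Fin N → ℝ≥0) (B : Estimator N) : ℝ≥0∞ :=
  ∫⁻ n, (let J := Finset.univ.filter fun i => 1 ≤ n i
    if J.card < K then 1 else unifAvg (J.powersetCard K) fun I => B I false)
    ∂photonLaw fun i => μ i * η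

/-- The numbers `c_k` of pulses with `k` photons. -/
def counts {N : ℕ} (n : Fin N → ℕ) : ℕ →₀ ℕ := ∑ i, Finsupp.single (n i) 1

/-- The maps `(c_k) ↦ (d_k)` with `d_k ≤ c_k` and `∑ d_k = K`. -/
def IsStrategy (N K : ℕ) (D : (ℕ →₀ ℕ) → (ℕ →₀ ℕ)) : Prop :=
  ∀ c : ℕ →₀ ℕ, c.degree = N → D c ≤ c ∧ (D c).degree = K

open Classical in
/-- Probability that the security game with the map `D` returns `Fail`. Choosing for every `k`
independently and uniformly a set of `d_k` of the `k`-photon pulses amounts to choosing uniformly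
a set `I` of pulses with exactly `d_k` pulses with `k` photons for every `k`. -/
def gameSimFail {N : ℕ} (μ : Fin N → ℝ≥0) (B : Estimator N) (D : (ℕ →₀ ℕ) → (ℕ →₀ ℕ)) : ℝ≥0∞ :=
  ∫⁻ n, (let d := D (counts n)
    unifAvg (Finset.univ.filter fun I : Finset (Fin N) =>
        ∀ k, (I.filter fun i => n i = k).card = d k)
      fun I => if d 0 = 0 ∧ d 1 = 0 then B I true else 0)
    ∂photonLaw μ

/-! ### The resources -/

/-- Mean photon number in `WCPGenerator` for intensity `μ` and Receiver flag `c`. -/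
def wcpMean (η μ : ℝ≥0) (c : Bool) : ℝ≥0 := if c then μ else μ * η

/-- The state `U(ρ₀)^{⊗ n}` of an `n`-photon pulse. -/
def pulse {𝒰 : Subgroup (Matrix.unitaryGroup (Fin 2) ℂ)} (ρ₀ : Matrix (Fin 2) (Fin 2) ℂ) (U : 𝒰)
    (n : ℕ) : Matrix (Qubits n) (Qubits n) ℂ :=
  prodState fun _ : Fin n => conjU U ρ₀

/-- The classical part of the output of `WCPGenerator`: nothing (besides the number of photons
sent), or a photon number together with the classical description of a unitary. -/
abbrev Label (𝒰 : Subgroup (Matrix.unitaryGroup (Fin 2) ℂ)) : Type := Unit ⊕ (ℕ × 𝒰)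

/-- Probability that `WCPGenerator`, on flag `c`, outputs `n` photons and, in the case
`y = some m`, the classical description of an `m`-photon pulse: on `c = 0` it samples `n` and sends
`n` photons; on `c = 1` it sends `n` photons if the sampled number is `n ≤ 1`, and no photon but
the description if the sampled number is `m > 1`. -/
def wcpWeight (η μ : ℝ≥0) (c : Bool) (n : ℕ) : Option ℕ → ℝ
  | none => if c = true ∧ 1 < n then 0 else (ProbabilityTheory.poissonMeasure (wcpMean η μ c)).real {n}
  | some m =>
    if c = true ∧ 1 < m ∧ n = 0 then (ProbabilityTheory.poissonMeasure (wcpMean η μ c)).real {m} else 0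

/-- The classical part of the output of `WCPGenerator`. -/
def wcpLabel {𝒰 : Subgroup (Matrix.unitaryGroup (Fin 2) ℂ)} (U : 𝒰) : Option ℕ → Label 𝒰
  | none => Sum.inl ()
  | some m => Sum.inr (m, U)

/-- The classical part of what `BatchRSP` sends to the Receiver. -/
inductive BatchReply (𝒰 : Subgroup (Matrix.unitaryGroup (Fin 2) ℂ)) (K : ℕ) : Type
  | abort : BatchReply 𝒰 K
  | honest : BatchReply 𝒰 K
  | leak (k : Fin K) (u : {j : Fin K // j ≠ k} → 𝒰) : BatchReply 𝒰 K

/-- The number of qubits that come with a reply of `BatchRSP`. -/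
def BatchReply.qubits {𝒰 : Subgroup (Matrix.unitaryGroup (Fin 2) ℂ)} {K : ℕ} :
    BatchReply 𝒰 K → ℕ
  | .abort => 0
  | .honest => K
  | .leak _ _ => 1

/-- The reply of `BatchRSP` to the Receiver's input `(c, d)`, where `d = 1` asks for an abort (of
which the Sender is notified) and `k` is the index sampled by the resource. -/
def batchReply {𝒰 : Subgroup (Matrix.unitaryGroup (Fin 2) ℂ)} {K : ℕ} (u : Fin K → 𝒰)
    (c d : Bool) (k : Fin K) : BatchReply 𝒰 K :=
  if d then .abort else if c then .leak k (fun j => u j) else .honest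

/-- The quantum state that comes with a reply of `BatchRSP`. -/
def batchState {𝒰 : Subgroup (Matrix.unitaryGroup (Fin 2) ℂ)} {K : ℕ}
    (ρ₀ : Matrix (Fin 2) (Fin 2) ℂ) (u : Fin K → 𝒰) :
    (r : BatchReply 𝒰 K) → Matrix (Qubits r.qubits) (Qubits r.qubits) ℂ
  | .abort => prodState (Fin.elim0 : Fin 0 → Matrix (Fin 2) (Fin 2) ℂ)
  | .honest => prodState fun i : Fin K => conjU (u i) ρ₀
  | .leak k _ => prodState fun _ : Fin 1 => conjU (u k) ρ₀

/-! ### The Sender of the protocol -/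

section Sender

variable {𝒰 : Subgroup (Matrix.unitaryGroup (Fin 2) ℂ)} {N K : ℕ}

/-- Randomness of the Sender while sending the pulses: a uniform permutation `π` and independent
Haar random unitaries `U'_1, …, U'_N`. -/
def senderLaw (𝒰 : Subgroup (Matrix.unitaryGroup (Fin 2) ℂ)) [CompactSpace 𝒰] (N : ℕ) :
    Measure (Equiv.Perm (Fin N) × (Fin N → 𝒰)) :=
  (PMF.uniformOfFintype (Equiv.Perm (Fin N))).toMeasure.prod (Measure.pi fun _ => haar 𝒰)

/-- The corrections `Ũ_j = U_{σ(j)} U'_j†`, after relabelling of the rounds in `I`. -/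
def corrections (u : Fin K → 𝒰) (U' : Fin N → 𝒰) (I : KSubset N K) (σ : Equiv.Perm (Fin K))
    (j : Fin K) : 𝒰 :=
  u (σ j) * (U' (kept I j))⁻¹

/-- The last message to the Receiver: `Abort`, or a permutation with corrections. -/
abbrev LastMsg (𝒰 : Subgroup (Matrix.unitaryGroup (Fin 2) ℂ)) (K : ℕ) : Type :=
  Unit ⊕ (Equiv.Perm (Fin K) × (Fin K → 𝒰))

/-- Probability of the outcomes of the Sender's estimation phase: `none` is an abort, `some σ`
means acceptance with the permutation `σ`. -/
def estimationWeight (B : Estimator N) (π : Equiv.Perm (Fin N)) :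
    Ack N K → Option (Equiv.Perm (Fin K)) → ℝ
  | none, none => 1
  | none, some _ => 0
  | some I, none => (B (unpermute π I.1) false).toReal
  | some I, some _ => (B (unpermute π I.1) true).toReal / K.factorial

/-- The message with which the Sender ends the estimation phase. -/
def estimationMsg (u : Fin K → 𝒰) (U' : Fin N → 𝒰) :
    Ack N K → Option (Equiv.Perm (Fin K)) → LastMsg 𝒰 K
  | some I, some σ => Sum.inr (σ, corrections u U' I σ)
  | _, _ => Sum.inl ()

end Sender

/-! ### Correctness: honest Sender and honest Receiver -/

/-- A distinguisher in the honest setting. It has a random classical memory `m` and a quantum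
memory; it chooses the Sender's input, and gets at the end either an abort at both interfaces, or no
abort at the Sender's interface and `K` qubits at the Receiver's interface. -/
structure HonestDistinguisher (𝒰 : Subgroup (Matrix.unitaryGroup (Fin 2) ℂ)) (K : ℕ) where
  M : Type
  [measM : MeasurableSpace M]
  law : Measure M
  [law_prob : IsProbabilityMeasure law]
  dim : ℕ
  state : M → Matrix (Fin dim) (Fin dim) ℂ
  state_density : ∀ m, IsDensity (state m)
  state_meas : ∀ i j, Measurable fun m => state m i j
  input : M → Fin K → 𝒰
  input_meas : Measurable input
  guessAbort : M → Matrix (Fin dim) (Fin dim) ℂ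
  guessAbort_effect : ∀ m, IsEffect (guessAbort m)
  guessAbort_meas : ∀ i j, Measurable fun m => guessAbort m i j
  guess : M → Matrix (Fin dim × Qubits K) (Fin dim × Qubits K) ℂ
  guess_effect : ∀ m, IsEffect (guess m)
  guess_meas : ∀ i j, Measurable fun m => guess m i j

attribute [instance] HonestDistinguisher.measM HonestDistinguisher.law_prob

/-- The output of the honest Receiver in an accepted run: for every `j` it keeps one photon of the
`j`-th acknowledged pulse and applies `Ũ_j` to it; then it permutes the `K` qubits by `σ⁻¹`. -/
def honestOutput {𝒰 : Subgroup (Matrix.unitaryGroup (Fin 2) ℂ)} {N K : ℕ}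
    (ρ₀ : Matrix (Fin 2) (Fin 2) ℂ) (u : Fin K → 𝒰) (U' : Fin N → 𝒰) (n : Fin N → ℕ)
    (I : KSubset N K) (σ : Equiv.Perm (Fin K)) : Matrix (Qubits K) (Qubits K) ℂ :=
  prodState fun i =>
    let j := σ⁻¹ i
    conjU (corrections u U' I σ j)
      (firstQubit (n (kept I j)) (pulse ρ₀ (U' (kept I j)) (n (kept I j))))

/-- Probability that the distinguisher outputs `1` when the honest parties run the protocol. -/
def honestReal {𝒰 : Subgroup (Matrix.unitaryGroup (Fin 2) ℂ)} [CompactSpace 𝒰] {N K : ℕ}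
    (ρ₀ : Matrix (Fin 2) (Fin 2) ℂ) (η : ℝ≥0) (μ : Fin N → ℝ≥0) (B : Estimator N)
    (Z : HonestDistinguisher 𝒰 K) : ℝ≥0∞ :=
  ∫⁻ m, ∫⁻ s, ∫⁻ n,
    (let J := Finset.univ.filter fun i => 1 ≤ n i
      let pAbort := prob (Z.guessAbort m) (Z.state m)
      if J.card < K then pAbort
      else unifAvg (Finset.univ.filter fun I : KSubset N K => I.1 ⊆ J) fun I =>
        B (unpermute s.1 I.1) false * pAbort +
        B (unpermute s.1 I.1) true *
          unifAvg Finset.univ fun σ : Equiv.Perm (Fin K) =>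
            prob (Z.guess m) (Z.state m ⊗ₖ honestOutput ρ₀ (Z.input m) s.2 n I σ))
    ∂photonLaw (fun i => wcpMean η (permuted μ s.1 i) false) ∂(senderLaw 𝒰 N) ∂(Z.law)

/-- Probability that the distinguisher outputs `1` when it interacts with `BatchRSP`, with the honest
input `c = 0` (and no abort) at the Receiver's interface. -/
def honestIdeal {𝒰 : Subgroup (Matrix.unitaryGroup (Fin 2) ℂ)} {K : ℕ}
    (ρ₀ : Matrix (Fin 2) (Fin 2) ℂ) (Z : HonestDistinguisher 𝒰 K) : ℝ≥0∞ :=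
  ∫⁻ m, prob (Z.guess m) (Z.state m ⊗ₖ batchState ρ₀ (Z.input m) .honest) ∂(Z.law)

/-! ### Security: malicious Receiver -/

/-- A system with the outer interfaces of the real world with a malicious Receiver. It has a
classical memory, with a random initial value, and a quantum memory.
* In each of the `N` pulse rounds it gets a flag `c`, applies an instrument whose outcome is a number
  `n` of qubits that are sent to the Receiver together with some `y`, and sends a classical label.
* Then it gets an acknowledgement, applies an instrument with outcome `z`, notifies the Sender of
  an abort or not (`true` is an abort), and sends a last message to the Receiver. This step may depend
  on the input `u` at the Sender's interface. -/
structure OpenSystem (𝒰 : Subgroup (Matrix.unitaryGroup (Fin 2) ℂ)) (N K : ℕ) where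
  S : Type
  [measS : MeasurableSpace S]
  law : Measure S
  dim : ℕ
  state : S → Matrix (Fin dim) (Fin dim) ℂ
  Y : Type
  emit : Fin N → S → Bool → (n : ℕ) → Y → Op (Fin dim) (Fin dim × Qubits n)
  label : Fin N → S → Bool → ℕ → Y → Label 𝒰
  next : Fin N → S → Bool → ℕ → Y → S
  Z : Type
  reply : S → (Fin K → 𝒰) → Ack N K → Z → Op (Fin dim) (Fin dim)
  out : S → (Fin K → 𝒰) → Ack N K → Z → Bool × LastMsg 𝒰 K

attribute [instance] OpenSystem.measS

/-- A distinguisher against a malicious Receiver. It has an arbitrary classical memory, with a random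
initial value, and a quantum memory of arbitrary finite dimension. It chooses the Sender's input;
in each pulse round it applies an instrument that determines the flag `c`, and receives and processes
the pulse; then it applies an instrument that determines the acknowledgement, gets the Sender's
abort notification and the last message, and measures its memory to output a bit. -/
structure Distinguisher (𝒰 : Subgroup (Matrix.unitaryGroup (Fin 2) ℂ)) (N K : ℕ) where
  M : Type
  [measM : MeasurableSpace M]
  law : Measure M
  [law_prob : IsProbabilityMeasure law]
  dim : ℕ
  state : M → Matrix (Fin dim) (Fin dim) ℂ
  state_density : ∀ m, IsDensity (state m)
  state_meas : ∀ i j, Measurable fun m => state m i j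
  input : M → Fin K → 𝒰
  input_meas : Measurable input
  flag : Fin N → M → Bool → Op (Fin dim) (Fin dim)
  flag_cp : ∀ i m c, IsCP (flag i m c)
  flag_trace : ∀ i m A, ∑ c, (flag i m c A).trace = A.trace
  flag_meas : ∀ i c A a b, Measurable fun m => flag i m c A a b
  receive : Fin N → M → Bool → (n : ℕ) → Label 𝒰 → Op (Fin dim × Qubits n) (Fin dim)
  receive_cp : ∀ i m c n x, IsCP (receive i m c n x)
  receive_trace : ∀ i m c n x A, (receive i m c n x A).trace = A.trace
  receive_meas : ∀ i c n A a b,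
    Measurable fun p : M × Label 𝒰 => receive i p.1 c n p.2 A a b
  next : Fin N → M → Bool → ℕ → Label 𝒰 → M
  next_meas : ∀ i c n, Measurable fun p : M × Label 𝒰 => next i p.1 c n p.2
  ack : M → Ack N K → Op (Fin dim) (Fin dim)
  ack_cp : ∀ m I, IsCP (ack m I)
  ack_trace : ∀ m A, ∑ I, (ack m I A).trace = A.trace
  ack_meas : ∀ I A a b, Measurable fun m => ack m I A a b
  guess : M → Ack N K → Bool × LastMsg 𝒰 K → Matrix (Fin dim) (Fin dim) ℂ
  guess_effect : ∀ m I x, IsEffect (guess m I x)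
  guess_meas : ∀ I a b,
    Measurable fun p : M × (Bool × LastMsg 𝒰 K) => guess p.1 I p.2 a b

attribute [instance] Distinguisher.measM Distinguisher.law_prob

/-- Probability that the distinguisher outputs `1` after the pulse rounds in the list `l` and the
estimation phase, from classical memories `m` and `s` and the (subnormalised) joint quantum state
`ρ` of the distinguisher and the system. -/
def play {𝒰 : Subgroup (Matrix.unitaryGroup (Fin 2) ℂ)} {N K : ℕ} (R : OpenSystem 𝒰 N K)
    (Z : Distinguisher 𝒰 N K) (u : Fin K → 𝒰) :
    (l : List (Fin N)) → Z.M → R.S →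
      Matrix (Fin Z.dim × Fin R.dim) (Fin Z.dim × Fin R.dim) ℂ → ℝ≥0∞
  | [], m, s, ρ => ∑ I : Ack N K, ∑' z : R.Z,
      prob (Z.guess m I (R.out s u I z) ⊗ₖ (1 : Matrix (Fin R.dim) (Fin R.dim) ℂ))
        (actRight _ (R.reply s u I z) (actLeft _ (Z.ack m I) ρ))
  | i :: l, m, s, ρ => ∑ c : Bool, ∑' n : ℕ, ∑' y : R.Y,
      play R Z u l (Z.next i m c n (R.label i s c n y)) (R.next i s c n y)
        (actLeft _ (Z.receive i m c n (R.label i s c n y))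
          (regroup (actRight _ (R.emit i s c n y) (actLeft _ (Z.flag i m c) ρ))))

/-- Probability that the distinguisher outputs `1` when interacting with the system. -/
def acceptProb {𝒰 : Subgroup (Matrix.unitaryGroup (Fin 2) ℂ)} {N K : ℕ} (R : OpenSystem 𝒰 N K)
    (Z : Distinguisher 𝒰 N K) : ℝ≥0∞ :=
  ∫⁻ m, (∫⁻ s, play R Z (Z.input m) (List.finRange N) m s (Z.state m ⊗ₖ R.state s) ∂(R.law))
    ∂(Z.law)

/-- The real world: the honest Sender attached to `N` calls of `WCPGenerator`. There is no quantum
memory (dimension `1`). -/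
def realSystem (𝒰 : Subgroup (Matrix.unitaryGroup (Fin 2) ℂ)) [CompactSpace 𝒰] {N : ℕ} (K : ℕ)
    (ρ₀ : Matrix (Fin 2) (Fin 2) ℂ) (η : ℝ≥0) (μ : Fin N → ℝ≥0) (B : Estimator N) :
    OpenSystem 𝒰 N K where
  S := Equiv.Perm (Fin N) × (Fin N → 𝒰)
  law := senderLaw 𝒰 N
  dim := 1
  state _ := 1
  Y := Option ℕ
  emit i s c n y :=
    (wcpWeight η (permuted μ s.1 i) c n y : ℂ) • appendState (pulse ρ₀ (s.2 i) n)
  label i s _ _ y := wcpLabel (s.2 i) y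
  next _ s _ _ _ := s
  Z := Option (Equiv.Perm (Fin K))
  reply s _ I z := (estimationWeight B s.1 I z : ℂ) • LinearMap.id
  out s u I z := (z.isNone, estimationMsg u s.2 I z)

/-- A simulator attached to the Receiver's interface of `BatchRSP`. It emulates the pulse rounds;
on the acknowledgement it applies an instrument that determines its input `(c, d)` to `BatchRSP`;
it processes the classical reply and the qubits that it gets in return, and sends the last message
to the Receiver. All instruments may have additional outcomes `y`, recorded in the classical memory.
It has no access to the input at the Sender's interface. -/
structure Simulator (𝒰 : Subgroup (Matrix.unitaryGroup (Fin 2) ℂ)) (N K : ℕ) where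
  S : Type
  [measS : MeasurableSpace S]
  law : Measure S
  [law_prob : IsProbabilityMeasure law]
  dim : ℕ
  state : S → Matrix (Fin dim) (Fin dim) ℂ
  state_density : ∀ s, IsDensity (state s)
  state_meas : ∀ i j, Measurable fun s => state s i j
  Y : Type
  [countY : Countable Y]
  emit : Fin N → S → Bool → (n : ℕ) → Y → Op (Fin dim) (Fin dim × Qubits n)
  emit_cp : ∀ i s c n y, IsCP (emit i s c n y)
  emit_trace : ∀ i s c A, HasSum (fun p : ℕ × Y => (emit i s c p.1 p.2 A).trace) A.trace
  emit_meas : ∀ i c n y A a b, Measurable fun s => emit i s c n y A a b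
  label : Fin N → S → Bool → ℕ → Y → Label 𝒰
  label_meas : ∀ i c n y, Measurable fun s => label i s c n y
  next : Fin N → S → Bool → ℕ → Y → S
  next_meas : ∀ i c n y, Measurable fun s => next i s c n y
  request : S → Ack N K → Bool → Bool → Y → Op (Fin dim) (Fin dim)
  request_cp : ∀ s I c d y, IsCP (request s I c d y)
  request_trace : ∀ s I A,
    HasSum (fun p : (Bool × Bool) × Y => (request s I p.1.1 p.1.2 p.2 A).trace) A.trace
  request_meas : ∀ I c d y A a b, Measurable fun s => request s I c d y A a b
  nextRequest : S → Ack N K → Bool → Bool → Y → S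
  nextRequest_meas : ∀ I c d y, Measurable fun s => nextRequest s I c d y
  respond : S → (r : BatchReply 𝒰 K) → Y → Op (Fin dim × Qubits r.qubits) (Fin dim)
  respond_cp : ∀ s r y, IsCP (respond s r y)
  respond_trace : ∀ s r A, HasSum (fun y => (respond s r y A).trace) A.trace
  respond_abort_meas : ∀ y A a b, Measurable fun s => respond s .abort y A a b
  respond_honest_meas : ∀ y A a b, Measurable fun s => respond s .honest y A a b
  respond_leak_meas : ∀ (k : Fin K) (y : Y) (A : Matrix (Fin dim × Qubits 1) (Fin dim × Qubits 1) ℂ)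
    (a b : Fin dim), Measurable fun p : S × ({j : Fin K // j ≠ k} → 𝒰) =>
      respond p.1 (.leak k p.2) y A a b
  message : S → BatchReply 𝒰 K → Y → LastMsg 𝒰 K
  message_abort_meas : ∀ y, Measurable fun s => message s .abort y
  message_honest_meas : ∀ y, Measurable fun s => message s .honest y
  message_leak_meas : ∀ (k : Fin K) (y : Y),
    Measurable fun p : S × ({j : Fin K // j ≠ k} → 𝒰) => message p.1 (.leak k p.2) y

attribute [instance] Simulator.measS Simulator.law_prob Simulator.countY

/-- The ideal world: `BatchRSP` with the simulator attached to its Receiver's interface. In the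
estimation phase the outcome consists of the simulator's input `(c, d)` to `BatchRSP` with its
additional outcome, the uniform index `k` sampled by `BatchRSP`, and the outcome of the simulator's last
instrument. The Sender is notified of an abort exactly if `d = 1`. -/
def idealSystem {𝒰 : Subgroup (Matrix.unitaryGroup (Fin 2) ℂ)} {N K : ℕ}
    (ρ₀ : Matrix (Fin 2) (Fin 2) ℂ) (T : Simulator 𝒰 N K) : OpenSystem 𝒰 N K where
  S := T.S
  law := T.law
  dim := T.dim
  state := T.state
  Y := T.Y
  emit := T.emit
  label := T.label
  next := T.next
  Z := (Bool × Bool) × T.Y × Fin K × T.Y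
  reply s u I z :=
    let r := batchReply u z.1.1 z.1.2 z.2.2.1
    ((K : ℂ)⁻¹) • (T.respond (T.nextRequest s I z.1.1 z.1.2 z.2.1) r z.2.2.2 ∘ₗ
      appendState (batchState ρ₀ u r) ∘ₗ T.request s I z.1.1 z.1.2 z.2.1)
  out s u I z :=
    (z.1.2, T.message (T.nextRequest s I z.1.1 z.1.2 z.2.1)
      (batchReply u z.1.1 z.1.2 z.2.2.1) z.2.2.2)

/-- The protocol `ε`-statistically constructs `BatchRSP` from `WCPGenerator`: with honest parties no
distinguisher has an advantage of more than `ε` between the protocol and `BatchRSP`, and there is one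
simulator such that no distinguisher that controls the Receiver's interface has an advantage of
more than `ε` between the honest Sender with `WCPGenerator` and the simulator with `BatchRSP`. -/
def Constructs (𝒰 : Subgroup (Matrix.unitaryGroup (Fin 2) ℂ)) [CompactSpace 𝒰] {N : ℕ} (K : ℕ)
    (ρ₀ : Matrix (Fin 2) (Fin 2) ℂ) (η : ℝ≥0) (μ : Fin N → ℝ≥0) (B : Estimator N) (ε : ℝ) : Prop :=
  (∀ Z : HonestDistinguisher 𝒰 K,
    |(honestReal ρ₀ η μ B Z).toReal - (honestIdeal ρ₀ Z).toReal| ≤ ε) ∧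
  ∃ T : Simulator 𝒰 N K, ∀ Z : Distinguisher 𝒰 N K,
    |(acceptProb (realSystem 𝒰 K ρ₀ η μ B) Z).toReal -
      (acceptProb (idealSystem ρ₀ T) Z).toReal| ≤ ε

end

end WCP

open WCP

namespace WCP

noncomputable section

/-! ### The Haar measure of a compact group of unitaries -/

section Haar

variable {𝒰 : Subgroup (Matrix.unitaryGroup (Fin 2) ℂ)}

/-! Correctness. If the estimation accepts, the corrections `Ũ_j` cancel the random unitaries and
`σ` is undone, so the output is exactly that of `BatchRSP` (`honestOutput_eq`). The two worlds
differ only on an abort, and the secret permutation turns the abort probability into that of the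
correctness game (`lintegral_abortGiven_comp`).

Security. The simulator postpones the choice of the state sent in the rounds that leak nothing, that
is, with at most one photon and no classical description ("low" rounds). It keeps one qubit per
round, prepared in a uniform superposition. A low one-photon round gets a coherent copy of that
qubit, half of a maximally entangled pair; every other pulse is prepared from the simulator's own
Haar unitary `G i`. If the estimation accepts and some acknowledged round is low, it asks `BatchRSP`
for a leak, draws `σ` so that the unknown state `U_k(ρ₀)` belongs to a low round, and teleports: a
Bell measurement rotated by `G i` is applied to that state, and the corresponding measurement for
the states it can prepare itself. With Pauli outcome `P i` and `V i = G i * (pauli (P i))⁻¹`, a low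
round behaves as if `(V i)⁻¹ * t i` had been applied from the start, and announcing `V i` is exactly
the honest correction for that unitary (`simMessage_leak`). Invariance of Haar measure under
translations and inversion makes these effective unitaries (`twist`) Haar distributed, as in the
real world (`lintegral_twist`).

To make this rigorous against adaptive quantum distinguishers, an interaction is expanded into a sum
over paths, a path recording the flag, photon number and classical outcome of each round. The
amplitude of a path is multilinear in the operators received (`amp`), so teleportation can be
computed round by round (`sum_bit_mul_multilinear`, `sum_teleport_amp`). After averaging, both
worlds agree path by path except when the estimation accepts although no acknowledged round is low
(`lintegral_realTerm_le`, `lintegral_idealTerm_le`).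

It remains to bound this event by the security game. By Poisson thinning the photon numbers `ν` may
be drawn with the full intensities before any flag is chosen, a lossy round then being a random
deletion of photons (`ofReal_wcpWeight`). Given `ν`, the acknowledgement is independent of `π`
(`tsum_pathWeight_mul_failTerm_le`). Averaging over `π` leaves a weight that depends only on how
many pulses of each photon number exist and how many are acknowledged
(`orbitWeight_eq_of_profile_eq`), so a deterministic map `D` that maximises it is at least as good
as any adaptive attack (`exists_strategy_le_gameSimFail`). -/

instance : SecondCountableTopology (Matrix (Fin 2) (Fin 2) ℂ) :=
  inferInstanceAs (SecondCountableTopology (Fin 2 → Fin 2 → ℂ))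

instance : SecondCountableTopology 𝒰 :=
  (Topology.IsInducing.subtypeVal.comp Topology.IsInducing.subtypeVal :
    Topology.IsInducing fun U : 𝒰 => (U.1.1 : Matrix (Fin 2) (Fin 2) ℂ)).secondCountableTopology

instance [CompactSpace 𝒰] : IsProbabilityMeasure (haar 𝒰) :=
  ⟨by unfold haar; simpa using Measure.haarMeasure_self (G := 𝒰) (K₀ := ⊤)⟩

instance [CompactSpace 𝒰] : (haar 𝒰).IsHaarMeasure := by unfold haar; infer_instance

/-- Compact groups are unimodular: a right translate of Haar measure is again a left Haar
probability measure, and that is unique. The same uniqueness gives invariance under inversion below.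
Both are needed to see that teleportation leaves the law of the unitaries unchanged. -/
instance [CompactSpace 𝒰] : (haar 𝒰).IsMulRightInvariant := by
  refine ⟨fun g => ?_⟩
  have : IsProbabilityMeasure ((haar 𝒰).map (· * g)) :=
    Measure.isProbabilityMeasure_map (measurable_mul_const g).aemeasurable
  have : ((haar 𝒰).map (· * g)).IsHaarMeasure := inferInstance
  exact Measure.isHaarMeasure_eq_of_isProbabilityMeasure _ _

instance [CompactSpace 𝒰] : (haar 𝒰).IsInvInvariant := by
  refine ⟨?_⟩
  have : IsProbabilityMeasure (haar 𝒰).inv :=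
    Measure.isProbabilityMeasure_map measurable_inv.aemeasurable
  have : (haar 𝒰).inv.IsOpenPosMeasure := ⟨fun U hU hne => by
    rw [Measure.inv_apply]
    exact hU.inv.measure_ne_zero _ hne.inv⟩
  have : (haar 𝒰).inv.IsHaarMeasure := {}
  exact Measure.isHaarMeasure_eq_of_isProbabilityMeasure _ _

@[fun_prop]
theorem measurable_entry (a b : Fin 2) :
    Measurable fun U : 𝒰 => (U.1 : Matrix (Fin 2) (Fin 2) ℂ) a b := by
  apply Continuous.measurable
  exact (continuous_subtype_val.comp continuous_subtype_val).matrix_elem a b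

end Haar

/-! ### Positivity and traces -/

section Linear

open Matrix

open scoped MatrixOrder Matrix.Norms.L2Operator in
theorem exists_conjTranspose_mul_self {a : Type*} [Fintype a] [DecidableEq a] {E : Matrix a a ℂ}
    (hE : E.PosSemidef) : ∃ C : Matrix a a ℂ, E = C.conjTranspose * C :=
  CStarAlgebra.nonneg_iff_eq_star_mul_self.mp hE.nonneg

/-- Iterated Schur product theorem, starting from the all-ones matrix. -/
theorem posSemidef_prod {ι κ : Type*} (s : Finset ι) (A : ι → Matrix κ κ ℂ)
    (hA : ∀ i ∈ s, (A i).PosSemidef) :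
    (Matrix.of fun x y => ∏ i ∈ s, A i x y).PosSemidef := by
  classical
  induction s using Finset.induction_on with
  | empty =>
    have h := (PosSemidef.one : (1 : Matrix Unit Unit ℂ).PosSemidef).submatrix
      (fun _ : κ => ())
    convert h using 1
    ext; simp
  | insert i s hi ih =>
    have h := (hA i (by simp)).hadamard (ih fun j hj => hA j (by simp [hj]))
    rw [show (Matrix.of fun x y => ∏ j ∈ insert i s, A j x y) =
      A i ⊙ (Matrix.of fun x y => ∏ j ∈ s, A j x y) by ext; simp [Finset.prod_insert hi]]
    exact h

theorem posSemidef_prodState {n : ℕ} (τ : Fin n → Matrix (Fin 2) (Fin 2) ℂ)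
    (hτ : ∀ i, (τ i).PosSemidef) : (prodState τ).PosSemidef :=
  posSemidef_prod Finset.univ (fun i => (τ i).submatrix (fun x : Qubits n => x i) (fun x => x i))
    fun i _ => (hτ i).submatrix _

theorem trace_prodState {n : ℕ} (τ : Fin n → Matrix (Fin 2) (Fin 2) ℂ) :
    (prodState τ).trace = ∏ i, (τ i).trace := by
  simp only [Matrix.trace, Matrix.diag, prodState, Matrix.of_apply]
  rw [Finset.prod_univ_sum]
  simp

theorem posSemidef_conjU {𝒰 : Subgroup (Matrix.unitaryGroup (Fin 2) ℂ)} (U : 𝒰)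
    {ρ : Matrix (Fin 2) (Fin 2) ℂ} (hρ : ρ.PosSemidef) : (conjU U ρ).PosSemidef :=
  hρ.mul_mul_conjTranspose_same _

theorem conjTranspose_mul_self {𝒰 : Subgroup (Matrix.unitaryGroup (Fin 2) ℂ)} (U : 𝒰) :
    (U.1 : Matrix (Fin 2) (Fin 2) ℂ).conjTranspose * U.1 = 1 :=
  Matrix.mem_unitaryGroup_iff'.1 U.1.2

theorem mul_conjTranspose_self {𝒰 : Subgroup (Matrix.unitaryGroup (Fin 2) ℂ)} (U : 𝒰) :
    (U.1 : Matrix (Fin 2) (Fin 2) ℂ) * (U.1 : Matrix (Fin 2) (Fin 2) ℂ).conjTranspose = 1 :=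
  Matrix.mem_unitaryGroup_iff.1 U.1.2

theorem trace_conjU {𝒰 : Subgroup (Matrix.unitaryGroup (Fin 2) ℂ)} (U : 𝒰)
    (ρ : Matrix (Fin 2) (Fin 2) ℂ) : (conjU U ρ).trace = ρ.trace := by
  rw [conjU, Matrix.trace_mul_comm, ← Matrix.mul_assoc, conjTranspose_mul_self, Matrix.one_mul]

theorem conjU_mul {𝒰 : Subgroup (Matrix.unitaryGroup (Fin 2) ℂ)} (U V : 𝒰)
    (ρ : Matrix (Fin 2) (Fin 2) ℂ) : conjU (U * V) ρ = conjU U (conjU V ρ) := by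
  simp [conjU, Matrix.mul_assoc]

theorem isDensity_pulse {𝒰 : Subgroup (Matrix.unitaryGroup (Fin 2) ℂ)}
    {ρ : Matrix (Fin 2) (Fin 2) ℂ} (hρ : IsDensity ρ) (U : 𝒰) (n : ℕ) :
    IsDensity (pulse ρ U n) :=
  ⟨posSemidef_prodState _ fun _ => posSemidef_conjU U hρ.1, by
    simp [pulse, trace_prodState, trace_conjU, hρ.2]⟩

theorem trace_mul_re_nonneg {a : Type*} [Fintype a] {E ρ : Matrix a a ℂ}
    (hE : E.PosSemidef) (hρ : ρ.PosSemidef) : 0 ≤ (E * ρ).trace.re := by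
  classical
  obtain ⟨C, rfl⟩ := exists_conjTranspose_mul_self hE
  have h := (hρ.mul_mul_conjTranspose_same C).trace_nonneg
  rw [Matrix.mul_assoc, Matrix.trace_mul_comm]
  exact (Complex.le_def.1 h).1

theorem IsCP.posSemidef {a b : Type} {Φ : Op a b} (hΦ : IsCP Φ) {A : Matrix a a ℂ}
    (hA : A.PosSemidef) : (Φ A).PosSemidef :=
  (hΦ 1 (A.submatrix Prod.fst Prod.fst) (hA.submatrix _)).submatrix fun i => (i, 0)

theorem isCP_smul_id {a : Type} {c : ℝ} (hc : 0 ≤ c) :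
    IsCP ((c : ℂ) • (LinearMap.id : Op a a)) := by
  intro k A hA
  have : actLeft (Fin k) ((c : ℂ) • (LinearMap.id : Op a a)) A = (c : ℂ) • A := by
    ext p q; simp [actLeft]
  rw [this]
  exact hA.smul (by exact_mod_cast hc)

/-- The operation that acts on the matrix units by `|x⟩⟨y| ↦ |x⟩⟨y| ⊗ κ x y`. -/
def blockEmit {D q : Type} (κ : D → D → Matrix q q ℂ) : Op D (D × q) where
  toFun A := Matrix.of fun p r => A p.1 r.1 * κ p.1 r.1 p.2 r.2
  map_add' A B := by ext; simp [add_mul]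
  map_smul' c A := by ext; simp [mul_assoc]

/-- With an ancilla, the output is the entrywise product of an inflated copy of the input and an
inflated copy of the kernel, so the Schur product theorem applies. -/
theorem isCP_blockEmit {D q : Type} {κ : D → D → Matrix q q ℂ}
    (hκ : (Matrix.of fun p r : D × q => κ p.1 r.1 p.2 r.2).PosSemidef) : IsCP (blockEmit κ) := by
  intro k A hA
  exact (hA.submatrix fun p : (D × q) × Fin k => (p.1.1, p.2)).hadamard
    (hκ.submatrix fun p : (D × q) × Fin k => p.1)

/-- Measure the effect `E` and prepare the state `ω`. -/
def measurePrepare {a b : Type} [Fintype a] (E : Matrix a a ℂ) (ω : Matrix b b ℂ) : Op a b where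
  toFun A := (E * A).trace • ω
  map_add' A B := by simp [mul_add, add_smul]
  map_smul' c A := by simp [mul_smul]

theorem isCP_measurePrepare {a b : Type} [Fintype a] {E : Matrix a a ℂ} {ω : Matrix b b ℂ}
    (hE : E.PosSemidef) (hω : ω.PosSemidef) : IsCP (measurePrepare E ω) := by
  classical
  intro k A hA
  obtain ⟨C, rfl⟩ := exists_conjTranspose_mul_self hE
  -- The partial trace of `(E ⊗ 1) A` over the first factor, with `E = C† C`, is a sum of
  -- compressions of `A` by the rows of `C` tensored with the identity of the ancilla.
  have h : (∑ i : a, Matrix.conjTranspose (Matrix.of fun (p : a × Fin k) (κ : Fin k) =>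
      if p.2 = κ then star (C i p.1) else 0) * A * (Matrix.of fun (p : a × Fin k) (κ : Fin k) =>
      if p.2 = κ then star (C i p.1) else 0)).PosSemidef :=
    posSemidef_sum _ fun i _ => hA.conjTranspose_mul_mul_same _
  rw [show actLeft (Fin k) (measurePrepare (C.conjTranspose * C) ω) A = (Matrix.submatrix
    (∑ i : a, Matrix.conjTranspose (Matrix.of fun (p : a × Fin k) (κ : Fin k) =>
      if p.2 = κ then star (C i p.1) else 0) * A * (Matrix.of fun (p : a × Fin k) (κ : Fin k) =>
      if p.2 = κ then star (C i p.1) else 0)) Prod.snd Prod.snd) ⊙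
      (ω.submatrix Prod.fst Prod.fst) by
    ext p q
    simp only [actLeft, measurePrepare, LinearMap.coe_mk, AddHom.coe_mk, Matrix.of_apply,
      Matrix.smul_apply, smul_eq_mul, Matrix.hadamard_apply, Matrix.submatrix_apply,
      Matrix.sum_apply]
    congr 1
    rw [Matrix.mul_assoc, Matrix.trace_mul_comm]
    simp only [Matrix.trace, Matrix.diag, Matrix.mul_apply, Matrix.conjTranspose_apply,
      Matrix.of_apply, Fintype.sum_prod_type, apply_ite star, star_star, star_zero, ite_mul,
      zero_mul, mul_ite, mul_zero, Finset.sum_ite_eq', Finset.mem_univ, if_true]]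
  exact (h.submatrix _).hadamard (hω.submatrix _)

theorem prob_le_of_isEffect {a : Type} [Fintype a] [DecidableEq a] {E ρ : Matrix a a ℂ}
    (hE : IsEffect E) (hρ : ρ.PosSemidef) : prob E ρ ≤ ENNReal.ofReal ρ.trace.re := by
  apply ENNReal.ofReal_le_ofReal
  have h := trace_mul_re_nonneg hE.2 hρ
  rw [sub_mul, Matrix.one_mul, Matrix.trace_sub, Complex.sub_re] at h
  linarith

theorem prob_le_one {a : Type} [Fintype a] [DecidableEq a] {E ρ : Matrix a a ℂ}
    (hE : IsEffect E) (hρ : IsDensity ρ) : prob E ρ ≤ 1 :=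
  (prob_le_of_isEffect hE hρ.1).trans (by simp [hρ.2])

/-- The block of a matrix on `ℂ^a ⊗ ℂ^k` with indices `x` and `y` in the second factor. -/
def block {a k : Type} (A : Matrix (a × k) (a × k) ℂ) (x y : k) : Matrix a a ℂ :=
  Matrix.of fun i j => A (i, x) (j, y)

/-- The system's memory is discarded after its last operation, so that operation matters only
through the functional `tr ∘ Φ`, described by the coefficients `e`. -/
theorem trace_kronecker_one_mul_actRight {d k : Type} [Fintype d] [Fintype k] [DecidableEq k]
    (g : Matrix d d ℂ) {Φ : Op k k} {e : k → k → ℂ}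
    (hΦ : ∀ B, (Φ B).trace = ∑ x, ∑ y, B x y * e x y) (A : Matrix (d × k) (d × k) ℂ) :
    ((g ⊗ₖ (1 : Matrix k k ℂ)) * actRight d Φ A).trace =
      ∑ x, ∑ y, e x y * (g * block A x y).trace := by
  have h1 : ((g ⊗ₖ (1 : Matrix k k ℂ)) * actRight d Φ A).trace =
      ∑ i, ∑ j, g i j * (Φ (Matrix.of fun x y => A (j, x) (i, y))).trace := by
    simp only [Matrix.trace, Matrix.diag, Matrix.mul_apply, Fintype.sum_prod_type,
      Matrix.kroneckerMap_apply, Matrix.one_apply, actRight, Matrix.of_apply, mul_ite, mul_one,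
      mul_zero, ite_mul, zero_mul, Finset.sum_ite_eq, Finset.mem_univ, if_true]
    refine Finset.sum_congr rfl fun i _ => ?_
    rw [Finset.sum_comm]
    simp only [Finset.mul_sum]
  rw [h1]
  simp only [hΦ]
  simp only [Matrix.of_apply, Matrix.trace, Matrix.diag, Matrix.mul_apply, block, Finset.mul_sum]
  calc _ = ∑ i, ∑ x, ∑ j, ∑ y, g i j * (A (j, x) (i, y) * e x y) :=
        Finset.sum_congr rfl fun _ _ => Finset.sum_comm
    _ = ∑ x, ∑ i, ∑ j, ∑ y, g i j * (A (j, x) (i, y) * e x y) := Finset.sum_comm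
    _ = ∑ x, ∑ i, ∑ y, ∑ j, g i j * (A (j, x) (i, y) * e x y) :=
        Finset.sum_congr rfl fun _ _ => Finset.sum_congr rfl fun _ _ => Finset.sum_comm
    _ = ∑ x, ∑ y, ∑ i, ∑ j, g i j * (A (j, x) (i, y) * e x y) :=
        Finset.sum_congr rfl fun _ _ => Finset.sum_comm
    _ = _ := by
      refine Finset.sum_congr rfl fun _ _ => Finset.sum_congr rfl fun _ _ =>
        Finset.sum_congr rfl fun _ _ => Finset.sum_congr rfl fun _ _ => by ring

end Linear

/-! ### Expansion of an interaction into paths -/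

section Paths

variable {𝒰 : Subgroup (Matrix.unitaryGroup (Fin 2) ℂ)} {N K : ℕ}

/-- The flags, photon numbers and classical outcomes of all pulse rounds. -/
abbrev Path (N : ℕ) : Type := Fin N → Bool × ℕ × Option ℕ

/-- Sum over all values of a path in the rounds of a list. -/
def pathSum : List (Fin N) → Path N → (Path N → ℝ≥0∞) → ℝ≥0∞
  | [], h, f => f h
  | i :: l, h, f => ∑ c : Bool, ∑' n : ℕ, ∑' y : Option ℕ,
      pathSum l (Function.update h i (c, n, y)) f

theorem sum_tsum_tsum (f : Bool × ℕ × Option ℕ → ℝ≥0∞) :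
    ∑ c : Bool, ∑' n : ℕ, ∑' y : Option ℕ, f (c, n, y) = ∑' o, f o := by
  rw [ENNReal.tsum_prod', tsum_fintype]
  exact Finset.sum_congr rfl fun c _ => (ENNReal.tsum_prod' (f := fun p => f (c, p))).symm

theorem pathSum_congr (l : List (Fin N)) (h : Path N) {f g : Path N → ℝ≥0∞}
    (hfg : ∀ h', (∀ i ∉ l, h' i = h i) → f h' = g h') : pathSum l h f = pathSum l h g := by
  induction l generalizing h with
  | nil => exact hfg h fun _ _ => rfl
  | cons i l ih =>
    simp only [pathSum]
    refine Finset.sum_congr rfl fun c _ => tsum_congr fun n => tsum_congr fun y => ih _ ?_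
    intro h' hh
    refine hfg h' fun j hj => ?_
    rw [hh j fun hjl => hj (List.mem_cons_of_mem _ hjl), Function.update_of_ne]
    rintro rfl
    exact hj List.mem_cons_self

theorem pathSum_mul_left (l : List (Fin N)) (h : Path N) (a : ℝ≥0∞) (f : Path N → ℝ≥0∞) :
    (pathSum l h fun h' => a * f h') = a * pathSum l h f := by
  induction l generalizing h with
  | nil => rfl
  | cons i l ih => simp only [pathSum, ih, ENNReal.tsum_mul_left, Finset.mul_sum]

/-- Without repetitions in the list each round is summed over once, so the nested sums range over
the paths that agree with `h` elsewhere. -/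
theorem pathSum_eq_tsum_ite (l : List (Fin N)) (hl : l.Nodup) (h : Path N)
    (f : Path N → ℝ≥0∞) :
    pathSum l h f = ∑' h', open Classical in if ∀ i ∉ l, h' i = h i then f h' else 0 := by
  classical
  induction l generalizing h with
  | nil =>
    rw [tsum_eq_single h]
    · simp [pathSum]
    · intro h' hne
      rw [if_neg]
      intro hh
      exact hne (funext fun i => hh i (by simp))
  | cons j l ih =>
    have hj := (List.nodup_cons.1 hl).1
    simp only [pathSum]
    simp_rw [ih (List.nodup_cons.1 hl).2]
    rw [sum_tsum_tsum fun o => ∑' h' : Path N,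
      if ∀ i ∉ l, h' i = Function.update h j o i then f h' else 0]
    rw [ENNReal.tsum_comm]
    refine tsum_congr fun h' => ?_
    rw [tsum_eq_single (h' j)]
    · refine if_congr ?_ rfl rfl
      constructor
      · intro hh i hi
        rw [hh i fun hil => hi (List.mem_cons_of_mem _ hil), Function.update_of_ne]
        rintro rfl
        exact hi List.mem_cons_self
      · intro hh i hi
        rcases eq_or_ne i j with rfl | hij
        · simp
        · rw [Function.update_of_ne hij]
          exact hh i (by simp [hij, hi])
    · intro o ho
      rw [if_neg]
      intro hh
      have := hh j hj
      simp at this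
      exact ho this.symm

theorem pathSum_finRange (h : Path N) (f : Path N → ℝ≥0∞) :
    pathSum (List.finRange N) h f = ∑' h', f h' := by
  rw [pathSum_eq_tsum_ite _ (List.nodup_finRange N)]
  simp

/-- The classical memory of the distinguisher after the rounds of a list, along a path. -/
def memAfter (Z : Distinguisher 𝒰 N K) (h : Path N) (U : Fin N → 𝒰) :
    List (Fin N) → Z.M → Z.M
  | [], m => m
  | i :: l, m => memAfter Z h U l (Z.next i m (h i).1 (h i).2.1 (wcpLabel (U i) (h i).2.2))

/-- The quantum memory of the distinguisher after the rounds of a list, along a path, when it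
receives the operators `τ i` as pulses. -/
def opAfter (Z : Distinguisher 𝒰 N K) (h : Path N) (U : Fin N → 𝒰)
    (τ : (i : Fin N) → Matrix (Qubits (h i).2.1) (Qubits (h i).2.1) ℂ) :
    List (Fin N) → Z.M → Matrix (Fin Z.dim) (Fin Z.dim) ℂ → Matrix (Fin Z.dim) (Fin Z.dim) ℂ
  | [], _, A => A
  | i :: l, m, A => opAfter Z h U τ l (Z.next i m (h i).1 (h i).2.1 (wcpLabel (U i) (h i).2.2))
      (Z.receive i m (h i).1 (h i).2.1 (wcpLabel (U i) (h i).2.2) (Z.flag i m (h i).1 A ⊗ₖ τ i))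

/-- The classical memory of a system after the rounds of a list, along a path. -/
def sysAfter (R : OpenSystem 𝒰 N K) (ι : Option ℕ → R.Y) (h : Path N) : List (Fin N) → R.S → R.S
  | [], s => s
  | i :: l, s => sysAfter R ι h l (R.next i s (h i).1 (h i).2.1 (ι (h i).2.2))

/-- Apart from the pulses themselves, unitaries reach the distinguisher only through labels. This
later permits replacing the simulator's unitaries by the effective ones in rounds that carry no
description. -/
theorem memAfter_congr (Z : Distinguisher 𝒰 N K) (h : Path N) {U V : Fin N → 𝒰}
    (hUV : ∀ i, wcpLabel (U i) (h i).2.2 = wcpLabel (V i) (h i).2.2) (l : List (Fin N)) (m : Z.M) :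
    memAfter Z h U l m = memAfter Z h V l m := by
  induction l generalizing m with
  | nil => rfl
  | cons i l ih => simp only [memAfter, hUV, ih]

theorem opAfter_congr (Z : Distinguisher 𝒰 N K) (h : Path N) {U V : Fin N → 𝒰}
    (hUV : ∀ i, wcpLabel (U i) (h i).2.2 = wcpLabel (V i) (h i).2.2)
    (τ : (i : Fin N) → Matrix (Qubits (h i).2.1) (Qubits (h i).2.1) ℂ) (l : List (Fin N)) (m : Z.M)
    (A : Matrix (Fin Z.dim) (Fin Z.dim) ℂ) :
    opAfter Z h U τ l m A = opAfter Z h V τ l m A := by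
  induction l generalizing m A with
  | nil => rfl
  | cons i l ih => simp only [opAfter, hUV, ih]

theorem actLeft_zero {a b k : Type} (Φ : Op a b) : actLeft k Φ 0 = 0 := by
  ext p q
  change Φ 0 p.1 q.1 = 0
  simp

theorem actRight_zero {a b k : Type} (Φ : Op a b) : actRight k Φ 0 = 0 := by
  ext p q
  change Φ 0 p.2 q.2 = 0
  simp

theorem play_zero (R : OpenSystem 𝒰 N K) (Z : Distinguisher 𝒰 N K) (u : Fin K → 𝒰)
    (l : List (Fin N)) (m : Z.M) (s : R.S) : play R Z u l m s 0 = 0 := by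
  induction l generalizing m s with
  | nil => simp [play, actLeft_zero, actRight_zero, prob]
  | cons i l ih =>
    have h0 : ∀ n, regroup (D := Fin Z.dim) (d := Fin R.dim) (q := Qubits n) 0 = 0 := fun n => rfl
    simp [play, actLeft_zero, actRight_zero, h0, ih]

/-- A system whose rounds depend only on a constant part of its memory, and whose emissions act on
matrix units of its quantum memory by appending operators. -/
structure IsBlockSystem (R : OpenSystem 𝒰 N K) (β : R.S → Equiv.Perm (Fin N) × (Fin N → 𝒰))
    (ι : Option ℕ → R.Y) (κ : Fin N → Equiv.Perm (Fin N) × (Fin N → 𝒰) → Bool → (n : ℕ) →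
      Option ℕ → Fin R.dim → Fin R.dim → Matrix (Qubits n) (Qubits n) ℂ) : Prop where
  inj : Function.Injective ι
  emit : ∀ i s c n y, R.emit i s c n (ι y) = blockEmit (κ i (β s) c n y)
  emit_zero : ∀ i s c n y, y ∉ Set.range ι → R.emit i s c n y = 0
  label : ∀ i s c n y, R.label i s c n (ι y) = wcpLabel ((β s).2 i) y
  next : ∀ i s c n y, β (R.next i s c n (ι y)) = β s

variable {R : OpenSystem 𝒰 N K} {β : R.S → Equiv.Perm (Fin N) × (Fin N → 𝒰)}
  {ι : Option ℕ → R.Y} {κ : Fin N → Equiv.Perm (Fin N) × (Fin N → 𝒰) → Bool → (n : ℕ) →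
      Option ℕ → Fin R.dim → Fin R.dim → Matrix (Qubits n) (Qubits n) ℂ}

/-- The emission never mixes matrix units of the system's memory, so each block `(x, y)` of the
joint state evolves separately, as if the operator `κ x y` had been received as the pulse. -/
theorem IsBlockSystem.play_cons (hR : IsBlockSystem R β ι κ) (Z : Distinguisher 𝒰 N K)
    (u : Fin K → 𝒰) (i : Fin N) (l : List (Fin N)) (m : Z.M) (s : R.S)
    (ρ : Matrix (Fin Z.dim × Fin R.dim) (Fin Z.dim × Fin R.dim) ℂ) :
    play R Z u (i :: l) m s ρ = ∑ c : Bool, ∑' n : ℕ, ∑' y : Option ℕ,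
      play R Z u l (Z.next i m c n (wcpLabel ((β s).2 i) y)) (R.next i s c n (ι y))
        (Matrix.of fun p q => (Z.receive i m c n (wcpLabel ((β s).2 i) y)
          (Z.flag i m c (block ρ p.2 q.2) ⊗ₖ κ i (β s) c n y p.2 q.2)) p.1 q.1) := by
  rw [play]
  refine Finset.sum_congr rfl fun c _ => tsum_congr fun n => ?_
  -- Outcomes outside the range of `ι` have the zero operation and contribute nothing, so the sum
  -- over `R.Y` reduces to one over `Option ℕ`.
  rw [← hR.inj.tsum_eq]
  · refine tsum_congr fun y => ?_
    rw [hR.label, hR.emit]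
    congr 1
  · intro y hy
    by_contra hy'
    refine hy ?_
    have h0 : ∀ A, actRight (b := Fin R.dim × Qubits n) (Fin Z.dim) (0 : Op (Fin R.dim) _) A = 0 :=
      fun A => rfl
    have h1 : regroup (D := Fin Z.dim) (d := Fin R.dim) (q := Qubits n) 0 = 0 := rfl
    beta_reduce
    rw [hR.emit_zero i s c n y hy', h0, h1, actLeft_zero, play_zero]

theorem IsBlockSystem.play_eq_pathSum (hR : IsBlockSystem R β ι κ) (Z : Distinguisher 𝒰 N K)
    (u : Fin K → 𝒰) (l : List (Fin N)) (hl : l.Nodup) (h₀ : Path N) (m : Z.M) (s : R.S)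
    (ρ : Matrix (Fin Z.dim × Fin R.dim) (Fin Z.dim × Fin R.dim) ℂ) :
    play R Z u l m s ρ = pathSum l h₀ fun h =>
      play R Z u [] (memAfter Z h (β s).2 l m) (sysAfter R ι h l s)
        (Matrix.of fun p q => opAfter Z h (β s).2
          (fun i => κ i (β s) (h i).1 (h i).2.1 (h i).2.2 p.2 q.2) l m (block ρ p.2 q.2)
            p.1 q.1) := by
  induction l generalizing h₀ m s ρ with
  | nil => rfl
  | cons i l ih =>
    obtain ⟨hi, hl⟩ := List.nodup_cons.1 hl
    rw [hR.play_cons, pathSum]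
    refine Finset.sum_congr rfl fun c _ => tsum_congr fun n => tsum_congr fun y => ?_
    rw [ih hl (Function.update h₀ i (c, n, y))]
    refine pathSum_congr _ _ fun h' hh => ?_
    have hhi : h' i = (c, n, y) := by rw [hh i hi, Function.update_self]
    -- The type of a pulse depends on its photon number; expressing `c`, `n`, `y` through the path
    -- makes both sides live in the same types.
    obtain rfl : c = (h' i).1 := by rw [hhi]
    obtain rfl : n = (h' i).2.1 := by rw [hhi]
    obtain rfl : y = (h' i).2.2 := by rw [hhi]
    simp only [memAfter, sysAfter, opAfter, hR.next]
    rfl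

end Paths

/-! ### Amplitudes of paths -/

section Amplitudes

variable {𝒰 : Subgroup (Matrix.unitaryGroup (Fin 2) ℂ)} {N K : ℕ}

theorem opAfter_add (Z : Distinguisher 𝒰 N K) (h : Path N) (U : Fin N → 𝒰)
    (τ : (i : Fin N) → Matrix (Qubits (h i).2.1) (Qubits (h i).2.1) ℂ) (l : List (Fin N)) (m : Z.M)
    (A B : Matrix (Fin Z.dim) (Fin Z.dim) ℂ) :
    opAfter Z h U τ l m (A + B) = opAfter Z h U τ l m A + opAfter Z h U τ l m B := by
  induction l generalizing m A B with
  | nil => rfl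
  | cons i l ih => simp only [opAfter, map_add, Matrix.add_kronecker, ih]

theorem opAfter_smul (Z : Distinguisher 𝒰 N K) (h : Path N) (U : Fin N → 𝒰)
    (τ : (i : Fin N) → Matrix (Qubits (h i).2.1) (Qubits (h i).2.1) ℂ) (l : List (Fin N)) (m : Z.M)
    (c : ℂ) (A : Matrix (Fin Z.dim) (Fin Z.dim) ℂ) :
    opAfter Z h U τ l m (c • A) = c • opAfter Z h U τ l m A := by
  induction l generalizing m A with
  | nil => rfl
  | cons i l ih => simp only [opAfter, map_smul, Matrix.smul_kronecker, ih]

theorem opAfter_update_of_notMem (Z : Distinguisher 𝒰 N K) (h : Path N) (U : Fin N → 𝒰)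
    (τ : (i : Fin N) → Matrix (Qubits (h i).2.1) (Qubits (h i).2.1) ℂ) (l : List (Fin N)) (m : Z.M)
    (A : Matrix (Fin Z.dim) (Fin Z.dim) ℂ) (j : Fin N) (hj : j ∉ l)
    (T : Matrix (Qubits (h j).2.1) (Qubits (h j).2.1) ℂ) :
    opAfter Z h U (Function.update τ j T) l m A = opAfter Z h U τ l m A := by
  induction l generalizing m A with
  | nil => rfl
  | cons i l ih =>
    rw [List.mem_cons, not_or] at hj
    simp only [opAfter, Function.update_of_ne (Ne.symm hj.1), ih _ _ hj.2]

/-- Each pulse is used exactly once when the list has no repetitions, which is why the result is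
linear in it. Additivity and homogeneity in each round make `amp` a multilinear map. -/
theorem opAfter_update_add (Z : Distinguisher 𝒰 N K) (h : Path N) (U : Fin N → 𝒰)
    (τ : (i : Fin N) → Matrix (Qubits (h i).2.1) (Qubits (h i).2.1) ℂ) (l : List (Fin N))
    (hl : l.Nodup) (m : Z.M) (A : Matrix (Fin Z.dim) (Fin Z.dim) ℂ) (j : Fin N) (hj : j ∈ l)
    (S T : Matrix (Qubits (h j).2.1) (Qubits (h j).2.1) ℂ) :
    opAfter Z h U (Function.update τ j (S + T)) l m A =
      opAfter Z h U (Function.update τ j S) l m A +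
        opAfter Z h U (Function.update τ j T) l m A := by
  induction l generalizing m A with
  | nil => simp at hj
  | cons i l ih =>
    obtain ⟨hi, hl⟩ := List.nodup_cons.1 hl
    rcases eq_or_ne i j with rfl | hij
    · simp only [opAfter, Function.update_self, Matrix.kronecker_add, map_add, opAfter_add,
        opAfter_update_of_notMem Z h U τ l _ _ i hi]
    · simp only [opAfter, Function.update_of_ne hij]
      exact ih hl _ _ ((List.mem_cons.1 hj).resolve_left hij.symm)

theorem opAfter_update_smul (Z : Distinguisher 𝒰 N K) (h : Path N) (U : Fin N → 𝒰)
    (τ : (i : Fin N) → Matrix (Qubits (h i).2.1) (Qubits (h i).2.1) ℂ) (l : List (Fin N))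
    (hl : l.Nodup) (m : Z.M) (A : Matrix (Fin Z.dim) (Fin Z.dim) ℂ) (j : Fin N) (hj : j ∈ l)
    (c : ℂ) (T : Matrix (Qubits (h j).2.1) (Qubits (h j).2.1) ℂ) :
    opAfter Z h U (Function.update τ j (c • T)) l m A =
      c • opAfter Z h U (Function.update τ j T) l m A := by
  induction l generalizing m A with
  | nil => simp at hj
  | cons i l ih =>
    obtain ⟨hi, hl⟩ := List.nodup_cons.1 hl
    rcases eq_or_ne i j with rfl | hij
    · simp only [opAfter, Function.update_self, Matrix.kronecker_smul, map_smul, opAfter_smul,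
        opAfter_update_of_notMem Z h U τ l _ _ i hi]
    · simp only [opAfter, Function.update_of_ne hij]
      exact ih hl _ _ ((List.mem_cons.1 hj).resolve_left hij.symm)

/-- The trace that gives the probability of the path `h`, the acknowledgement `I` and the final
message `x`, as a multilinear function of the operators received as pulses. -/
def amp (Z : Distinguisher 𝒰 N K) (h : Path N) (U : Fin N → 𝒰) (m : Z.M)
    (A : Matrix (Fin Z.dim) (Fin Z.dim) ℂ) (I : Ack N K) (x : Bool × LastMsg 𝒰 K) :
    MultilinearMap ℂ (fun i : Fin N => Matrix (Qubits (h i).2.1) (Qubits (h i).2.1) ℂ) ℂ where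
  toFun τ := (Z.guess (memAfter Z h U (List.finRange N) m) I x *
    Z.ack (memAfter Z h U (List.finRange N) m) I
      (opAfter Z h U τ (List.finRange N) m A)).trace
  map_update_add' := by
    intro inst τ i S T
    rw [Subsingleton.elim inst (instDecidableEqFin N)]
    rw [opAfter_update_add _ _ _ _ _ (List.nodup_finRange N) _ _ _ (List.mem_finRange i),
      map_add, Matrix.mul_add, Matrix.trace_add]
  map_update_smul' := by
    intro inst τ i c T
    rw [Subsingleton.elim inst (instDecidableEqFin N)]
    rw [opAfter_update_smul _ _ _ _ _ (List.nodup_finRange N) _ _ _ (List.mem_finRange i),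
      map_smul, Matrix.mul_smul, Matrix.trace_smul]

theorem amp_congr (Z : Distinguisher 𝒰 N K) (h : Path N) {U V : Fin N → 𝒰}
    (hUV : ∀ i, wcpLabel (U i) (h i).2.2 = wcpLabel (V i) (h i).2.2) (m : Z.M)
    (A : Matrix (Fin Z.dim) (Fin Z.dim) ℂ) (I : Ack N K) (x : Bool × LastMsg 𝒰 K) :
    amp Z h U m A I x = amp Z h V m A I x := by
  ext τ
  simp only [amp, memAfter_congr Z h hUV, opAfter_congr Z h hUV]

theorem play_nil (R : OpenSystem 𝒰 N K) (Z : Distinguisher 𝒰 N K) (u : Fin K → 𝒰) (m : Z.M)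
    (s : R.S) {e : Ack N K → R.Z → Fin R.dim → Fin R.dim → ℂ}
    (he : ∀ I z B, (R.reply s u I z B).trace = ∑ x, ∑ y, B x y * e I z x y)
    (ρ : Matrix (Fin Z.dim × Fin R.dim) (Fin Z.dim × Fin R.dim) ℂ) :
    play R Z u [] m s ρ = ∑ I, ∑' z, ENNReal.ofReal
      (∑ x, ∑ y, e I z x y * (Z.guess m I (R.out s u I z) * Z.ack m I (block ρ x y)).trace).re := by
  rw [play]
  refine Finset.sum_congr rfl fun I _ => tsum_congr fun z => ?_
  rw [prob, trace_kronecker_one_mul_actRight _ (he I z)]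
  rfl

/-- For a product initial state every block is the scalar `ω x y` times `A`. The system then enters
a path only through the scalars `e`, `ω` and the kernels inserted into the multilinear `amp`. -/
theorem IsBlockSystem.play_eq_tsum {R : OpenSystem 𝒰 N K}
    {β : R.S → Equiv.Perm (Fin N) × (Fin N → 𝒰)} {ι : Option ℕ → R.Y}
    {κ : Fin N → Equiv.Perm (Fin N) × (Fin N → 𝒰) → Bool → (n : ℕ) →
      Option ℕ → Fin R.dim → Fin R.dim → Matrix (Qubits n) (Qubits n) ℂ}
    (hR : IsBlockSystem R β ι κ) (Z : Distinguisher 𝒰 N K) (u : Fin K → 𝒰) (m : Z.M) (s : R.S)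
    {e : R.S → Ack N K → R.Z → Fin R.dim → Fin R.dim → ℂ}
    (he : ∀ s I z B, (R.reply s u I z B).trace = ∑ x, ∑ y, B x y * e s I z x y)
    (A : Matrix (Fin Z.dim) (Fin Z.dim) ℂ) (ω : Matrix (Fin R.dim) (Fin R.dim) ℂ) :
    play R Z u (List.finRange N) m s (A ⊗ₖ ω) = ∑' h : Path N, ∑ I, ∑' z, ENNReal.ofReal
      (∑ x, ∑ y, e (sysAfter R ι h (List.finRange N) s) I z x y * ω x y *
        amp Z h (β s).2 m A I (R.out (sysAfter R ι h (List.finRange N) s) u I z)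
          fun i => κ i (β s) (h i).1 (h i).2.1 (h i).2.2 x y).re := by
  -- The starting path is a dummy: all its entries are overwritten.
  rw [hR.play_eq_pathSum Z u _ (List.nodup_finRange N) (fun _ => (true, 0, none)),
    pathSum_finRange]
  refine tsum_congr fun h => ?_
  rw [play_nil R Z u _ _ (he _)]
  refine Finset.sum_congr rfl fun I _ => tsum_congr fun z => ?_
  congr 2
  refine Finset.sum_congr rfl fun x _ => Finset.sum_congr rfl fun y _ => ?_
  rw [mul_assoc]
  congr 1
  have hb : block (A ⊗ₖ ω) x y = ω x y • A := by
    ext i j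
    simp [block, mul_comm]
  have hb' : ∀ X : Fin R.dim → Fin R.dim → Matrix (Fin Z.dim) (Fin Z.dim) ℂ,
      block (Matrix.of fun p q : Fin Z.dim × Fin R.dim => X p.2 q.2 p.1 q.1) x y = X x y :=
    fun _ => rfl
  rw [hb' fun x y => opAfter Z h (β s).2
    (fun i => κ i (β s) (h i).1 (h i).2.1 (h i).2.2 x y) (List.finRange N) m (block (A ⊗ₖ ω) x y),
    hb, opAfter_smul, map_smul, Matrix.mul_smul, Matrix.trace_smul]
  rfl

/-- The `i`-th bit of an index of the computational basis of `N` qubits. -/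
def bit (i : Fin N) (x : Fin (2 ^ N)) : Fin 2 := finFunctionFinEquiv.symm x i

theorem sum_bit {M : Type*} [AddCommMonoid M] (f : (Fin N → Fin 2) → M) :
    ∑ x : Fin (2 ^ N), f (fun i => bit i x) = ∑ x : Fin N → Fin 2, f x :=
  Fintype.sum_equiv finFunctionFinEquiv.symm _ _ fun _ => rfl

/-- When the coefficients are products over the qubits, multilinearity turns the sum over the joint
basis into separate sums over each qubit. This reduces the simulation to a single round, however
adaptive the distinguisher is. -/
theorem sum_bit_mul_multilinear {E : Fin N → Type*} [∀ i, AddCommGroup (E i)]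
    [∀ i, Module ℂ (E i)] (F : MultilinearMap ℂ E ℂ) (g : Fin N → Fin 2 → Fin 2 → ℂ)
    (T : (i : Fin N) → Fin 2 → Fin 2 → E i) :
    ∑ x : Fin (2 ^ N), ∑ y : Fin (2 ^ N), (∏ i, g i (bit i x) (bit i y)) *
      F (fun i => T i (bit i x) (bit i y)) = F fun i => ∑ a, ∑ b, g i a b • T i a b := by
  rw [Finset.sum_congr rfl fun x _ =>
    sum_bit fun y => (∏ i, g i (bit i x) (y i)) * F fun i => T i (bit i x) (y i)]
  rw [sum_bit fun x => ∑ y : Fin N → Fin 2, (∏ i, g i (x i) (y i)) * F fun i => T i (x i) (y i)]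
  rw [show (fun i => ∑ a, ∑ b, g i a b • T i a b) =
    fun i => ∑ p : Fin 2 × Fin 2, g i p.1 p.2 • T i p.1 p.2 from
    funext fun i => (Fintype.sum_prod_type' fun a b => g i a b • T i a b).symm]
  rw [MultilinearMap.map_sum, ← Fintype.sum_prod_type']
  refine (Fintype.sum_equiv (Equiv.arrowProdEquivProdArrow _ _ _) _ _ fun r => ?_).symm
  rw [MultilinearMap.map_smul_univ]
  rfl

end Amplitudes

/-! ### Probabilities of paths -/

section PathProb

variable {𝒰 : Subgroup (Matrix.unitaryGroup (Fin 2) ℂ)} {N K : ℕ}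

/-- Measurability is assumed only for fixed input operators; expansion in matrix units extends it to
inputs that vary with the parameter. -/
theorem measurable_op_apply {X a b : Type} [MeasurableSpace X] [Fintype a] [DecidableEq a]
    {Φ : X → Op a b} (hΦ : ∀ A i j, Measurable fun x => Φ x A i j) {A : X → Matrix a a ℂ}
    (hA : ∀ i j, Measurable fun x => A x i j) (i j : b) : Measurable fun x => Φ x (A x) i j := by
  have h : ∀ x, Φ x (A x) i j = ∑ p, ∑ q, A x p q * Φ x (Matrix.single p q 1) i j := by
    intro x
    conv_lhs => rw [Matrix.matrix_eq_sum_single (A x)]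
    simp only [map_sum, Matrix.sum_apply]
    refine Finset.sum_congr rfl fun p _ => Finset.sum_congr rfl fun q _ => ?_
    rw [show Matrix.single p q (A x p q) = A x p q • Matrix.single p q (1 : ℂ) by
      rw [Matrix.smul_single, smul_eq_mul, mul_one], map_smul]
    rfl
  simp_rw [h]
  exact Finset.measurable_sum _ fun p _ => Finset.measurable_sum _ fun q _ =>
    (hA p q).mul (hΦ _ i j)

theorem measurable_conjU (ρ : Matrix (Fin 2) (Fin 2) ℂ) (a b : Fin 2) :
    Measurable fun U : 𝒰 => conjU U ρ a b := by
  have h : Continuous fun U : 𝒰 => (U.1 : Matrix (Fin 2) (Fin 2) ℂ) :=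
    continuous_subtype_val.comp continuous_subtype_val
  exact (((h.matrix_mul continuous_const).matrix_mul h.matrix_conjTranspose).matrix_elem
    a b).measurable

theorem measurable_pulse (ρ : Matrix (Fin 2) (Fin 2) ℂ) (n : ℕ) (q r : Qubits n) :
    Measurable fun U : 𝒰 => pulse ρ U n q r := by
  simp only [pulse, prodState, Matrix.of_apply]
  exact Finset.measurable_prod _ fun i _ => measurable_conjU ρ (q i) (r i)

theorem measurable_wcpLabel (y : Option ℕ) : Measurable fun U : 𝒰 => wcpLabel U y := by
  cases y with
  | none => exact measurable_const
  | some m => exact measurable_inr.comp (measurable_const.prodMk measurable_id)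

theorem measurable_memAfter {X : Type} [MeasurableSpace X] (Z : Distinguisher 𝒰 N K) (h : Path N)
    {U : X → Fin N → 𝒰} (hU : ∀ i, Measurable fun x => U x i) (l : List (Fin N)) {m : X → Z.M}
    (hm : Measurable m) : Measurable fun x => memAfter Z h (U x) l (m x) := by
  induction l generalizing m with
  | nil => exact hm
  | cons i l ih =>
    exact ih ((Z.next_meas i (h i).1 (h i).2.1).comp
      (hm.prodMk ((measurable_wcpLabel _).comp (hU i))))

theorem measurable_opAfter {X : Type} [MeasurableSpace X] (Z : Distinguisher 𝒰 N K) (h : Path N)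
    {U : X → Fin N → 𝒰} (hU : ∀ i, Measurable fun x => U x i)
    {τ : X → (i : Fin N) → Matrix (Qubits (h i).2.1) (Qubits (h i).2.1) ℂ}
    (hτ : ∀ i q r, Measurable fun x => τ x i q r) (l : List (Fin N)) {m : X → Z.M}
    (hm : Measurable m) {A : X → Matrix (Fin Z.dim) (Fin Z.dim) ℂ}
    (hA : ∀ i j, Measurable fun x => A x i j) (i j : Fin Z.dim) :
    Measurable fun x => opAfter Z h (U x) (τ x) l (m x) (A x) i j := by
  induction l generalizing m A with
  | nil => exact hA i j
  | cons k l ih =>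
    have hlab : Measurable fun x => (m x, wcpLabel (U x k) (h k).2.2) :=
      hm.prodMk ((measurable_wcpLabel _).comp (hU k))
    refine ih ((Z.next_meas k (h k).1 (h k).2.1).comp hlab) ?_
    refine measurable_op_apply
      (fun B a b => (Z.receive_meas k (h k).1 (h k).2.1 B a b).comp hlab) fun p q => ?_
    simp only [Matrix.kroneckerMap_apply]
    exact (measurable_op_apply (fun B a b => (Z.flag_meas k (h k).1 B a b).comp hm) hA _ _).mul
      (hτ k _ _)

/-- The probability weight of a path, an acknowledgement and a final message, for given unitaries
and apart from the probabilities of the photon numbers and of the outcomes of the estimation. -/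
def pathProb (ρ₀ : Matrix (Fin 2) (Fin 2) ℂ) (Z : Distinguisher 𝒰 N K) (h : Path N)
    (U : Fin N → 𝒰) (m : Z.M) (A : Matrix (Fin Z.dim) (Fin Z.dim) ℂ) (I : Ack N K)
    (x : Bool × LastMsg 𝒰 K) : ℝ≥0∞ :=
  ENNReal.ofReal (amp Z h U m A I x fun i => pulse ρ₀ (U i) (h i).2.1).re

theorem measurable_pathProb {X : Type} [MeasurableSpace X] (ρ₀ : Matrix (Fin 2) (Fin 2) ℂ)
    (Z : Distinguisher 𝒰 N K) (h : Path N) {U : X → Fin N → 𝒰}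
    (hU : ∀ i, Measurable fun x => U x i) (m : Z.M) (A : Matrix (Fin Z.dim) (Fin Z.dim) ℂ)
    (I : Ack N K) {o : X → Bool × LastMsg 𝒰 K} (ho : Measurable o) :
    Measurable fun x => pathProb ρ₀ Z h (U x) m A I (o x) := by
  have hm := measurable_memAfter Z h hU (List.finRange N) (measurable_const (a := m))
  have hA := measurable_opAfter Z h hU
    (τ := fun x i => pulse ρ₀ (U x i) (h i).2.1)
    (fun i q r => (measurable_pulse ρ₀ _ q r).comp (hU i)) (List.finRange N)
    (measurable_const (a := m)) (A := fun _ => A) (fun _ _ => measurable_const)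
  refine ENNReal.measurable_ofReal.comp (Complex.measurable_re.comp ?_)
  simp only [amp, MultilinearMap.coe_mk, Matrix.trace, Matrix.diag, Matrix.mul_apply]
  exact Finset.measurable_sum _ fun a _ => Finset.measurable_sum _ fun b _ =>
    ((Z.guess_meas I a b).comp (hm.prodMk ho)).mul
      (measurable_op_apply (fun B a b => (Z.ack_meas I B a b).comp hm) hA _ _)

theorem posSemidef_opAfter (Z : Distinguisher 𝒰 N K) (h : Path N) (U : Fin N → 𝒰)
    {τ : (i : Fin N) → Matrix (Qubits (h i).2.1) (Qubits (h i).2.1) ℂ}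
    (hτ : ∀ i, (τ i).PosSemidef) (l : List (Fin N)) (m : Z.M)
    {A : Matrix (Fin Z.dim) (Fin Z.dim) ℂ} (hA : A.PosSemidef) :
    (opAfter Z h U τ l m A).PosSemidef := by
  induction l generalizing m A with
  | nil => exact hA
  | cons i l ih =>
    exact ih _ ((Z.receive_cp _ _ _ _ _).posSemidef
      (((Z.flag_cp _ _ _).posSemidef hA).kronecker (hτ i)))

variable {ρ₀ : Matrix (Fin 2) (Fin 2) ℂ}

theorem amp_re_nonneg (hρ₀ : IsDensity ρ₀) (Z : Distinguisher 𝒰 N K) (h : Path N) (U : Fin N → 𝒰)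
    (m : Z.M) {A : Matrix (Fin Z.dim) (Fin Z.dim) ℂ} (hA : A.PosSemidef) (I : Ack N K)
    (x : Bool × LastMsg 𝒰 K) :
    0 ≤ (amp Z h U m A I x fun i => pulse ρ₀ (U i) (h i).2.1).re :=
  trace_mul_re_nonneg (Z.guess_effect _ _ _).1 ((Z.ack_cp _ _).posSemidef
    (posSemidef_opAfter Z h U (fun _ => (isDensity_pulse hρ₀ _ _).1) _ _ hA))

/-- The probability weight of a path and an acknowledgement. -/
def ackProb (ρ₀ : Matrix (Fin 2) (Fin 2) ℂ) (Z : Distinguisher 𝒰 N K) (h : Path N)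
    (U : Fin N → 𝒰) (m : Z.M) (A : Matrix (Fin Z.dim) (Fin Z.dim) ℂ) (I : Ack N K) : ℝ≥0∞ :=
  ENNReal.ofReal (Z.ack (memAfter Z h U (List.finRange N) m) I (opAfter Z h U
    (fun i => pulse ρ₀ (U i) (h i).2.1) (List.finRange N) m A)).trace.re

theorem pathProb_le_ackProb (hρ₀ : IsDensity ρ₀) (Z : Distinguisher 𝒰 N K) (h : Path N)
    (U : Fin N → 𝒰) (m : Z.M) {A : Matrix (Fin Z.dim) (Fin Z.dim) ℂ} (hA : A.PosSemidef)
    (I : Ack N K) (x : Bool × LastMsg 𝒰 K) :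
    pathProb ρ₀ Z h U m A I x ≤ ackProb ρ₀ Z h U m A I :=
  prob_le_of_isEffect (Z.guess_effect _ _ _) ((Z.ack_cp _ _).posSemidef
    (posSemidef_opAfter Z h U (fun _ => (isDensity_pulse hρ₀ _ _).1) _ _ hA))

theorem sum_ofReal_trace {a : Type} {ι : Type*} [Fintype a] [Fintype ι] {Φ : ι → Op a a}
    (hΦ : ∀ i, IsCP (Φ i)) (htr : ∀ A, ∑ i, (Φ i A).trace = A.trace) {A : Matrix a a ℂ}
    (hA : A.PosSemidef) :
    ∑ i, ENNReal.ofReal (Φ i A).trace.re = ENNReal.ofReal A.trace.re := by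
  rw [← ENNReal.ofReal_sum_of_nonneg, ← Complex.re_sum, htr]
  intro i _
  exact (Complex.le_def.1 ((hΦ i).posSemidef hA).trace_nonneg).1

/-- Conservation of probability along the rounds: receiving preserves the trace, pulses have trace
one, and the flag instrument preserves the total trace. Since the distinguisher chooses the flag,
`t` has to be subnormalised for each flag separately. -/
theorem pathSum_trace_opAfter_le (hρ₀ : IsDensity ρ₀) (Z : Distinguisher 𝒰 N K) (U : Fin N → 𝒰)
    {t : Fin N → Bool × ℕ × Option ℕ → ℝ≥0∞}
    (ht : ∀ i c, ∑' n, ∑' y, t i (c, n, y) ≤ 1) (l : List (Fin N)) (hl : l.Nodup) (h₀ : Path N)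
    (m : Z.M) {A : Matrix (Fin Z.dim) (Fin Z.dim) ℂ} (hA : A.PosSemidef) :
    (pathSum l h₀ fun h => (l.map fun i => t i (h i)).prod * ENNReal.ofReal
      (opAfter Z h U (fun i => pulse ρ₀ (U i) (h i).2.1) l m A).trace.re) ≤
        ENNReal.ofReal A.trace.re := by
  induction l generalizing h₀ m A with
  | nil => simp [pathSum, opAfter]
  | cons i l ih =>
    obtain ⟨hi, hl⟩ := List.nodup_cons.1 hl
    rw [pathSum]
    calc _ ≤ ∑ c, ∑' n, ∑' y, t i (c, n, y) * ENNReal.ofReal (Z.flag i m c A).trace.re := ?_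
      _ ≤ ∑ c, ENNReal.ofReal (Z.flag i m c A).trace.re := by
        refine Finset.sum_le_sum fun c _ => ?_
        simp_rw [ENNReal.tsum_mul_right]
        exact (mul_le_mul_left (ht i c) _).trans (by simp)
      _ = _ := sum_ofReal_trace (Z.flag_cp i m) (Z.flag_trace i m) hA
    refine Finset.sum_le_sum fun c _ => ENNReal.tsum_le_tsum fun n => ENNReal.tsum_le_tsum
      fun y => ?_
    have hstep : ((Z.receive i m c n (wcpLabel (U i) y)
        (Z.flag i m c A ⊗ₖ pulse ρ₀ (U i) n))).PosSemidef :=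
      (Z.receive_cp _ _ _ _ _).posSemidef
        (((Z.flag_cp _ _ _).posSemidef hA).kronecker (isDensity_pulse hρ₀ _ _).1)
    have := ih hl (Function.update h₀ i (c, n, y)) (Z.next i m c n (wcpLabel (U i) y)) hstep
    rw [Z.receive_trace, Matrix.trace_kronecker, (isDensity_pulse hρ₀ _ _).2, mul_one] at this
    refine le_trans (le_of_eq ?_) (mul_le_mul_right this _)
    rw [← pathSum_mul_left]
    refine pathSum_congr _ _ fun h' hh => ?_
    have hhi : h' i = (c, n, y) := by rw [hh i hi, Function.update_self]
    obtain rfl : c = (h' i).1 := by rw [hhi]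
    obtain rfl : n = (h' i).2.1 := by rw [hhi]
    obtain rfl : y = (h' i).2.2 := by rw [hhi]
    rw [List.map_cons, List.prod_cons, mul_assoc]
    rfl

theorem tsum_ackProb_le (hρ₀ : IsDensity ρ₀) (Z : Distinguisher 𝒰 N K) (U : Fin N → 𝒰)
    {t : Fin N → Bool × ℕ × Option ℕ → ℝ≥0∞}
    (ht : ∀ i c, ∑' n, ∑' y, t i (c, n, y) ≤ 1) (m : Z.M)
    {A : Matrix (Fin Z.dim) (Fin Z.dim) ℂ} (hA : IsDensity A) :
    ∑' h : Path N, (∏ i, t i (h i)) * ∑ I, ackProb ρ₀ Z h U m A I ≤ 1 := by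
  have h := pathSum_trace_opAfter_le hρ₀ Z U ht _ (List.nodup_finRange N)
    (fun _ => (true, 0, none)) m hA.1
  rw [pathSum_finRange, hA.2] at h
  refine le_trans (le_of_eq (tsum_congr fun h => ?_)) (h.trans (by simp))
  rw [show ∏ i, t i (h i) = ((List.finRange N).map fun i => t i (h i)).prod by
    rw [← List.prod_ofFn, List.ofFn_eq_map]]
  congr 1
  exact sum_ofReal_trace (Z.ack_cp _) (Z.ack_trace _)
    (posSemidef_opAfter Z h U (fun _ => (isDensity_pulse hρ₀ _ _).1) _ _ hA.1)

end PathProb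

/-! ### Teleportation -/

section Teleportation

variable {𝒰 : Subgroup (Matrix.unitaryGroup (Fin 2) ℂ)} {N K : ℕ}

/-- The products of `PX` and `PZ`. -/
def pauli (PX PZ : 𝒰) (p : Fin 2 × Fin 2) : 𝒰 := PX ^ (p.1 : ℕ) * PZ ^ (p.2 : ℕ)

/-- Completeness of the Pauli basis: the four products are orthogonal for the trace inner product,
each of squared norm `2`. -/
theorem sum_pauli {PX PZ : 𝒰} (hX : (PX.1 : Matrix (Fin 2) (Fin 2) ℂ) = pauliX)
    (hZ : (PZ.1 : Matrix (Fin 2) (Fin 2) ℂ) = pauliZ) (a b c d : Fin 2) :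
    ∑ p, ((pauli PX PZ p)⁻¹.1 : Matrix (Fin 2) (Fin 2) ℂ) c b *
      star (((pauli PX PZ p)⁻¹.1 : Matrix (Fin 2) (Fin 2) ℂ) d a) =
        if c = d ∧ b = a then 2 else 0 := by
  have hinv : ∀ U : 𝒰, (U⁻¹.1 : Matrix (Fin 2) (Fin 2) ℂ) =
    (U.1 : Matrix (Fin 2) (Fin 2) ℂ).conjTranspose := fun _ => rfl
  have hp : ∀ p, ((pauli PX PZ p).1 : Matrix (Fin 2) (Fin 2) ℂ) =
      pauliX ^ (p.1 : ℕ) * pauliZ ^ (p.2 : ℕ) := by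
    intro p
    simp [pauli, hX, hZ]
  simp only [hinv, hp, Fintype.sum_prod_type, Fin.sum_univ_two]
  fin_cases a <;> fin_cases b <;> fin_cases c <;> fin_cases d <;>
    simp [pauliX, pauliZ] <;> norm_num

/-- The matrix of the projection on a maximally entangled state, with the second qubit rotated
by `V`. -/
def bell (V : 𝒰) : Matrix (Fin 2 × Fin 2) (Fin 2 × Fin 2) ℂ :=
  Matrix.of fun p r => 2⁻¹ * ((V.1 : Matrix (Fin 2) (Fin 2) ℂ) p.2 p.1 *
    star ((V.1 : Matrix (Fin 2) (Fin 2) ℂ) r.2 r.1))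

theorem posSemidef_bell (V : 𝒰) : (bell V).PosSemidef := by
  have h := (Matrix.posSemidef_vecMulVec_self_star (R := ℂ)
    fun p : Fin 2 × Fin 2 => (V.1 : Matrix (Fin 2) (Fin 2) ℂ) p.2 p.1).smul
    (show (0 : ℂ) ≤ 2⁻¹ by simp)
  exact h

/-- The rotated Bell projections form a measurement: Pauli completeness handles `G = 1`, and `G`
acts unitarily on the second qubit alone. -/
theorem sum_bell {PX PZ : 𝒰} (hX : (PX.1 : Matrix (Fin 2) (Fin 2) ℂ) = pauliX)
    (hZ : (PZ.1 : Matrix (Fin 2) (Fin 2) ℂ) = pauliZ) (G : 𝒰) :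
    ∑ p, bell (G * (pauli PX PZ p)⁻¹) = 1 := by
  ext ⟨b, q⟩ ⟨a, r⟩
  have h1 : ∀ p, bell (G * (pauli PX PZ p)⁻¹) (b, q) (a, r) = 2⁻¹ * ∑ c, ∑ d,
      (G.1 : Matrix (Fin 2) (Fin 2) ℂ) q c * star ((G.1 : Matrix (Fin 2) (Fin 2) ℂ) r d) *
      (((pauli PX PZ p)⁻¹.1 : Matrix (Fin 2) (Fin 2) ℂ) c b *
      star (((pauli PX PZ p)⁻¹.1 : Matrix (Fin 2) (Fin 2) ℂ) d a)) := by
    intro p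
    simp only [bell, Matrix.of_apply, Subgroup.coe_mul, Submonoid.coe_mul, Matrix.mul_apply,
      star_sum, star_mul', Finset.sum_mul_sum]
    congr 1
    refine Finset.sum_congr rfl fun c _ => Finset.sum_congr rfl fun d _ => by ring
  rw [Matrix.sum_apply]
  simp_rw [h1]
  rw [← Finset.mul_sum, Finset.sum_comm]
  have h2 := congrFun (congrFun (mul_conjTranspose_self G) q) r
  simp only [Matrix.mul_apply, Matrix.conjTranspose_apply] at h2
  calc _ = 2⁻¹ * ∑ c, ∑ d, (G.1 : Matrix (Fin 2) (Fin 2) ℂ) q c *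
        star ((G.1 : Matrix (Fin 2) (Fin 2) ℂ) r d) * (if c = d ∧ b = a then 2 else 0) := by
        congr 1
        refine Finset.sum_congr rfl fun c _ => ?_
        rw [Finset.sum_comm]
        refine Finset.sum_congr rfl fun d _ => ?_
        rw [← Finset.mul_sum, sum_pauli hX hZ]
    _ = if b = a then ∑ c, (G.1 : Matrix (Fin 2) (Fin 2) ℂ) q c *
        star ((G.1 : Matrix (Fin 2) (Fin 2) ℂ) r c) else 0 := by
        by_cases hab : b = a
        · simp [hab]
          ring
        · simp [hab]
    _ = _ := by
      rw [h2]
      simp only [Matrix.one_apply, Prod.mk.injEq]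
      by_cases hab : b = a <;> simp [hab]

/-- The teleportation identity: projecting an input `t ρ t†` on a rotated Bell vector leaves on the
memory qubit the transpose of `V⁻¹ t` applied to `ρ`. The factor `2⁻¹` is the normalisation of the
Bell projection. -/
theorem sum_bell_mul_conjU (V t : 𝒰) (ρ : Matrix (Fin 2) (Fin 2) ℂ) (a b : Fin 2) :
    ∑ q, ∑ r, bell V (b, q) (a, r) * conjU t ρ r q = 2⁻¹ * conjU (V⁻¹ * t) ρ a b := by
  have hinv : (V⁻¹.1 : Matrix (Fin 2) (Fin 2) ℂ) =
    (V.1 : Matrix (Fin 2) (Fin 2) ℂ).conjTranspose := rfl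
  rw [conjU_mul]
  generalize conjU t ρ = σ
  rw [conjU, hinv, Matrix.conjTranspose_conjTranspose]
  simp only [Matrix.mul_apply, bell, Matrix.of_apply, Matrix.conjTranspose_apply,
    Finset.sum_mul, Finset.mul_sum]
  exact Finset.sum_congr rfl fun q _ => Finset.sum_congr rfl fun r _ => by ring

/-- The Pauli twirl of a state is maximally mixed. It follows by contracting the completeness of the
Bell measurement with that state. -/
theorem sum_conjU {PX PZ : 𝒰} (hX : (PX.1 : Matrix (Fin 2) (Fin 2) ℂ) = pauliX)
    (hZ : (PZ.1 : Matrix (Fin 2) (Fin 2) ℂ) = pauliZ) (G t : 𝒰) {ρ : Matrix (Fin 2) (Fin 2) ℂ}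
    (hρ : IsDensity ρ) (a b : Fin 2) :
    ∑ p, 2⁻¹ * conjU ((G * (pauli PX PZ p)⁻¹)⁻¹ * t) ρ a b = if a = b then 1 else 0 := by
  simp_rw [← sum_bell_mul_conjU]
  rw [Finset.sum_comm]
  simp_rw [Finset.sum_comm (s := (Finset.univ : Finset (Fin 2 × Fin 2))), ← Finset.sum_mul,
    ← Matrix.sum_apply, sum_bell hX hZ]
  have h : (conjU t ρ).trace = 1 := by rw [trace_conjU, hρ.2]
  simp only [Matrix.trace, Matrix.diag] at h
  simp only [Matrix.one_apply, Prod.mk.injEq]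
  by_cases hab : a = b
  · simpa [hab] using h
  · simp [hab, Ne.symm hab]

/-- The effect of the outcome of a simultaneous teleportation of the states `t i ρ₀`, where the
state with index `i₀` is an additional quantum input. -/
def teleport (ρ₀ : Matrix (Fin 2) (Fin 2) ℂ) (V t : Fin N → 𝒰) (i₀ : Fin N) :
    Matrix (Fin (2 ^ N) × Qubits 1) (Fin (2 ^ N) × Qubits 1) ℂ :=
  Matrix.of fun p r => ∏ i, if i = i₀ then bell (V i) (bit i p.1, p.2 0) (bit i r.1, r.2 0)
    else 2⁻¹ * conjU ((V i)⁻¹ * t i) ρ₀ (bit i r.1) (bit i p.1)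

theorem posSemidef_teleport {ρ₀ : Matrix (Fin 2) (Fin 2) ℂ} (hρ₀ : IsDensity ρ₀)
    (V t : Fin N → 𝒰) (i₀ : Fin N) : (teleport ρ₀ V t i₀).PosSemidef := by
  have h := posSemidef_prod Finset.univ (fun i : Fin N => if i = i₀ then
      (bell (V i)).submatrix (fun p : Fin (2 ^ N) × Qubits 1 => (bit i p.1, p.2 0))
        (fun p => (bit i p.1, p.2 0))
    else ((2⁻¹ : ℂ) • (conjU ((V i)⁻¹ * t i) ρ₀).transpose).submatrix
      (fun p : Fin (2 ^ N) × Qubits 1 => bit i p.1) (fun p => bit i p.1)) fun i _ => by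
    split_ifs
    · exact (posSemidef_bell _).submatrix _
    · exact ((posSemidef_conjU _ hρ₀.1).transpose.smul
        (show (0 : ℂ) ≤ 2⁻¹ by simp)).submatrix _
  rw [show teleport ρ₀ V t i₀ = _ from ?_]
  · exact h
  · ext p r
    simp only [teleport, Matrix.of_apply]
    refine Finset.prod_congr rfl fun i _ => ?_
    split_ifs <;> rfl

theorem bit_ext {x y : Fin (2 ^ N)} (h : ∀ i, bit i x = bit i y) : x = y :=
  finFunctionFinEquiv.symm.injective (funext h)

theorem prod_bit_eq (x y : Fin (2 ^ N)) :
    ∏ i : Fin N, (if bit i x = bit i y then (1 : ℂ) else 0) = if x = y then 1 else 0 := by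
  rw [Finset.prod_ite_zero]
  simp only [Finset.prod_const_one]
  refine if_congr ⟨fun h => bit_ext fun i => h i (Finset.mem_univ i), fun h i _ => by rw [h]⟩ rfl rfl

theorem sum_prod_conjU {PX PZ : 𝒰} (hX : (PX.1 : Matrix (Fin 2) (Fin 2) ℂ) = pauliX)
    (hZ : (PZ.1 : Matrix (Fin 2) (Fin 2) ℂ) = pauliZ) {ρ₀ : Matrix (Fin 2) (Fin 2) ℂ}
    (hρ₀ : IsDensity ρ₀) (G t : Fin N → 𝒰) (x y : Fin (2 ^ N)) :
    ∑ P : Fin N → Fin 2 × Fin 2, ∏ i, 2⁻¹ *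
      conjU ((G i * (pauli PX PZ (P i))⁻¹)⁻¹ * t i) ρ₀ (bit i x) (bit i y) =
        if x = y then 1 else 0 := by
  have h := Finset.prod_univ_sum (fun _ : Fin N => (Finset.univ : Finset (Fin 2 × Fin 2)))
    (fun i p => 2⁻¹ * conjU ((G i * (pauli PX PZ p)⁻¹)⁻¹ * t i) ρ₀ (bit i x) (bit i y))
  rw [Fintype.piFinset_univ] at h
  rw [← h]
  simp_rw [sum_conjU hX hZ _ _ hρ₀]
  exact prod_bit_eq x y

/-- The sum over outcomes factorises over the rounds: a Bell measurement at `i₀`, and elsewhere its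
contraction with a known input state, which is a measurement by the Pauli twirl. -/
theorem sum_teleport {PX PZ : 𝒰} (hX : (PX.1 : Matrix (Fin 2) (Fin 2) ℂ) = pauliX)
    (hZ : (PZ.1 : Matrix (Fin 2) (Fin 2) ℂ) = pauliZ) {ρ₀ : Matrix (Fin 2) (Fin 2) ℂ}
    (hρ₀ : IsDensity ρ₀) (G t : Fin N → 𝒰) (i₀ : Fin N) :
    ∑ P : Fin N → Fin 2 × Fin 2,
      teleport ρ₀ (fun i => G i * (pauli PX PZ (P i))⁻¹) t i₀ = 1 := by
  ext ⟨x, q⟩ ⟨y, r⟩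
  rw [Matrix.sum_apply]
  have h := Finset.prod_univ_sum (fun _ : Fin N => (Finset.univ : Finset (Fin 2 × Fin 2)))
    (fun i p => if i = i₀ then bell (G i * (pauli PX PZ p)⁻¹) (bit i x, q 0) (bit i y, r 0)
      else 2⁻¹ * conjU ((G i * (pauli PX PZ p)⁻¹)⁻¹ * t i) ρ₀ (bit i y) (bit i x))
  rw [Fintype.piFinset_univ] at h
  simp only [teleport, Matrix.of_apply]
  rw [← h]
  have h1 : ∀ i, (∑ p, if i = i₀ then bell (G i * (pauli PX PZ p)⁻¹) (bit i x, q 0) (bit i y, r 0)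
      else 2⁻¹ * conjU ((G i * (pauli PX PZ p)⁻¹)⁻¹ * t i) ρ₀ (bit i y) (bit i x)) =
      (if bit i x = bit i y then 1 else 0) * if i = i₀ then (if q 0 = r 0 then 1 else 0) else 1 := by
    intro i
    by_cases hi : i = i₀
    · simp only [hi, if_true]
      rw [← Matrix.sum_apply, sum_bell hX hZ, Matrix.one_apply]
      simp only [Prod.mk.injEq, ← ite_and, mul_ite, mul_one, mul_zero, and_comm]
    · simp only [hi, if_false]
      rw [sum_conjU hX hZ _ _ hρ₀, mul_one]
      simp only [eq_comm]
  simp_rw [h1]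
  rw [Finset.prod_mul_distrib, prod_bit_eq, Finset.prod_ite_eq']
  have hq : q 0 = r 0 ↔ q = r := ⟨fun h => funext fun i => by rw [Subsingleton.elim i 0, h],
    fun h => by rw [h]⟩
  simp only [Matrix.one_apply, Prod.mk.injEq, Finset.mem_univ, if_true, hq]
  by_cases hxy : x = y <;> simp [hxy]

/-- Once the external qubit is in the state `t i₀` applied to `ρ₀`, the round `i₀` contributes the
same factor as all others: holding the state physically or knowing its description makes no
difference. -/
theorem trace_teleport_mul {ρ₀ : Matrix (Fin 2) (Fin 2) ℂ} (V t : Fin N → 𝒰) (i₀ : Fin N)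
    (A : Matrix (Fin (2 ^ N)) (Fin (2 ^ N)) ℂ) :
    (teleport ρ₀ V t i₀ * (A ⊗ₖ prodState fun _ : Fin 1 => conjU (t i₀) ρ₀)).trace =
      ∑ x, ∑ y, A x y * ∏ i, 2⁻¹ * conjU ((V i)⁻¹ * t i) ρ₀ (bit i x) (bit i y) := by
  have hsum : ∀ f : Qubits 1 → ℂ, ∑ q, f q = ∑ a, f fun _ => a := fun f =>
    Fintype.sum_equiv (Equiv.funUnique (Fin 1) (Fin 2)) _ _ fun q => by
      congr 1; funext i; rw [Subsingleton.elim i 0]; rfl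
  simp only [Matrix.trace, Matrix.diag, Matrix.mul_apply, Fintype.sum_prod_type, hsum,
    Matrix.kroneckerMap_apply, prodState, Matrix.of_apply, Finset.univ_unique, Finset.prod_singleton]
  rw [Finset.sum_congr rfl fun x _ => Finset.sum_comm, Finset.sum_comm]
  refine Finset.sum_congr rfl fun y _ => Finset.sum_congr rfl fun x _ => ?_
  rw [← Finset.mul_prod_erase _ _ (Finset.mem_univ i₀), ← sum_bell_mul_conjU, Finset.sum_mul,
    Finset.mul_sum]
  refine Finset.sum_congr rfl fun q _ => ?_
  rw [Finset.sum_mul, Finset.mul_sum]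
  refine Finset.sum_congr rfl fun r _ => ?_
  simp only [teleport, Matrix.of_apply]
  rw [← Finset.mul_prod_erase _ _ (Finset.mem_univ i₀), if_pos rfl]
  rw [Finset.prod_congr rfl fun i hi => if_neg (Finset.ne_of_mem_erase hi)]
  ring

end Teleportation

/-! ### The operations of the simulator -/

section Operations

variable {𝒰 : Subgroup (Matrix.unitaryGroup (Fin 2) ℂ)} {N K : ℕ}

/-- The uniform superposition of all computational basis states of `N` qubits. -/
def plusState (N : ℕ) : Matrix (Fin (2 ^ N)) (Fin (2 ^ N)) ℂ := Matrix.of fun _ _ => ((2 : ℂ) ^ N)⁻¹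

theorem isDensity_plusState (N : ℕ) : IsDensity (plusState N) := by
  constructor
  · have h := ((Matrix.PosSemidef.one (n := Unit) (R := ℂ)).submatrix (fun _ : Fin (2 ^ N) => ())).smul
      (show (0 : ℂ) ≤ ((2 : ℂ) ^ N)⁻¹ from inv_nonneg.2 (pow_nonneg (by simp) _))
    convert h using 1
    ext; simp [plusState]
  · simp [plusState, Matrix.trace]

/-- A pulse with at most one photon and without a classical description. -/
def isLow (n : ℕ) (y : Option ℕ) : Bool := decide (n ≤ 1) && y.isNone

/-- The operator appended by the simulator to the matrix unit `|a⟩⟨b|` of the memory qubit of a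
round with `n` photons and classical outcome `y`. -/
def simPulse (ρ₀ : Matrix (Fin 2) (Fin 2) ℂ) (U : 𝒰) :
    (n : ℕ) → Option ℕ → Fin 2 → Fin 2 → Matrix (Qubits n) (Qubits n) ℂ
  | 1, none, a, b => Matrix.of fun q r => if q 0 = a ∧ r 0 = b then 1 else 0
  | n, _, a, b => (if a = b then 1 else 0 : ℂ) • pulse ρ₀ U n

theorem simPulse_of_ne (ρ₀ : Matrix (Fin 2) (Fin 2) ℂ) (U : 𝒰) {n : ℕ} {y : Option ℕ}
    (hn : ¬(n = 1 ∧ y = none)) (a b : Fin 2) :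
    simPulse ρ₀ U n y a b = (if a = b then 1 else 0 : ℂ) • pulse ρ₀ U n := by
  match n, y, hn with
  | 0, _, _ => rfl
  | 1, none, h => simp at h
  | 1, some _, _ => rfl
  | _ + 2, _, _ => rfl

theorem posSemidef_simPulse {ρ₀ : Matrix (Fin 2) (Fin 2) ℂ} (hρ₀ : IsDensity ρ₀) (U : 𝒰) (n : ℕ)
    (y : Option ℕ) : (Matrix.of fun p r : Fin 2 × Qubits n =>
      simPulse ρ₀ U n y p.1 r.1 p.2 r.2).PosSemidef := by
  by_cases hn : n = 1 ∧ y = none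
  · obtain ⟨rfl, rfl⟩ := hn
    have h := Matrix.posSemidef_vecMulVec_self_star (R := ℂ)
      fun p : Fin 2 × Qubits 1 => if p.2 0 = p.1 then 1 else 0
    convert h using 1
    ext p r
    simp only [simPulse, Matrix.of_apply, Matrix.vecMulVec_apply, Pi.star_apply, apply_ite star,
      star_one, star_zero, mul_ite, mul_one, mul_zero, ← ite_and, and_comm]
  · simp only [simPulse_of_ne ρ₀ U hn]
    have h := (Matrix.PosSemidef.one (n := Fin 2) (R := ℂ)).kronecker (isDensity_pulse hρ₀ U n).1
    rw [show (Matrix.of fun p r : Fin 2 × Qubits n => ((if p.1 = r.1 then 1 else 0 : ℂ) •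
      pulse ρ₀ U n) p.2 r.2) = (1 : Matrix (Fin 2) (Fin 2) ℂ) ⊗ₖ pulse ρ₀ U n by
        ext; simp [Matrix.one_apply]]
    exact h

theorem sum_simPulse_apply {ρ₀ : Matrix (Fin 2) (Fin 2) ℂ} (hρ₀ : IsDensity ρ₀) (U : 𝒰) (n : ℕ)
    (y : Option ℕ) (a : Fin 2) : ∑ q, simPulse ρ₀ U n y a a q q = 1 := by
  by_cases hn : n = 1 ∧ y = none
  · obtain ⟨rfl, rfl⟩ := hn
    simp only [simPulse, Matrix.of_apply, and_self]
    rw [Fintype.sum_equiv (Equiv.funUnique (Fin 1) (Fin 2)) (fun q => if q 0 = a then (1 : ℂ) else 0)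
      (fun b => if b = a then 1 else 0) fun q => rfl]
    simp
  · simp only [simPulse_of_ne ρ₀ U hn, if_true, one_smul]
    exact (isDensity_pulse hρ₀ U n).2

/-- A single photon is a copy of the memory qubit, so contracting the memory with the entries of a
state reproduces that state as the pulse; an empty pulse only sees the trace, which is one. In the
other rounds the memory qubit is merely dephased, and the pulse of `U` survives (next lemma). -/
theorem sum_smul_simPulse_of_isLow {ρ₀ : Matrix (Fin 2) (Fin 2) ℂ} (hρ₀ : IsDensity ρ₀) (U W : 𝒰)
    {n : ℕ} {y : Option ℕ} (hn : isLow n y = true) (c : ℂ) :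
    ∑ a, ∑ b, (c * conjU W ρ₀ a b) • simPulse ρ₀ U n y a b = c • pulse ρ₀ W n := by
  simp only [isLow, Bool.and_eq_true, decide_eq_true_eq, Option.isNone_iff_eq_none] at hn
  obtain ⟨hn, rfl⟩ := hn
  ext q r
  simp only [Matrix.sum_apply, Matrix.smul_apply, smul_eq_mul]
  interval_cases n
  · have h : (conjU W ρ₀).trace = 1 := by rw [trace_conjU, hρ₀.2]
    simp only [Matrix.trace, Matrix.diag] at h
    simp only [simPulse, Matrix.smul_apply, pulse, prodState, Matrix.of_apply, Finset.univ_eq_empty,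
      Finset.prod_empty, smul_eq_mul, mul_one, mul_ite, mul_zero, Finset.sum_ite_eq,
      Finset.mem_univ, if_true]
    rw [← Finset.mul_sum, h, mul_one]
  · simp [simPulse, pulse, prodState, ite_and]

theorem sum_smul_simPulse_of_not_isLow {ρ₀ : Matrix (Fin 2) (Fin 2) ℂ} (hρ₀ : IsDensity ρ₀)
    (U W : 𝒰) {n : ℕ} {y : Option ℕ} (hn : isLow n y = false) (c : ℂ) :
    ∑ a, ∑ b, (c * conjU W ρ₀ a b) • simPulse ρ₀ U n y a b = c • pulse ρ₀ U n := by
  have hn' : ¬(n = 1 ∧ y = none) := by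
    rintro ⟨rfl, rfl⟩
    simp [isLow] at hn
  have h : (conjU W ρ₀).trace = 1 := by rw [trace_conjU, hρ₀.2]
  simp only [Matrix.trace, Matrix.diag] at h
  simp only [simPulse_of_ne ρ₀ U hn', ite_smul, zero_smul, one_smul, smul_ite, smul_zero,
    Finset.sum_ite_eq, Finset.mem_univ, if_true]
  rw [← Finset.sum_smul, ← Finset.mul_sum, h, mul_one]

theorem measurable_simPulse (ρ₀ : Matrix (Fin 2) (Fin 2) ℂ) (n : ℕ) (y : Option ℕ) (a b : Fin 2)
    (q r : Qubits n) : Measurable fun U : 𝒰 => simPulse ρ₀ U n y a b q r := by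
  by_cases hn : n = 1 ∧ y = none
  · obtain ⟨rfl, rfl⟩ := hn
    exact measurable_const
  · simp only [fun U : 𝒰 => simPulse_of_ne ρ₀ U hn, Matrix.smul_apply, smul_eq_mul]
    exact (measurable_pulse ρ₀ n q r).const_mul _

theorem wcpWeight_nonneg (η μ : ℝ≥0) (c : Bool) (n : ℕ) (y : Option ℕ) :
    0 ≤ wcpWeight η μ c n y := by
  cases y <;> simp only [wcpWeight] <;> split_ifs <;> positivity

theorem hasSum_wcpWeight (η μ : ℝ≥0) (c : Bool) :
    HasSum (fun p : ℕ × Option ℕ => wcpWeight η μ c p.1 p.2) 1 := by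
  have hs : HasSum (fun n => (ProbabilityTheory.poissonMeasure (wcpMean η μ c)).real {n}) 1 := by
    simp_rw [ProbabilityTheory.poissonMeasure_real_singleton]
    exact ProbabilityTheory.hasSum_one_poissonMeasure _
  -- The sampled photon number determines the visible output; the weights are the Poisson weights
  -- carried along this injection.
  let f : ℕ → ℕ × Option ℕ := fun n => if c = true ∧ 1 < n then (0, some n) else (n, none)
  have hf : Function.Injective f := by
    intro a b hab
    simp only [f] at hab
    split_ifs at hab <;> simp_all
  have hcomp : (fun p : ℕ × Option ℕ => wcpWeight η μ c p.1 p.2) ∘ f =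
      fun n => (ProbabilityTheory.poissonMeasure (wcpMean η μ c)).real {n} := by
    funext n
    by_cases h : c = true ∧ 1 < n
    · simp [f, h, wcpWeight]
    · simp [f, h, wcpWeight]
  rw [← hf.hasSum_iff, hcomp]
  · exact hs
  · rintro ⟨n, y⟩ hp
    cases y with
    | none =>
      have : c = true ∧ 1 < n := by
        by_contra h
        exact hp ⟨n, by simp [f, h]⟩
      simp [wcpWeight, this]
    | some m =>
      have : ¬(c = true ∧ 1 < m ∧ n = 0) := by
        rintro ⟨h1, h2, rfl⟩
        exact hp ⟨m, by simp [f, h1, h2]⟩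
      simp only [wcpWeight, if_neg this]

/-- Composition with a transposition shows that the sum is independent of `k`; over all `K` values
of `k` it is `K! / (K - 1)! = K`. -/
theorem sum_perm_apply_eq (j k : Fin K) :
    ∑ σ : Equiv.Perm (Fin K), (if σ j = k then ((K - 1).factorial : ℝ)⁻¹ else 0) = 1 := by
  have hsymm : ∀ k', ∑ σ : Equiv.Perm (Fin K), (if σ j = k' then ((K - 1).factorial : ℝ)⁻¹ else 0) =
      ∑ σ : Equiv.Perm (Fin K), (if σ j = k then ((K - 1).factorial : ℝ)⁻¹ else 0) := by
    intro k'
    refine Fintype.sum_equiv (Equiv.mulLeft (Equiv.swap k k')) _ _ fun σ => ?_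
    refine if_congr ?_ rfl rfl
    simp [Equiv.swap_apply_eq_iff]
  have hsum : ∑ k', ∑ σ : Equiv.Perm (Fin K),
      (if σ j = k' then ((K - 1).factorial : ℝ)⁻¹ else 0) = K := by
    rw [Finset.sum_comm]
    have hK : 0 < K := j.pos
    have hf : (K.factorial : ℝ) = K * (K - 1).factorial := by
      exact_mod_cast (Nat.mul_factorial_pred hK.ne').symm
    simp only [Finset.sum_ite_eq, Finset.mem_univ, if_true, Finset.sum_const, Finset.card_univ,
      Fintype.card_perm, Fintype.card_fin, nsmul_eq_mul]
    rw [hf, mul_assoc, mul_inv_cancel₀ (by positivity), mul_one]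
  rw [Finset.sum_congr rfl fun k' _ => hsymm k'] at hsum
  have hK : (K : ℝ) ≠ 0 := by exact_mod_cast j.pos.ne'
  simpa [hK] using hsum

end Operations

/-! ### The simulator -/

section Simulation

variable {𝒰 : Subgroup (Matrix.unitaryGroup (Fin 2) ℂ)} {N K : ℕ}

/-- What the simulator records: which rounds had at most one photon, and the acknowledged rounds. -/
structure SimMem (N K : ℕ) where
  low : Fin N → Bool
  ack : KSubset N K

instance : MeasurableSpace (SimMem N K) := ⊤

instance : DiscreteMeasurableSpace (SimMem N K) := ⟨fun _ => trivial⟩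

instance (n : ℕ) : DiscreteMeasurableSpace (Equiv.Perm (Fin n)) := ⟨fun _ => trivial⟩

instance : Countable (SimMem N K) :=
  Function.Injective.countable (f := fun r : SimMem N K => (r.low, r.ack)) fun r r' h => by
    cases r; cases r'; simpa using h

/-- The classical memory of the simulator. -/
abbrev SimState (𝒰 : Subgroup (Matrix.unitaryGroup (Fin 2) ℂ)) (N K : ℕ) : Type :=
  (Equiv.Perm (Fin N) × (Fin N → 𝒰)) × SimMem N K

/-- The additional classical outcomes of the simulator. -/
abbrev SimOut (N K : ℕ) : Type := Option ℕ ⊕ (Equiv.Perm (Fin K) × (Fin N → Fin 2 × Fin 2))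

/-- Permutations and records range over countable discrete spaces, so only the dependence on the
unitaries has to be checked. -/
theorem measurable_simState {β : Type*} [MeasurableSpace β] {f : SimState 𝒰 N K → β}
    (hf : ∀ π r, Measurable fun G => f ((π, G), r)) : Measurable f :=
  measurable_from_prod_countable_left fun r => measurable_from_prod_countable_right fun π => hf π r

theorem measurable_simState_prod {β W : Type*} [MeasurableSpace β] [MeasurableSpace W]
    {f : SimState 𝒰 N K × W → β}
    (hf : ∀ π r, Measurable fun p : (Fin N → 𝒰) × W => f (((π, p.1), r), p.2)) : Measurable f := by
  have h : Measurable fun p : ((Fin N → 𝒰) × W) × (Equiv.Perm (Fin N) × SimMem N K) =>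
      f (((p.2.1, p.1.1), p.2.2), p.1.2) :=
    measurable_from_prod_countable_left fun r => hf r.1 r.2
  exact h.comp (f := fun q : SimState 𝒰 N K × W => ((q.1.1.2, q.2), (q.1.1.1, q.1.2)))
    (by fun_prop)

/-- Some acknowledged round had at most one photon. -/
abbrev HasLow (low : Fin N → Bool) (I : KSubset N K) : Prop := ∃ j, low (kept I j) = true

/-- The index of an acknowledged round with at most one photon, if there is one. -/
def lowIndex (hK : 0 < K) (r : SimMem N K) : Fin K :=
  if h : HasLow r.low r.ack then h.choose else ⟨0, hK⟩

/-- Completion of a family that is unknown at `k`. -/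
def fillLeak (k : Fin K) (u : {j : Fin K // j ≠ k} → 𝒰) (j : Fin K) : 𝒰 :=
  if h : j = k then 1 else u ⟨j, h⟩

/-- The unitary whose state is teleported into round `i`. -/
def target (I : KSubset N K) (σ : Equiv.Perm (Fin K)) (u : Fin K → 𝒰) (i : Fin N) : 𝒰 :=
  if h : ∃ j, kept I j = i then u (σ h.choose) else 1

theorem kept_injective (I : KSubset N K) : Function.Injective (kept I) :=
  (I.1.orderEmbOfFin I.2).injective

theorem target_kept (I : KSubset N K) (σ : Equiv.Perm (Fin K)) (u : Fin K → 𝒰) (j : Fin K) :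
    target I σ u (kept I j) = u (σ j) := by
  have h : ∃ j', kept I j' = kept I j := ⟨j, rfl⟩
  rw [target, dif_pos h, kept_injective I h.choose_spec]

/-- The correction in round `i` for teleportation outcomes `P`. -/
def rotation (PX PZ : 𝒰) (G : Fin N → 𝒰) (P : Fin N → Fin 2 × Fin 2) (i : Fin N) : 𝒰 :=
  G i * (pauli PX PZ (P i))⁻¹

/-- The probabilities of the simulator's inputs to `BatchRSP`. -/
def requestWeight (B : Estimator N) (π : Equiv.Perm (Fin N)) (low : Fin N → Bool) :
    Ack N K → Bool → Bool → ℝ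
  | none, false, true => 1
  | some I, false, true => (B (unpermute π I.1) false).toReal +
      if HasLow low I then 0 else (B (unpermute π I.1) true).toReal
  | some I, true, false => if HasLow low I then (B (unpermute π I.1) true).toReal else 0
  | _, _, _ => 0

theorem requestWeight_nonneg (B : Estimator N) (π : Equiv.Perm (Fin N)) (low : Fin N → Bool)
    (I : Ack N K) (c d : Bool) : 0 ≤ requestWeight B π low I c d := by
  unfold requestWeight
  split <;> (try split_ifs) <;> positivity

theorem estimator_add (B : Estimator N) (I : Finset (Fin N)) :
    (B I false).toReal + (B I true).toReal = 1 := by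
  have h := (B I).tsum_coe
  rw [tsum_fintype, Fintype.sum_bool] at h
  rw [← ENNReal.toReal_add ((B I).apply_ne_top _) ((B I).apply_ne_top _), add_comm, h,
    ENNReal.toReal_one]

theorem sum_requestWeight (B : Estimator N) (π : Equiv.Perm (Fin N)) (low : Fin N → Bool)
    (I : Ack N K) : ∑ p : Bool × Bool, requestWeight B π low I p.1 p.2 = 1 := by
  rw [Fintype.sum_prod_type]
  simp only [Fintype.sum_bool]
  cases I with
  | none => simp [requestWeight]
  | some I =>
    have h := estimator_add B (unpermute π I.1)
    by_cases hl : HasLow low I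
    · simp only [requestWeight, if_pos hl]
      linarith
    · simp only [requestWeight, if_neg hl]
      linarith

/-- The kernel of the simulator's emissions. -/
def simKernel (ρ₀ : Matrix (Fin 2) (Fin 2) ℂ) (η : ℝ≥0) (μ : Fin N → ℝ≥0) (i : Fin N)
    (t : Equiv.Perm (Fin N) × (Fin N → 𝒰)) (c : Bool) (n : ℕ) (y : Option ℕ)
    (x x' : Fin (2 ^ N)) : Matrix (Qubits n) (Qubits n) ℂ :=
  (wcpWeight η (permuted μ t.1 i) c n y : ℂ) • simPulse ρ₀ (t.2 i) n y (bit i x) (bit i x')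

/-- The emissions of the simulator. -/
def simEmit (ρ₀ : Matrix (Fin 2) (Fin 2) ℂ) (η : ℝ≥0) (μ : Fin N → ℝ≥0) (i : Fin N)
    (s : SimState 𝒰 N K) (c : Bool) (n : ℕ) :
    SimOut N K → Op (Fin (2 ^ N)) (Fin (2 ^ N) × Qubits n)
  | .inl y => blockEmit (simKernel ρ₀ η μ i s.1 c n y)
  | .inr _ => 0

theorem isCP_zero {a b : Type} : IsCP (0 : Op a b) := fun _ _ _ => Matrix.PosSemidef.zero

theorem isCP_simEmit {ρ₀ : Matrix (Fin 2) (Fin 2) ℂ} (hρ₀ : IsDensity ρ₀) (η : ℝ≥0)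
    (μ : Fin N → ℝ≥0) (i : Fin N) (s : SimState 𝒰 N K) (c : Bool) (n : ℕ) (y : SimOut N K) :
    IsCP (simEmit ρ₀ η μ i s c n y) := by
  rcases y with y | y
  · refine isCP_blockEmit ?_
    exact (((posSemidef_simPulse hρ₀ (s.1.2 i) n y).submatrix
      fun p : Fin (2 ^ N) × Qubits n => (bit i p.1, p.2))).smul
      (show (0 : ℂ) ≤ (wcpWeight η (permuted μ s.1.1 i) c n y : ℂ) by
        exact_mod_cast wcpWeight_nonneg _ _ _ _ _)
  · exact isCP_zero

theorem hasSum_trace_simEmit {ρ₀ : Matrix (Fin 2) (Fin 2) ℂ} (hρ₀ : IsDensity ρ₀) (η : ℝ≥0)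
    (μ : Fin N → ℝ≥0) (i : Fin N) (s : SimState 𝒰 N K) (c : Bool)
    (A : Matrix (Fin (2 ^ N)) (Fin (2 ^ N)) ℂ) :
    HasSum (fun p : ℕ × SimOut N K => (simEmit ρ₀ η μ i s c p.1 p.2 A).trace) A.trace := by
  have hinj : Function.Injective fun p : ℕ × Option ℕ => (p.1, (Sum.inl p.2 : SimOut N K)) := by
    rintro ⟨n, y⟩ ⟨n', y'⟩ h
    simpa using h
  rw [← hinj.hasSum_iff]
  · have h := (Complex.ofRealCLM.hasSum
      (hasSum_wcpWeight η (permuted μ s.1.1 i) c)).mul_right A.trace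
    rw [Complex.ofRealCLM_apply, Complex.ofReal_one, one_mul] at h
    refine (congrArg (HasSum · A.trace) (funext fun p => ?_)).mpr h
    simp only [Function.comp_apply, simEmit, blockEmit, simKernel, LinearMap.coe_mk,
      AddHom.coe_mk, Matrix.trace, Matrix.diag, Matrix.of_apply, Fintype.sum_prod_type,
      Matrix.smul_apply, smul_eq_mul, ← Finset.mul_sum, sum_simPulse_apply hρ₀, mul_one,
      ← Finset.sum_mul, Complex.ofRealCLM_apply]
    exact mul_comm _ _
  · rintro ⟨n, y | y⟩ hp
    · exact absurd ⟨(n, y), rfl⟩ hp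
    · simp [simEmit]

theorem measurable_simEmit (ρ₀ : Matrix (Fin 2) (Fin 2) ℂ) (η : ℝ≥0)
    (μ : Fin N → ℝ≥0) (i : Fin N) (c : Bool) (n : ℕ) (y : SimOut N K)
    (A : Matrix (Fin (2 ^ N)) (Fin (2 ^ N)) ℂ) (a b : Fin (2 ^ N) × Qubits n) :
    Measurable fun s : SimState 𝒰 N K => simEmit ρ₀ η μ i s c n y A a b := by
  rcases y with y | y
  · refine measurable_simState fun π r => ?_
    exact (((measurable_simPulse ρ₀ n y (bit i a.1) (bit i b.1) a.2 b.2).comp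
      (measurable_pi_apply (X := fun _ : Fin N => 𝒰) i)).const_mul
      (wcpWeight η (permuted μ π i) c n y : ℂ)).const_mul (A a.1 b.1)
  · exact measurable_const

theorem measurable_measurePrepare {X a b : Type} [MeasurableSpace X] [Fintype a]
    {E : X → Matrix a a ℂ} (hE : ∀ i j, Measurable fun x => E x i j) (ω : Matrix b b ℂ)
    (A : Matrix a a ℂ) (i j : b) : Measurable fun x => measurePrepare (E x) ω A i j := by
  simp only [measurePrepare, LinearMap.coe_mk, AddHom.coe_mk, Matrix.smul_apply, smul_eq_mul,
    Matrix.trace, Matrix.diag, Matrix.mul_apply]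
  exact (Finset.measurable_sum _ fun k _ => Finset.measurable_sum _ fun l _ =>
    (hE k l).mul_const _).mul_const _

theorem trace_measurePrepare {a : Type} [Fintype a] (E A : Matrix a a ℂ) (N : ℕ) :
    (measurePrepare E (plusState N) A).trace = (E * A).trace := by
  change ((E * A).trace • plusState N).trace = _
  rw [Matrix.trace_smul, (isDensity_plusState N).2, smul_eq_mul, mul_one]

/-- The final operation of the simulator. -/
def simRespond (ρ₀ : Matrix (Fin 2) (Fin 2) ℂ) (PX PZ : 𝒰) (hK : 0 < K) (s : SimState 𝒰 N K) :
    (r : BatchReply 𝒰 K) → SimOut N K → Op (Fin (2 ^ N) × Qubits r.qubits) (Fin (2 ^ N))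
  | .leak k u, .inr (σ, P) => measurePrepare
      (((if σ (lowIndex hK s.2) = k then ((K - 1).factorial : ℝ)⁻¹ else 0 : ℝ) : ℂ) •
        teleport ρ₀ (rotation PX PZ s.1.2 P) (target s.2.ack σ (fillLeak k u))
          (kept s.2.ack (lowIndex hK s.2))) (plusState N)
  | .abort, .inl none => measurePrepare 1 (plusState N)
  | .honest, .inl none => measurePrepare 1 (plusState N)
  | _, _ => 0

/-- The last message of the simulator. -/
def simMessage (PX PZ : 𝒰) (s : SimState 𝒰 N K) :
    BatchReply 𝒰 K → SimOut N K → LastMsg 𝒰 K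
  | .leak k u, .inr (σ, P) => .inr (σ, fun j =>
      if s.2.low (kept s.2.ack j) then rotation PX PZ s.1.2 P (kept s.2.ack j)
      else fillLeak k u (σ j) * (s.1.2 (kept s.2.ack j))⁻¹)
  | _, _ => .inl ()

/-- The first operation of the simulator in the estimation phase. -/
def simRequest (B : Estimator N) (s : SimState 𝒰 N K) (I : Ack N K) (c d : Bool) :
    SimOut N K → Op (Fin (2 ^ N)) (Fin (2 ^ N))
  | .inl none => (requestWeight B s.1.1 s.2.low I c d : ℂ) • LinearMap.id
  | _ => 0

@[fun_prop]
theorem measurable_fillLeak (k j : Fin K) :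
    Measurable fun u : {j : Fin K // j ≠ k} → 𝒰 => fillLeak k u j := by
  by_cases h : j = k
  · simp only [fillLeak, dif_pos h]
    exact measurable_const
  · simp only [fillLeak, dif_neg h]
    exact measurable_pi_apply _

@[fun_prop]
theorem measurable_rotation (PX PZ : 𝒰) (P : Fin N → Fin 2 × Fin 2) (i : Fin N) :
    Measurable fun G : Fin N → 𝒰 => rotation PX PZ G P i := by
  unfold rotation
  fun_prop

theorem measurable_teleport {X : Type} [MeasurableSpace X] (ρ₀ : Matrix (Fin 2) (Fin 2) ℂ)
    {V t : X → Fin N → 𝒰} (hV : ∀ i, Measurable fun x => V x i)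
    (ht : ∀ i, Measurable fun x => t x i) (i₀ : Fin N) (p r : Fin (2 ^ N) × Qubits 1) :
    Measurable fun x => teleport ρ₀ (V x) (t x) i₀ p r := by
  simp only [teleport, Matrix.of_apply]
  refine Finset.measurable_prod _ fun i _ => ?_
  by_cases hi : i = i₀
  · simp only [hi, if_true, bell, Matrix.of_apply]
    have h := fun a b => (measurable_entry (𝒰 := 𝒰) a b).comp (hV i₀)
    exact ((h _ _).mul ((Complex.continuous_conj.measurable).comp (h _ _))).const_mul _
  · simp only [hi, if_false]
    exact ((measurable_conjU ρ₀ _ _).comp ((hV i).inv.mul (ht i))).const_mul _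

theorem measurable_simRespond_leak (ρ₀ : Matrix (Fin 2) (Fin 2) ℂ) (PX PZ : 𝒰) (hK : 0 < K)
    (k : Fin K) (y : SimOut N K) (A : Matrix (Fin (2 ^ N) × Qubits 1) (Fin (2 ^ N) × Qubits 1) ℂ)
    (a b : Fin (2 ^ N)) : Measurable fun p : SimState 𝒰 N K × ({j : Fin K // j ≠ k} → 𝒰) =>
      simRespond ρ₀ PX PZ hK p.1 (.leak k p.2) y A a b := by
  rcases y with y | ⟨σ, P⟩
  · exact measurable_const
  · refine measurable_simState_prod fun π r => ?_
    refine measurable_measurePrepare (E := fun p : (Fin N → 𝒰) × ({j : Fin K // j ≠ k} → 𝒰) =>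
      (((if σ (lowIndex hK r) = k then ((K - 1).factorial : ℝ)⁻¹ else 0 : ℝ) : ℂ) •
        teleport ρ₀ (rotation PX PZ p.1 P) (target r.ack σ (fillLeak k p.2))
          (kept r.ack (lowIndex hK r)))) (fun i j => ?_) (plusState N) A a b
    refine (measurable_teleport ρ₀ (fun i => ?_) (fun i => ?_) _ i j).const_mul _
    · fun_prop
    · unfold target
      by_cases h : ∃ j, kept r.ack j = i
      · simp only [dif_pos h]
        fun_prop
      · simp only [dif_neg h]
        exact measurable_const

theorem measurable_simMessage_leak (PX PZ : 𝒰) (k : Fin K) (y : SimOut N K) :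
    Measurable fun p : SimState 𝒰 N K × ({j : Fin K // j ≠ k} → 𝒰) =>
      simMessage PX PZ p.1 (.leak k p.2) y := by
  rcases y with y | ⟨σ, P⟩
  · exact measurable_const
  · refine measurable_simState_prod fun π r => ?_
    refine measurable_inr.comp (measurable_const.prodMk (measurable_pi_lambda _ fun j => ?_))
    by_cases h : r.low (kept r.ack j) = true
    · simp only [h, if_true]
      fun_prop
    · simp only [h, Bool.false_eq_true, if_false]
      fun_prop

theorem hasSum_sumElim_inr {α β : Type*} [Fintype β] {f : α ⊕ β → ℂ} (hf : ∀ a, f (.inl a) = 0) :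
    HasSum f (∑ b, f (.inr b)) := by
  rw [← Sum.inr_injective.hasSum_iff]
  · exact hasSum_fintype _
  · rintro (a | b) h
    · exact hf a
    · exact absurd ⟨b, rfl⟩ h

theorem isCP_simRespond {ρ₀ : Matrix (Fin 2) (Fin 2) ℂ} (hρ₀ : IsDensity ρ₀) (PX PZ : 𝒰)
    (hK : 0 < K) (s : SimState 𝒰 N K) (r : BatchReply 𝒰 K) (y : SimOut N K) :
    IsCP (simRespond ρ₀ PX PZ hK s r y) := by
  have hplus := (isDensity_plusState N).1
  match r, y with
  | .leak k u, .inr (σ, P) =>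
    refine isCP_measurePrepare ((posSemidef_teleport hρ₀ _ _ _).smul ?_) hplus
    rw [Complex.zero_le_real]
    split_ifs <;> positivity
  | .leak k u, .inl _ => exact isCP_zero
  | .abort, .inl none => exact isCP_measurePrepare Matrix.PosSemidef.one hplus
  | .honest, .inl none => exact isCP_measurePrepare Matrix.PosSemidef.one hplus
  | .abort, .inl (some _) => exact isCP_zero
  | .honest, .inl (some _) => exact isCP_zero
  | .abort, .inr _ => exact isCP_zero
  | .honest, .inr _ => exact isCP_zero

theorem trace_simRespond_leak (ρ₀ : Matrix (Fin 2) (Fin 2) ℂ) (PX PZ : 𝒰) (hK : 0 < K)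
    (s : SimState 𝒰 N K) (k : Fin K) (u : {j : Fin K // j ≠ k} → 𝒰) (σ : Equiv.Perm (Fin K))
    (P : Fin N → Fin 2 × Fin 2)
    (A : Matrix (Fin (2 ^ N) × Qubits 1) (Fin (2 ^ N) × Qubits 1) ℂ) :
    (simRespond ρ₀ PX PZ hK s (.leak k u) (.inr (σ, P)) A).trace =
      (if σ (lowIndex hK s.2) = k then ((K - 1).factorial : ℝ)⁻¹ else 0 : ℝ) *
        (teleport ρ₀ (rotation PX PZ s.1.2 P) (target s.2.ack σ (fillLeak k u))
          (kept s.2.ack (lowIndex hK s.2)) * A).trace := by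
  change (measurePrepare _ (plusState N) A).trace = _
  rw [trace_measurePrepare, Matrix.smul_mul, Matrix.trace_smul, smul_eq_mul]

theorem hasSum_trace_simRespond_leak {ρ₀ : Matrix (Fin 2) (Fin 2) ℂ} (hρ₀ : IsDensity ρ₀)
    {PX PZ : 𝒰} (hX : (PX.1 : Matrix (Fin 2) (Fin 2) ℂ) = pauliX)
    (hZ : (PZ.1 : Matrix (Fin 2) (Fin 2) ℂ) = pauliZ) (hK : 0 < K) (s : SimState 𝒰 N K)
    (k : Fin K) (u : {j : Fin K // j ≠ k} → 𝒰)
    (A : Matrix (Fin (2 ^ N) × Qubits 1) (Fin (2 ^ N) × Qubits 1) ℂ) :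
    HasSum (fun y => (simRespond ρ₀ PX PZ hK s (.leak k u) y A).trace) A.trace := by
  have h : ∀ σ, ∑ P, (teleport ρ₀ (rotation PX PZ s.1.2 P) (target s.2.ack σ (fillLeak k u))
      (kept s.2.ack (lowIndex hK s.2)) * A).trace = A.trace := by
    intro σ
    rw [← Matrix.trace_sum, ← Finset.sum_mul]
    have h1 := sum_teleport hX hZ hρ₀ s.1.2 (target s.2.ack σ (fillLeak k u))
      (kept s.2.ack (lowIndex hK s.2))
    have h2 : ∀ P, rotation PX PZ s.1.2 P = fun i => s.1.2 i * (pauli PX PZ (P i))⁻¹ :=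
      fun _ => rfl
    simp_rw [h2]
    rw [h1, Matrix.one_mul]
  have h' := hasSum_sumElim_inr
    (f := fun y => (simRespond ρ₀ PX PZ hK s (.leak k u) y A).trace) fun y => by
      simp only [simRespond]
      exact Matrix.trace_zero ..
  refine (congrArg (HasSum _) ?_).mp h'
  rw [Fintype.sum_prod_type]
  simp_rw [trace_simRespond_leak]
  simp_rw [← Finset.mul_sum, h]
  rw [← Finset.sum_mul, ← Complex.ofReal_sum, sum_perm_apply_eq, Complex.ofReal_one, one_mul]

/-- An honest reply is never requested by this simulator, but the response must be an instrument
there too: as on an abort, everything is discarded and the memory reset. -/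
theorem hasSum_trace_simRespond {ρ₀ : Matrix (Fin 2) (Fin 2) ℂ} (hρ₀ : IsDensity ρ₀) {PX PZ : 𝒰}
    (hX : (PX.1 : Matrix (Fin 2) (Fin 2) ℂ) = pauliX)
    (hZ : (PZ.1 : Matrix (Fin 2) (Fin 2) ℂ) = pauliZ) (hK : 0 < K) (s : SimState 𝒰 N K)
    (r : BatchReply 𝒰 K) (A : Matrix (Fin (2 ^ N) × Qubits r.qubits) (Fin (2 ^ N) × Qubits r.qubits) ℂ) :
    HasSum (fun y => (simRespond ρ₀ PX PZ hK s r y A).trace) A.trace := by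
  match r, A with
  | .abort, A =>
    convert hasSum_single (f := fun y => (simRespond ρ₀ PX PZ hK s .abort y A).trace)
      (Sum.inl none) ?_ using 1
    · simp only [simRespond]
      rw [trace_measurePrepare, Matrix.one_mul]
    · rintro ((_ | _) | _) h
      · exact absurd rfl h
      · simp [simRespond]
      · simp [simRespond]
  | .honest, A =>
    convert hasSum_single (f := fun y => (simRespond ρ₀ PX PZ hK s .honest y A).trace)
      (Sum.inl none) ?_ using 1
    · simp only [simRespond]
      rw [trace_measurePrepare, Matrix.one_mul]
    · rintro ((_ | _) | _) h
      · exact absurd rfl h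
      · simp [simRespond]
      · simp [simRespond]
  | .leak k u, A => exact hasSum_trace_simRespond_leak hρ₀ hX hZ hK s k u A

theorem hasSum_trace_simRequest (B : Estimator N) (s : SimState 𝒰 N K) (I : Ack N K)
    (A : Matrix (Fin (2 ^ N)) (Fin (2 ^ N)) ℂ) :
    HasSum (fun p : (Bool × Bool) × SimOut N K =>
      (simRequest B s I p.1.1 p.1.2 p.2 A).trace) A.trace := by
  have hinj : Function.Injective fun p : Bool × Bool => (p, (Sum.inl none : SimOut N K)) :=
    fun p q h => (Prod.mk.inj h).1
  rw [← hinj.hasSum_iff]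
  · have h := hasSum_fintype fun p : Bool × Bool =>
      (requestWeight B s.1.1 s.2.low I p.1 p.2 : ℂ) * A.trace
    rw [← Finset.sum_mul, ← Complex.ofReal_sum, sum_requestWeight, Complex.ofReal_one,
      one_mul] at h
    convert h using 1
    funext p
    simp [simRequest]
  · rintro ⟨p, (_ | _) | _⟩ hp
    · exact absurd ⟨p, rfl⟩ hp
    · simp [simRequest]
    · simp [simRequest]

/-- The simulator: it emulates the pulses with random unitaries, except that in rounds with at most
one photon it sends one half of a maximally entangled pair; later it teleports into these rounds
the state obtained from `BatchRSP` and states prepared from the classical descriptions. -/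
def simulator [CompactSpace 𝒰] {ρ₀ : Matrix (Fin 2) (Fin 2) ℂ} (hρ₀ : IsDensity ρ₀) (η : ℝ≥0)
    (μ : Fin N → ℝ≥0) (B : Estimator N) {PX PZ : 𝒰}
    (hX : (PX.1 : Matrix (Fin 2) (Fin 2) ℂ) = pauliX)
    (hZ : (PZ.1 : Matrix (Fin 2) (Fin 2) ℂ) = pauliZ) (hK : 0 < K) (I₀ : KSubset N K) :
    Simulator 𝒰 N K where
  S := SimState 𝒰 N K
  law := (senderLaw 𝒰 N).map fun t => (t, ⟨fun _ => false, I₀⟩)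
  law_prob := by
    have : IsProbabilityMeasure (senderLaw 𝒰 N) := by unfold senderLaw; infer_instance
    exact Measure.isProbabilityMeasure_map (by fun_prop)
  dim := 2 ^ N
  state _ := plusState N
  state_density _ := isDensity_plusState N
  state_meas _ _ := measurable_const
  Y := SimOut N K
  emit := simEmit ρ₀ η μ
  emit_cp := isCP_simEmit hρ₀ η μ
  emit_trace := hasSum_trace_simEmit hρ₀ η μ
  emit_meas := measurable_simEmit ρ₀ η μ
  label i s _ _ y := Sum.elim (wcpLabel (s.1.2 i)) (fun _ => .inl ()) y
  label_meas i _ _ y := by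
    rcases y with y | y
    · exact (measurable_wcpLabel y).comp (by fun_prop)
    · exact measurable_const
  next i s _ n y := (s.1, ⟨Function.update s.2.low i (Sum.elim (isLow n) (fun _ => false) y), s.2.ack⟩)
  next_meas i _ n y := measurable_fst.prodMk ((Measurable.of_discrete (f := fun r : SimMem N K =>
    (⟨Function.update r.low i (Sum.elim (isLow n) (fun _ => false) y), r.ack⟩ : SimMem N K))).comp
      measurable_snd)
  request := simRequest B
  request_cp s I c d y := by
    match y with
    | .inl none => exact isCP_smul_id (requestWeight_nonneg _ _ _ _ _ _)
    | .inl (some _) => exact isCP_zero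
    | .inr _ => exact isCP_zero
  request_trace := hasSum_trace_simRequest B
  request_meas I c d y A a b := by
    refine measurable_simState fun π r => ?_
    match y with
    | .inl none => exact measurable_const (a := ((requestWeight B π r.low I c d : ℂ) •
        (LinearMap.id : Op (Fin (2 ^ N)) (Fin (2 ^ N)))) A a b)
    | .inl (some _) => exact measurable_const
    | .inr _ => exact measurable_const
  nextRequest s I _ _ _ := (s.1, ⟨s.2.low, I.getD s.2.ack⟩)
  nextRequest_meas I _ _ _ := measurable_fst.prodMk ((Measurable.of_discrete
    (f := fun r : SimMem N K => (⟨r.low, I.getD r.ack⟩ : SimMem N K))).comp measurable_snd)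
  respond := simRespond ρ₀ PX PZ hK
  respond_cp := isCP_simRespond hρ₀ PX PZ hK
  respond_trace := hasSum_trace_simRespond hρ₀ hX hZ hK
  respond_abort_meas y A a b := by
    match y with
    | .inl none => exact measurable_const
    | .inl (some _) => exact measurable_const
    | .inr _ => exact measurable_const
  respond_honest_meas y A a b := by
    match y with
    | .inl none => exact measurable_const
    | .inl (some _) => exact measurable_const
    | .inr _ => exact measurable_const
  respond_leak_meas := measurable_simRespond_leak ρ₀ PX PZ hK
  message := simMessage PX PZ
  message_abort_meas _ := measurable_const
  message_honest_meas _ := measurable_const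
  message_leak_meas := measurable_simMessage_leak PX PZ

end Simulation

/-! ### The two worlds as sums over paths -/

section Worlds

variable {𝒰 : Subgroup (Matrix.unitaryGroup (Fin 2) ℂ)} {N K : ℕ}

theorem smul_appendState {D q : Type} (c : ℂ) (τ : Matrix q q ℂ) :
    (c • appendState τ : Op D (D × q)) = blockEmit fun _ _ => c • τ := by
  ext A p r
  change c * (A p.1 r.1 * τ p.2 r.2) = A p.1 r.1 * (c * τ p.2 r.2)
  ring

/-- The probability of the photon numbers and classical outcomes of a path. -/
def pathWeight (η : ℝ≥0) (μ : Fin N → ℝ≥0) (π : Equiv.Perm (Fin N)) (h : Path N) : ℝ≥0∞ :=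
  ∏ i, ENNReal.ofReal (wcpWeight η (permuted μ π i) (h i).1 (h i).2.1 (h i).2.2)

theorem ofReal_prod_wcpWeight (η : ℝ≥0) (μ : Fin N → ℝ≥0) (π : Equiv.Perm (Fin N)) (h : Path N) :
    ENNReal.ofReal (∏ i, wcpWeight η (permuted μ π i) (h i).1 (h i).2.1 (h i).2.2) =
      pathWeight η μ π h :=
  ENNReal.ofReal_prod_of_nonneg fun _ _ => wcpWeight_nonneg _ _ _ _ _

variable (ρ₀ : Matrix (Fin 2) (Fin 2) ℂ) (Z : Distinguisher 𝒰 N K) (h : Path N) (U : Fin N → 𝒰)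
  (u : Fin K → 𝒰) (m : Z.M) (A : Matrix (Fin Z.dim) (Fin Z.dim) ℂ)

/-- The probability weight of a path followed by an abort. -/
def abortProb (I : Ack N K) : ℝ≥0∞ := pathProb ρ₀ Z h U m A I (true, .inl ())

/-- The probability weight of a path followed by acceptance with permutation `σ`. -/
def passProb (I : KSubset N K) (σ : Equiv.Perm (Fin K)) : ℝ≥0∞ :=
  pathProb ρ₀ Z h U m A (some I) (false, .inr (σ, corrections u U I σ))

theorem sum_ack (f : Ack N K → ℝ≥0∞) : ∑ I, f I = f none + ∑ I : KSubset N K, f (some I) :=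
  Fintype.sum_option f

variable [CompactSpace 𝒰] (η : ℝ≥0) (μ : Fin N → ℝ≥0) (B : Estimator N)

theorem isBlockSystem_realSystem : IsBlockSystem (realSystem 𝒰 K ρ₀ η μ B) id id
    fun i t c n y _ _ => (wcpWeight η (permuted μ t.1 i) c n y : ℂ) • pulse ρ₀ (t.2 i) n where
  inj := Function.injective_id
  emit _ _ _ _ _ := smul_appendState _ _
  emit_zero _ _ _ _ y hy := absurd ⟨y, rfl⟩ hy
  label _ _ _ _ _ := rfl
  next _ _ _ _ _ := rfl

theorem sysAfter_realSystem (l : List (Fin N)) (t : Equiv.Perm (Fin N) × (Fin N → 𝒰)) :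
    sysAfter (realSystem 𝒰 K ρ₀ η μ B) id h l t = t := by
  induction l generalizing t with
  | nil => rfl
  | cons i l ih => exact ih t

theorem trace_reply_realSystem (t : Equiv.Perm (Fin N) × (Fin N → 𝒰)) (I : Ack N K)
    (z : Option (Equiv.Perm (Fin K))) (C : Matrix (Fin 1) (Fin 1) ℂ) :
    ((realSystem 𝒰 K ρ₀ η μ B).reply t u I z C).trace =
      ∑ x, ∑ y, C x y * (estimationWeight B t.1 I z : ℂ) := by
  change ((estimationWeight B t.1 I z : ℂ) • C).trace = _
  simp [Matrix.trace, mul_comm]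

/-- The contribution of a path to the real world. -/
def realTerm (π : Equiv.Perm (Fin N)) : ℝ≥0∞ :=
  abortProb ρ₀ Z h U m A none + ∑ I : KSubset N K,
    (B (unpermute π I.1) false * abortProb ρ₀ Z h U m A (some I) +
      B (unpermute π I.1) true *
        ((K.factorial : ℝ≥0∞)⁻¹ * ∑ σ, passProb ρ₀ Z h U u m A I σ))

/-- Multilinearity pulls the photon number weights out of the amplitude as the product `pathWeight`.
-/
theorem play_realSystem (t : Equiv.Perm (Fin N) × (Fin N → 𝒰)) :
    play (realSystem 𝒰 K ρ₀ η μ B) Z u (List.finRange N) m t (A ⊗ₖ (1 : Matrix (Fin 1) (Fin 1) ℂ)) =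
      ∑' h : Path N, pathWeight η μ t.1 h * realTerm ρ₀ Z h t.2 u m A B t.1 := by
  refine ((isBlockSystem_realSystem ρ₀ η μ B).play_eq_tsum Z u m t
    (trace_reply_realSystem ρ₀ u η μ B) A 1).trans ?_
  refine tsum_congr fun h => ?_
  have hz : ∀ I z, ENNReal.ofReal (∑ x : Fin 1, ∑ y : Fin 1,
      (estimationWeight B (sysAfter (realSystem 𝒰 K ρ₀ η μ B) id h (List.finRange N) t).1 I z : ℂ) *
      (1 : Matrix (Fin 1) (Fin 1) ℂ) x y * amp Z h t.2 m A I
        ((realSystem 𝒰 K ρ₀ η μ B).out (sysAfter (realSystem 𝒰 K ρ₀ η μ B) id h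
          (List.finRange N) t) u I z) fun i => (wcpWeight η (permuted μ t.1 i) (h i).1 (h i).2.1
            (h i).2.2 : ℂ) • pulse ρ₀ (t.2 i) (h i).2.1).re =
      pathWeight η μ t.1 h * (ENNReal.ofReal (estimationWeight B t.1 I z) *
        pathProb ρ₀ Z h t.2 m A I (z.isNone, estimationMsg u t.2 I z)) := by
    intro I z
    have hest : 0 ≤ estimationWeight B t.1 I z := by
      unfold estimationWeight
      split <;> positivity
    rw [sysAfter_realSystem, MultilinearMap.map_smul_univ, ← ofReal_prod_wcpWeight, pathProb,
      ← ENNReal.ofReal_mul hest, ← ENNReal.ofReal_mul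
        (Finset.prod_nonneg fun _ _ => wcpWeight_nonneg _ _ _ _ _)]
    congr 1
    simp only [Finset.univ_unique, Finset.sum_singleton, Matrix.one_apply_eq, mul_one,
      ← Complex.ofReal_prod, smul_eq_mul, Complex.re_ofReal_mul]
    simp only [realSystem]
    ring
  refine (Finset.sum_congr rfl fun I _ => tsum_congr fun z => hz I z).trans ?_
  refine (Finset.sum_congr rfl fun I _ => ENNReal.tsum_mul_left).trans ?_
  rw [← Finset.mul_sum]
  congr 1
  have hfin : ∀ f : Option (Equiv.Perm (Fin K)) → ℝ≥0∞, ∑' z, f z = f none + ∑ σ, f (some σ) := by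
    intro f
    rw [tsum_fintype, Fintype.sum_option]
  refine (Finset.sum_congr rfl fun I _ => hfin _).trans ?_
  rw [sum_ack, realTerm]
  congr 1
  · simp [estimationWeight, estimationMsg, abortProb]
  · refine Finset.sum_congr rfl fun I _ => ?_
    have hne := fun b => (B (unpermute t.1 I.1)).apply_ne_top b
    simp only [estimationWeight, estimationMsg, abortProb, passProb, Option.isNone_none,
      Option.isNone_some, ENNReal.ofReal_toReal (hne _)]
    rw [ENNReal.ofReal_div_of_pos (by positivity), ENNReal.ofReal_toReal (hne _),
      ENNReal.ofReal_natCast, ← Finset.mul_sum, div_eq_mul_inv, mul_assoc]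

end Worlds

/-! ### The ideal world: teleportation inside a path -/

section IdealWorld

variable {𝒰 : Subgroup (Matrix.unitaryGroup (Fin 2) ℂ)} {N K : ℕ}

/-- The rounds of a path with at most one photon. -/
def lowRounds (h : Path N) (i : Fin N) : Bool := isLow (h i).2.1 (h i).2.2

/-- The unitaries of the pulses that are emulated by teleporting `t i` into the rounds with at most
one photon with corrections `V i`, and by sending the pulses of `G i` in the other rounds. -/
def twist (h : Path N) (V t G : Fin N → 𝒰) (i : Fin N) : 𝒰 :=
  if lowRounds h i then (V i)⁻¹ * t i else G i

/-- Low rounds carry no description, and in the others the unitary is unchanged, so labels cannot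
reveal the substitution. -/
theorem wcpLabel_twist (h : Path N) (V t G : Fin N → 𝒰) (i : Fin N) :
    wcpLabel (G i) (h i).2.2 = wcpLabel (twist h V t G i) (h i).2.2 := by
  by_cases hi : lowRounds h i = true
  · have hy : (h i).2.2 = none := by
      simp only [lowRounds, isLow, Bool.and_eq_true, Option.isNone_iff_eq_none] at hi
      exact hi.2
    rw [hy]
    rfl
  · rw [twist, if_neg hi]

/-- The heart of the simulation: after multilinear factorisation, each low round becomes a pulse of
`(V i)⁻¹ * t i` and every other round stays a pulse of `G i`. Each qubit contributes `4⁻¹`, one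
factor `2⁻¹` from the superposition and one from the Bell projection. -/
theorem sum_teleport_amp {ρ₀ : Matrix (Fin 2) (Fin 2) ℂ} (hρ₀ : IsDensity ρ₀)
    (Z : Distinguisher 𝒰 N K) (h : Path N) (m : Z.M) (A : Matrix (Fin Z.dim) (Fin Z.dim) ℂ)
    (η : ℝ≥0) (μ : Fin N → ℝ≥0) (I : Ack N K) (o : Bool × LastMsg 𝒰 K) (π : Equiv.Perm (Fin N))
    (V t G : Fin N → 𝒰) :
    ∑ x, ∑ y, (∏ i, 2⁻¹ * conjU ((V i)⁻¹ * t i) ρ₀ (bit i x) (bit i y)) * plusState N x y *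
      amp Z h G m A I o (fun i => simKernel ρ₀ η μ i (π, G) (h i).1 (h i).2.1 (h i).2.2 x y) =
    ((∏ i, wcpWeight η (permuted μ π i) (h i).1 (h i).2.1 (h i).2.2 : ℝ) : ℂ) *
      ((((4 : ℝ) ^ N)⁻¹ : ℝ) : ℂ) * amp Z h (twist h V t G) m A I o fun i => pulse ρ₀
        (twist h V t G i) (h i).2.1 := by
  have h1 : ∀ x y, (∏ i, 2⁻¹ * conjU ((V i)⁻¹ * t i) ρ₀ (bit i x) (bit i y)) * plusState N x y =
      ∏ i, 4⁻¹ * conjU ((V i)⁻¹ * t i) ρ₀ (bit i x) (bit i y) := by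
    intro x y
    have : plusState N x y = ∏ _i : Fin N, (2⁻¹ : ℂ) := by simp [plusState]
    rw [this, ← Finset.prod_mul_distrib]
    exact Finset.prod_congr rfl fun i _ => by ring
  simp_rw [h1]
  have h2 := sum_bit_mul_multilinear (amp Z h G m A I o)
    (fun i a b => 4⁻¹ * conjU ((V i)⁻¹ * t i) ρ₀ a b)
    (fun i a b => (wcpWeight η (permuted μ π i) (h i).1 (h i).2.1 (h i).2.2 : ℂ) •
      simPulse ρ₀ (G i) (h i).2.1 (h i).2.2 a b)
  refine h2.trans ?_
  have h3 : ∀ i, ∑ a, ∑ b, (4⁻¹ * conjU ((V i)⁻¹ * t i) ρ₀ a b) •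
      ((wcpWeight η (permuted μ π i) (h i).1 (h i).2.1 (h i).2.2 : ℂ) •
        simPulse ρ₀ (G i) (h i).2.1 (h i).2.2 a b) =
      ((wcpWeight η (permuted μ π i) (h i).1 (h i).2.1 (h i).2.2 : ℂ) * 4⁻¹) •
        pulse ρ₀ (twist h V t G i) (h i).2.1 := by
    intro i
    simp_rw [smul_comm (4⁻¹ * conjU ((V i)⁻¹ * t i) ρ₀ _ _) (_ : ℂ), ← Finset.smul_sum]
    rw [mul_smul]
    congr 1
    by_cases hi : lowRounds h i = true
    · rw [sum_smul_simPulse_of_isLow hρ₀ _ _ hi, twist, if_pos hi]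
    · rw [sum_smul_simPulse_of_not_isLow hρ₀ _ _ (by simpa [lowRounds] using hi), twist, if_neg hi]
  simp_rw [h3]
  rw [MultilinearMap.map_smul_univ, Finset.prod_mul_distrib,
    amp_congr Z h (wcpLabel_twist h V t G)]
  simp

/-- Of all outcomes of the estimation phase only two kinds have nonzero weight: an abort request,
and a leak request followed by a teleportation outcome. -/
theorem tsum_outcome {a : Type} [Fintype a] {g : (Bool × Bool) × (Option ℕ ⊕ a) × Fin K ×
      (Option ℕ ⊕ a) → ℝ≥0∞}
    (h1 : ∀ p y k y', y ≠ .inl none → g (p, y, k, y') = 0)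
    (h2 : ∀ y k y', g ((false, false), y, k, y') = 0)
    (h3 : ∀ y k y', g ((true, true), y, k, y') = 0)
    (h4 : ∀ k y', y' ≠ .inl none → g ((false, true), .inl none, k, y') = 0)
    (h5 : ∀ k y', g ((true, false), .inl none, k, .inl y') = 0) :
    ∑' z, g z = ∑ k, g ((false, true), .inl none, k, .inl none) +
      ∑ k, ∑ x, g ((true, false), .inl none, k, .inr x) := by
  have hy : ∀ p, ∑' w : (Option ℕ ⊕ a) × Fin K × (Option ℕ ⊕ a), g (p, w) =
      ∑ k, ∑' y', g (p, .inl none, k, y') := by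
    intro p
    rw [ENNReal.tsum_prod', tsum_eq_single (Sum.inl none)]
    · rw [ENNReal.tsum_prod', tsum_fintype]
    · intro y hy
      simp [h1 p y _ _ hy]
  rw [ENNReal.tsum_prod', tsum_fintype, Fintype.sum_prod_type]
  simp only [Fintype.sum_bool, hy, h2, h3]
  simp only [tsum_zero, Finset.sum_const_zero, zero_add, add_zero]
  rw [add_comm]
  congr 1
  · exact Finset.sum_congr rfl fun k _ => tsum_eq_single _ fun y' hy' => h4 k y' hy'
  · refine Finset.sum_congr rfl fun k _ => ?_
    rw [← Sum.inr_injective.tsum_eq, tsum_fintype]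
    rintro (y' | y') hy'
    · exact absurd (h5 k y') hy'
    · exact ⟨y', rfl⟩

theorem trace_op_eq_sum {a b : Type} [Fintype a] [DecidableEq a] [Fintype b] (Φ : Op a b)
    (C : Matrix a a ℂ) :
    (Φ C).trace = ∑ x, ∑ y, C x y * (Φ (Matrix.single x y 1)).trace := by
  conv_lhs => rw [Matrix.matrix_eq_sum_single C]
  simp only [map_sum, Matrix.trace_sum]
  refine Finset.sum_congr rfl fun x _ => Finset.sum_congr rfl fun y _ => ?_
  rw [show Matrix.single x y (C x y) = C x y • Matrix.single x y (1 : ℂ) by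
    rw [Matrix.smul_single, smul_eq_mul, mul_one], map_smul, Matrix.trace_smul, smul_eq_mul]

theorem ofReal_inv_four_pow (N : ℕ) : ENNReal.ofReal (((4 : ℝ) ^ N)⁻¹) = ((4 : ℝ≥0∞) ^ N)⁻¹ := by
  rw [ENNReal.ofReal_inv_of_pos (by positivity), ENNReal.ofReal_pow (by norm_num),
    ENNReal.ofReal_ofNat]

/-- The probability weight of a path and a final message in the ideal world, for given coefficients
of the final operation. -/
def coeffProb (ρ₀ : Matrix (Fin 2) (Fin 2) ℂ) (η : ℝ≥0) (μ : Fin N → ℝ≥0)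
    (Z : Distinguisher 𝒰 N K) (h : Path N) (t : Equiv.Perm (Fin N) × (Fin N → 𝒰))
    (m : Z.M) (A : Matrix (Fin Z.dim) (Fin Z.dim) ℂ) (I : Ack N K)
    (e : Fin (2 ^ N) → Fin (2 ^ N) → ℂ) (o : Bool × LastMsg 𝒰 K) : ℝ≥0∞ :=
  ENNReal.ofReal (∑ x, ∑ y, e x y * plusState N x y * amp Z h t.2 m A I o
    fun i => simKernel ρ₀ η μ i t (h i).1 (h i).2.1 (h i).2.2 x y).re

theorem coeffProb_zero (ρ₀ : Matrix (Fin 2) (Fin 2) ℂ) (η : ℝ≥0) (μ : Fin N → ℝ≥0)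
    (Z : Distinguisher 𝒰 N K) (h : Path N)
    (t : Equiv.Perm (Fin N) × (Fin N → 𝒰)) (m : Z.M) (A : Matrix (Fin Z.dim) (Fin Z.dim) ℂ)
    (I : Ack N K) (o : Bool × LastMsg 𝒰 K) :
    coeffProb ρ₀ η μ Z h t m A I (fun _ _ => 0) o = 0 := by
  simp [coeffProb]

theorem coeffProb_teleport {ρ₀ : Matrix (Fin 2) (Fin 2) ℂ} (hρ₀ : IsDensity ρ₀) (η : ℝ≥0)
    (μ : Fin N → ℝ≥0) (Z : Distinguisher 𝒰 N K) (h : Path N)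
    (t : Equiv.Perm (Fin N) × (Fin N → 𝒰)) (m : Z.M) (A : Matrix (Fin Z.dim) (Fin Z.dim) ℂ)
    (I : Ack N K) (o : Bool × LastMsg 𝒰 K) (V v : Fin N → 𝒰) {r : ℝ} (hr : 0 ≤ r) :
    coeffProb ρ₀ η μ Z h t m A I (fun x y => (r : ℂ) * ∏ i, 2⁻¹ * conjU ((V i)⁻¹ * v i) ρ₀
      (bit i x) (bit i y)) o = pathWeight η μ t.1 h * (ENNReal.ofReal r *
        (((4 : ℝ≥0∞) ^ N)⁻¹ * pathProb ρ₀ Z h (twist h V v t.2) m A I o)) := by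
  have hp : 0 ≤ ∏ i, wcpWeight η (permuted μ t.1 i) (h i).1 (h i).2.1 (h i).2.2 :=
    Finset.prod_nonneg fun _ _ => wcpWeight_nonneg _ _ _ _ _
  rw [coeffProb]
  simp_rw [mul_assoc (r : ℂ), ← Finset.mul_sum]
  rw [sum_teleport_amp hρ₀ Z h m A η μ I o t.1 V v t.2, pathProb, ← ofReal_prod_wcpWeight,
    ← ofReal_inv_four_pow, ← ENNReal.ofReal_mul (by positivity), ← ENNReal.ofReal_mul hr,
    ← ENNReal.ofReal_mul hp]
  congr 1
  rw [mul_assoc, Complex.re_ofReal_mul, Complex.re_ofReal_mul, Complex.re_ofReal_mul]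
  ring

/-- On an abort the memory is discarded. The identity functional is resolved by the Pauli twirl into
fictitious teleportations of `ρ₀`, with trivial target `1`, so that this branch too becomes an
average over effective unitaries. -/
theorem coeffProb_one {ρ₀ : Matrix (Fin 2) (Fin 2) ℂ} (hρ₀ : IsDensity ρ₀) (η : ℝ≥0)
    (μ : Fin N → ℝ≥0) {PX PZ : 𝒰} (hX : (PX.1 : Matrix (Fin 2) (Fin 2) ℂ) = pauliX)
    (hZ : (PZ.1 : Matrix (Fin 2) (Fin 2) ℂ) = pauliZ) (Z : Distinguisher 𝒰 N K) (h : Path N)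
    (t : Equiv.Perm (Fin N) × (Fin N → 𝒰)) (m : Z.M) {A : Matrix (Fin Z.dim) (Fin Z.dim) ℂ}
    (hA : A.PosSemidef) (I : Ack N K) (o : Bool × LastMsg 𝒰 K) {r : ℝ} (hr : 0 ≤ r) :
    coeffProb ρ₀ η μ Z h t m A I (fun x y => (r : ℂ) * if x = y then 1 else 0) o =
      pathWeight η μ t.1 h * (ENNReal.ofReal r * ∑ P, ((4 : ℝ≥0∞) ^ N)⁻¹ *
        pathProb ρ₀ Z h (twist h (rotation PX PZ t.2 P) 1 t.2) m A I o) := by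
  rw [Finset.mul_sum, Finset.mul_sum]
  simp_rw [← coeffProb_teleport hρ₀ η μ Z h t m A I o _ _ hr]
  simp_rw [coeffProb]
  rw [← ENNReal.ofReal_sum_of_nonneg]
  · congr 1
    rw [← Complex.re_sum]
    refine congrArg Complex.re ?_
    refine Eq.trans (Finset.sum_congr rfl fun x _ => ?_) Finset.sum_comm
    refine Eq.trans (Finset.sum_congr rfl fun y _ => ?_) Finset.sum_comm
    rw [← Finset.sum_mul, ← Finset.sum_mul, ← Finset.mul_sum]
    congr 3
    exact (sum_prod_conjU hX hZ hρ₀ t.2 1 x y).symm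
  · intro P _
    simp_rw [mul_assoc (r : ℂ), ← Finset.mul_sum]
    rw [sum_teleport_amp hρ₀ Z h m A η μ I o t.1 _ _ t.2, mul_assoc, Complex.re_ofReal_mul,
      Complex.re_ofReal_mul, Complex.re_ofReal_mul]
    have h1 := amp_re_nonneg hρ₀ Z h (twist h (rotation PX PZ t.2 P) 1 t.2) m hA I o
    have hp : 0 ≤ ∏ i, wcpWeight η (permuted μ t.1 i) (h i).1 (h i).2.1 (h i).2.2 :=
      Finset.prod_nonneg fun _ _ => wcpWeight_nonneg _ _ _ _ _
    positivity

/-- In a low round the honest correction for the effective unitary is `t (V⁻¹ t)⁻¹ = V`, which needs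
no knowledge of the target. In the other rounds the target is known, because the index missing from
the leak is assigned to a low round. -/
theorem simMessage_leak {PX PZ : 𝒰} (hK : 0 < K) (s : SimState 𝒰 N K) (h : Path N) (u : Fin K → 𝒰)
    (σ : Equiv.Perm (Fin K)) (P : Fin N → Fin 2 × Fin 2) (hs : s.2.low = lowRounds h)
    (hl : HasLow s.2.low s.2.ack) :
    simMessage PX PZ s (.leak (σ (lowIndex hK s.2)) fun j => u j) (.inr (σ, P)) =
      .inr (σ, corrections u (twist h (rotation PX PZ s.1.2 P) (target s.2.ack σ u) s.1.2)
        s.2.ack σ) := by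
  refine congrArg (fun f => Sum.inr (σ, f)) (funext fun j => ?_)
  rw [corrections, twist, target_kept]
  have hlow : s.2.low (kept s.2.ack (lowIndex hK s.2)) = true := by
    rw [lowIndex, dif_pos hl]
    exact hl.choose_spec
  by_cases hj : s.2.low (kept s.2.ack j) = true
  · rw [if_pos hj, if_pos (by rw [← hs, hj]), mul_inv_rev, inv_inv, mul_inv_cancel_left]
  · rw [if_neg hj, if_neg (by rw [← hs]; exact hj), fillLeak, dif_neg]
    intro hh
    exact hj (by rw [σ.injective hh, hlow])

variable [CompactSpace 𝒰] {ρ₀ : Matrix (Fin 2) (Fin 2) ℂ} (hρ₀ : IsDensity ρ₀) (η : ℝ≥0)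
  (μ : Fin N → ℝ≥0) (B : Estimator N) {PX PZ : 𝒰}
  (hX : (PX.1 : Matrix (Fin 2) (Fin 2) ℂ) = pauliX)
  (hZ : (PZ.1 : Matrix (Fin 2) (Fin 2) ℂ) = pauliZ) (hK : 0 < K) (I₀ : KSubset N K)

theorem isBlockSystem_idealSystem :
    IsBlockSystem (idealSystem ρ₀ (simulator hρ₀ η μ B hX hZ hK I₀)) Prod.fst Sum.inl
      (simKernel ρ₀ η μ) where
  inj := Sum.inl_injective
  emit _ _ _ _ _ := rfl
  emit_zero := by
    rintro i s c n (y | y) hy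
    · exact absurd ⟨y, rfl⟩ hy
    · rfl
  label _ _ _ _ _ := rfl
  next _ _ _ _ _ := rfl

theorem sysAfter_idealSystem (h : Path N) (l : List (Fin N)) (s : SimState 𝒰 N K) :
    sysAfter (idealSystem ρ₀ (simulator hρ₀ η μ B hX hZ hK I₀)) Sum.inl h l s =
      (s.1, ⟨fun j => if j ∈ l then lowRounds h j else s.2.low j, s.2.ack⟩) := by
  induction l generalizing s with
  | nil =>
    simp only [sysAfter, List.not_mem_nil, if_false]
    rfl
  | cons i l ih =>
    refine Eq.trans ?_ ((ih (s.1, ⟨Function.update s.2.low i (lowRounds h i), s.2.ack⟩)).trans ?_)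
    · rfl
    refine congrArg (fun f => (s.1, (⟨f, s.2.ack⟩ : SimMem N K))) (funext fun j => ?_)
    by_cases hj : j ∈ l
    · simp [hj]
    · rcases eq_or_ne j i with rfl | hji
      · simp
      · simp [hj, hji]

theorem trace_reply_abort (u : Fin K → 𝒰) (s : SimState 𝒰 N K) (I : Ack N K) (c : Bool)
    (k : Fin K) (C : Matrix (Fin (2 ^ N)) (Fin (2 ^ N)) ℂ) :
    ((idealSystem ρ₀ (simulator hρ₀ η μ B hX hZ hK I₀)).reply s u I
      ((c, true), .inl none, k, .inl none) C).trace =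
      ((K : ℝ)⁻¹ * requestWeight B s.1.1 s.2.low I c true : ℝ) * C.trace := by
  change ((K : ℂ)⁻¹ • (measurePrepare 1 (plusState N)
    (((requestWeight B s.1.1 s.2.low I c true : ℂ) • C) ⊗ₖ
      prodState (Fin.elim0 : Fin 0 → Matrix (Fin 2) (Fin 2) ℂ)))).trace = _
  rw [Matrix.trace_smul, trace_measurePrepare, Matrix.one_mul, Matrix.trace_kronecker,
    trace_prodState, Matrix.trace_smul]
  simp [mul_assoc]

theorem trace_reply_leak (u : Fin K → 𝒰) (s : SimState 𝒰 N K) (I : KSubset N K)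
    (k : Fin K) (σ : Equiv.Perm (Fin K)) (P : Fin N → Fin 2 × Fin 2)
    (C : Matrix (Fin (2 ^ N)) (Fin (2 ^ N)) ℂ) :
    ((idealSystem ρ₀ (simulator hρ₀ η μ B hX hZ hK I₀)).reply s u (some I)
      ((true, false), .inl none, k, .inr (σ, P)) C).trace =
      ((K : ℝ)⁻¹ * requestWeight B s.1.1 s.2.low (some I) true false *
        (if σ (lowIndex hK ⟨s.2.low, I⟩) = k then ((K - 1).factorial : ℝ)⁻¹ else 0) : ℝ) *
      ∑ x, ∑ y, C x y * ∏ i, 2⁻¹ * conjU ((rotation PX PZ s.1.2 P i)⁻¹ * target I σ u i) ρ₀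
        (bit i x) (bit i y) := by
  change ((K : ℂ)⁻¹ • (simRespond ρ₀ PX PZ hK (s.1, ⟨s.2.low, I⟩) (.leak k fun j => u j) (.inr (σ, P))
    (((requestWeight B s.1.1 s.2.low (some I) true false : ℂ) • C) ⊗ₖ
      prodState fun _ : Fin 1 => conjU (u k) ρ₀))).trace = _
  rw [Matrix.trace_smul]
  refine (congrArg ((K : ℂ)⁻¹ • ·) (trace_simRespond_leak ρ₀ PX PZ hK (s.1, ⟨s.2.low, I⟩) k
    (fun j => u j) σ P (((requestWeight B s.1.1 s.2.low (some I) true false : ℂ) • C) ⊗ₖ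
      prodState fun _ : Fin 1 => conjU (u k) ρ₀))).trans ?_
  by_cases hσ : σ (lowIndex hK ⟨s.2.low, I⟩) = k
  · subst hσ
    have htel : teleport ρ₀ (rotation PX PZ s.1.2 P) (target I σ (fillLeak
        (σ (lowIndex hK ⟨s.2.low, I⟩)) fun j => u j)) (kept I (lowIndex hK ⟨s.2.low, I⟩)) =
        teleport ρ₀ (rotation PX PZ s.1.2 P) (target I σ u)
          (kept I (lowIndex hK ⟨s.2.low, I⟩)) := by
      ext p r
      simp only [teleport, Matrix.of_apply]
      refine Finset.prod_congr rfl fun i _ => ?_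
      by_cases hi : i = kept I (lowIndex hK ⟨s.2.low, I⟩)
      · simp only [hi, if_true]
      · simp only [hi, if_false]
        have : target I σ (fillLeak (σ (lowIndex hK ⟨s.2.low, I⟩)) fun j => u j) i =
            target I σ u i := by
          by_cases hj : ∃ j, kept I j = i
          · obtain ⟨j, rfl⟩ := hj
            rw [target_kept, target_kept, fillLeak, dif_neg]
            intro hh
            exact hi (by rw [σ.injective hh])
          · rw [target, target, dif_neg hj, dif_neg hj]
        rw [this]
    have htk := trace_teleport_mul (ρ₀ := ρ₀) (rotation PX PZ s.1.2 P) (target I σ u)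
      (kept I (lowIndex hK ⟨s.2.low, I⟩)) C
    rw [target_kept] at htk
    simp only [if_true]
    rw [htel, Matrix.smul_kronecker, Matrix.mul_smul, Matrix.trace_smul, htk]
    push_cast
    simp only [smul_eq_mul]
    ring
  · simp only [if_neg hσ]
    simp

theorem trace_reply_of_request_eq_zero (u : Fin K → 𝒰) (s : SimState 𝒰 N K) (I : Ack N K)
    {c d : Bool} {y : SimOut N K} (hy : simRequest B s I c d y = 0) (k : Fin K) (y' : SimOut N K)
    (C : Matrix (Fin (2 ^ N)) (Fin (2 ^ N)) ℂ) :
    ((idealSystem ρ₀ (simulator hρ₀ η μ B hX hZ hK I₀)).reply s u I ((c, d), y, k, y') C).trace =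
      0 := by
  have h : (idealSystem ρ₀ (simulator hρ₀ η μ B hX hZ hK I₀)).reply s u I ((c, d), y, k, y') =
      (K : ℂ)⁻¹ • (simRespond ρ₀ PX PZ hK (s.1, ⟨s.2.low, I.getD s.2.ack⟩) (batchReply u c d k) y' ∘ₗ
        appendState (batchState ρ₀ u (batchReply u c d k)) ∘ₗ simRequest B s I c d y) := rfl
  rw [h, hy, LinearMap.comp_zero, LinearMap.comp_zero, smul_zero]
  exact Matrix.trace_zero ..

theorem trace_reply_of_respond_eq_zero (u : Fin K → 𝒰) (s : SimState 𝒰 N K) (I : Ack N K)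
    {c d : Bool} {y y' : SimOut N K} {k : Fin K} (hy : simRespond ρ₀ PX PZ hK
      (s.1, ⟨s.2.low, I.getD s.2.ack⟩) (batchReply u c d k) y' = 0)
    (C : Matrix (Fin (2 ^ N)) (Fin (2 ^ N)) ℂ) :
    ((idealSystem ρ₀ (simulator hρ₀ η μ B hX hZ hK I₀)).reply s u I ((c, d), y, k, y') C).trace =
      0 := by
  have h : (idealSystem ρ₀ (simulator hρ₀ η μ B hX hZ hK I₀)).reply s u I ((c, d), y, k, y') =
      (K : ℂ)⁻¹ • (simRespond ρ₀ PX PZ hK (s.1, ⟨s.2.low, I.getD s.2.ack⟩) (batchReply u c d k) y' ∘ₗ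
        appendState (batchState ρ₀ u (batchReply u c d k)) ∘ₗ simRequest B s I c d y) := rfl
  rw [h, hy, LinearMap.zero_comp, smul_zero]
  exact Matrix.trace_zero ..

theorem requestWeight_eq_zero (B : Estimator N) (π : Equiv.Perm (Fin N)) (low : Fin N → Bool)
    (I : Ack N K) (c : Bool) : requestWeight B π low I c c = 0 := by
  cases I <;> cases c <;> rfl

/-- The coefficients of the final operation of the ideal world with outcome `z`. -/
def replyCoeff (u : Fin K → 𝒰) (s : SimState 𝒰 N K) (I : Ack N K)
    (z : (Bool × Bool) × SimOut N K × Fin K × SimOut N K) (x y : Fin (2 ^ N)) : ℂ :=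
  ((idealSystem ρ₀ (simulator hρ₀ η μ B hX hZ hK I₀)).reply s u I z (Matrix.single x y 1)).trace

theorem replyCoeff_eq_zero {u : Fin K → 𝒰} {s : SimState 𝒰 N K} {I : Ack N K}
    {z : (Bool × Bool) × SimOut N K × Fin K × SimOut N K}
    (hz : ∀ C, ((idealSystem ρ₀ (simulator hρ₀ η μ B hX hZ hK I₀)).reply s u I z C).trace = 0) :
    replyCoeff hρ₀ η μ B hX hZ hK I₀ u s I z = fun _ _ => 0 :=
  funext fun _ => funext fun _ => hz _

theorem replyCoeff_abort (u : Fin K → 𝒰) (s : SimState 𝒰 N K) (I : Ack N K) (c : Bool)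
    (k : Fin K) (x y : Fin (2 ^ N)) :
    replyCoeff hρ₀ η μ B hX hZ hK I₀ u s I ((c, true), .inl none, k, .inl none) x y =
      ((K : ℝ)⁻¹ * requestWeight B s.1.1 s.2.low I c true : ℝ) * if x = y then 1 else 0 := by
  refine (trace_reply_abort hρ₀ η μ B hX hZ hK I₀ u s I c k (Matrix.single x y 1)).trans ?_
  by_cases hxy : x = y
  · subst hxy
    simp [Matrix.trace_single_eq_same]
  · rw [Matrix.trace_single_eq_of_ne _ _ _ hxy, if_neg hxy]

theorem replyCoeff_leak (u : Fin K → 𝒰) (s : SimState 𝒰 N K) (I : KSubset N K)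
    (k : Fin K) (σ : Equiv.Perm (Fin K)) (P : Fin N → Fin 2 × Fin 2) (x y : Fin (2 ^ N)) :
    replyCoeff hρ₀ η μ B hX hZ hK I₀ u s (some I) ((true, false), .inl none, k, .inr (σ, P)) x y =
      ((K : ℝ)⁻¹ * requestWeight B s.1.1 s.2.low (some I) true false *
        (if σ (lowIndex hK ⟨s.2.low, I⟩) = k then ((K - 1).factorial : ℝ)⁻¹ else 0) : ℝ) *
      ∏ i, 2⁻¹ * conjU ((rotation PX PZ s.1.2 P i)⁻¹ * target I σ u i) ρ₀ (bit i x) (bit i y) := by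
  refine (trace_reply_leak hρ₀ η μ B hX hZ hK I₀ u s I k σ P (Matrix.single x y 1)).trans ?_
  congr 1
  simp [Matrix.single_apply, ite_and]

/-- The contribution of a path to the ideal world. -/
def idealTerm (ρ₀ : Matrix (Fin 2) (Fin 2) ℂ) (B : Estimator N) (PX PZ : 𝒰)
    (Z : Distinguisher 𝒰 N K) (h : Path N) (u : Fin K → 𝒰) (m : Z.M)
    (A : Matrix (Fin Z.dim) (Fin Z.dim) ℂ) (π : Equiv.Perm (Fin N)) (G : Fin N → 𝒰) : ℝ≥0∞ :=
  ∑ I, ENNReal.ofReal (requestWeight B π (lowRounds h) I false true) *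
      ∑ P, ((4 : ℝ≥0∞) ^ N)⁻¹ * abortProb ρ₀ Z h (twist h (rotation PX PZ G P) 1 G) m A I +
  ∑ I, ENNReal.ofReal (requestWeight B π (lowRounds h) (some I) true false) *
    ((K.factorial : ℝ≥0∞)⁻¹ * ∑ σ, ∑ P, ((4 : ℝ≥0∞) ^ N)⁻¹ *
      passProb ρ₀ Z h (twist h (rotation PX PZ G P) (target I σ u) G) u m A I σ)

/-- The index `k` is part of the outcome even on an abort, but nothing depends on it: `K` equal
terms of weight `K⁻¹`. -/
theorem sum_coeffProb_abort (Z : Distinguisher 𝒰 N K) (h : Path N) (u : Fin K → 𝒰) (m : Z.M)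
    {A : Matrix (Fin Z.dim) (Fin Z.dim) ℂ} (hA : A.PosSemidef) (s : SimState 𝒰 N K) (I : Ack N K) :
    ∑ k, coeffProb ρ₀ η μ Z h s.1 m A I (replyCoeff hρ₀ η μ B hX hZ hK I₀ u s I
      ((false, true), .inl none, k, .inl none)) (true, .inl ()) =
    pathWeight η μ s.1.1 h * (ENNReal.ofReal (requestWeight B s.1.1 s.2.low I false true) *
      ∑ P, ((4 : ℝ≥0∞) ^ N)⁻¹ *
        abortProb ρ₀ Z h (twist h (rotation PX PZ s.1.2 P) 1 s.1.2) m A I) := by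
  have hw := requestWeight_nonneg B s.1.1 s.2.low I false true
  have hk : ∀ k, coeffProb ρ₀ η μ Z h s.1 m A I (replyCoeff hρ₀ η μ B hX hZ hK I₀ u s I
      ((false, true), .inl none, k, .inl none)) (true, .inl ()) = (K : ℝ≥0∞)⁻¹ *
      (pathWeight η μ s.1.1 h * (ENNReal.ofReal (requestWeight B s.1.1 s.2.low I false true) *
      ∑ P, ((4 : ℝ≥0∞) ^ N)⁻¹ *
        abortProb ρ₀ Z h (twist h (rotation PX PZ s.1.2 P) 1 s.1.2) m A I)) := by
    intro k
    have he : replyCoeff hρ₀ η μ B hX hZ hK I₀ u s I ((false, true), .inl none, k, .inl none) =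
        fun x y => (((K : ℝ)⁻¹ * requestWeight B s.1.1 s.2.low I false true : ℝ) : ℂ) *
          if x = y then 1 else 0 :=
      funext fun x => funext fun y => replyCoeff_abort hρ₀ η μ B hX hZ hK I₀ u s I false k x y
    rw [he, coeffProb_one hρ₀ η μ hX hZ Z h s.1 m hA I _ (by positivity),
      ENNReal.ofReal_mul (by positivity), ENNReal.ofReal_inv_of_pos (by positivity),
      ENNReal.ofReal_natCast]
    simp only [abortProb]
    ring
  simp_rw [hk]
  rw [Finset.sum_const, Finset.card_univ, Fintype.card_fin, nsmul_eq_mul, ← mul_assoc,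
    ENNReal.mul_inv_cancel (by exact_mod_cast hK.ne') (ENNReal.natCast_ne_top K), one_mul]

/-- A uniform `k`, followed by a uniform `σ` among the `(K - 1)!` permutations that send the chosen
low index to `k`, gives a uniform `σ`, as in the protocol: `K⁻¹ · (K - 1)!⁻¹ = K!⁻¹`. -/
theorem sum_coeffProb_leak (Z : Distinguisher 𝒰 N K) (h : Path N) (u : Fin K → 𝒰) (m : Z.M)
    (A : Matrix (Fin Z.dim) (Fin Z.dim) ℂ) (s : SimState 𝒰 N K) (hs : s.2.low = lowRounds h)
    (I : KSubset N K) :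
    ∑ k, ∑ x : Equiv.Perm (Fin K) × (Fin N → Fin 2 × Fin 2), coeffProb ρ₀ η μ Z h s.1 m A (some I)
      (replyCoeff hρ₀ η μ B hX hZ hK I₀ u s (some I) ((true, false), .inl none, k, .inr x))
      (false, simMessage PX PZ (s.1, ⟨s.2.low, I⟩) (.leak k fun j => u j) (.inr x)) =
    pathWeight η μ s.1.1 h * (ENNReal.ofReal (requestWeight B s.1.1 s.2.low (some I) true false) *
      ((K.factorial : ℝ≥0∞)⁻¹ * ∑ σ, ∑ P, ((4 : ℝ≥0∞) ^ N)⁻¹ *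
        passProb ρ₀ Z h (twist h (rotation PX PZ s.1.2 P) (target I σ u) s.1.2) u m A I σ)) := by
  have hw := requestWeight_nonneg B s.1.1 s.2.low (some I) true false
  have hfac : (K.factorial : ℝ≥0∞)⁻¹ = ENNReal.ofReal ((K : ℝ)⁻¹ * ((K - 1).factorial : ℝ)⁻¹) := by
    rw [← mul_inv, ← Nat.cast_mul, Nat.mul_factorial_pred hK.ne',
      ENNReal.ofReal_inv_of_pos (by positivity), ENNReal.ofReal_natCast]
  have hx : ∀ (k : Fin K) (σ : Equiv.Perm (Fin K)) (P : Fin N → Fin 2 × Fin 2),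
      coeffProb ρ₀ η μ Z h s.1 m A (some I)
        (replyCoeff hρ₀ η μ B hX hZ hK I₀ u s (some I) ((true, false), .inl none, k, .inr (σ, P)))
        (false, simMessage PX PZ (s.1, ⟨s.2.low, I⟩) (.leak k fun j => u j) (.inr (σ, P))) =
      if k = σ (lowIndex hK ⟨s.2.low, I⟩) then pathWeight η μ s.1.1 h *
        (ENNReal.ofReal (requestWeight B s.1.1 s.2.low (some I) true false) *
        ((K.factorial : ℝ≥0∞)⁻¹ * (((4 : ℝ≥0∞) ^ N)⁻¹ *
        passProb ρ₀ Z h (twist h (rotation PX PZ s.1.2 P) (target I σ u) s.1.2) u m A I σ)))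
      else 0 := by
    intro k σ P
    have he : replyCoeff hρ₀ η μ B hX hZ hK I₀ u s (some I)
        ((true, false), .inl none, k, .inr (σ, P)) =
        fun x y => (((K : ℝ)⁻¹ * requestWeight B s.1.1 s.2.low (some I) true false *
          (if σ (lowIndex hK ⟨s.2.low, I⟩) = k then ((K - 1).factorial : ℝ)⁻¹ else 0) : ℝ) : ℂ) *
        ∏ i, 2⁻¹ * conjU ((rotation PX PZ s.1.2 P i)⁻¹ * target I σ u i) ρ₀ (bit i x) (bit i y) :=
      funext fun x => funext fun y => replyCoeff_leak hρ₀ η μ B hX hZ hK I₀ u s I k σ P x y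
    rw [he, coeffProb_teleport hρ₀ η μ Z h s.1 m A (some I) _ _ _
      (mul_nonneg (by positivity) (by split_ifs <;> positivity))]
    by_cases hk : k = σ (lowIndex hK ⟨s.2.low, I⟩)
    · subst hk
      rw [if_pos rfl, if_pos rfl]
      by_cases hl : HasLow s.2.low I
      · rw [simMessage_leak hK (s.1, ⟨s.2.low, I⟩) h u σ P hs hl, hfac,
          mul_right_comm, ENNReal.ofReal_mul (by positivity), passProb]
        ring
      · simp [requestWeight, hl]
    · rw [if_neg hk, if_neg (Ne.symm hk)]
      simp
  simp_rw [Fintype.sum_prod_type, hx]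
  rw [Finset.sum_comm]
  simp_rw [Finset.mul_sum]
  refine Finset.sum_congr rfl fun σ _ => ?_
  rw [Finset.sum_comm]
  refine Finset.sum_congr rfl fun P _ => ?_
  rw [Finset.sum_ite_eq' Finset.univ, if_pos (Finset.mem_univ _)]

theorem play_idealSystem (Z : Distinguisher 𝒰 N K) (u : Fin K → 𝒰) (m : Z.M)
    {A : Matrix (Fin Z.dim) (Fin Z.dim) ℂ} (hA : A.PosSemidef) (s : SimState 𝒰 N K) :
    play (idealSystem ρ₀ (simulator hρ₀ η μ B hX hZ hK I₀)) Z u (List.finRange N) m s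
      (A ⊗ₖ plusState N) = ∑' h : Path N, pathWeight η μ s.1.1 h *
        idealTerm ρ₀ B PX PZ Z h u m A s.1.1 s.1.2 := by
  refine ((isBlockSystem_idealSystem hρ₀ η μ B hX hZ hK I₀).play_eq_tsum Z u m s
    (e := fun s I z x y => replyCoeff hρ₀ η μ B hX hZ hK I₀ u s I z x y)
    (fun s I z C => trace_op_eq_sum _ C) A (plusState N)).trans ?_
  refine tsum_congr fun h => ?_
  rw [sysAfter_idealSystem]
  simp only [List.mem_finRange, if_true]
  change ∑ I, ∑' z, coeffProb ρ₀ η μ Z h s.1 m A I (replyCoeff hρ₀ η μ B hX hZ hK I₀ u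
    (s.1, ⟨lowRounds h, s.2.ack⟩) I z) (z.1.2, simMessage PX PZ (s.1, ⟨lowRounds h, I.getD s.2.ack⟩)
      (batchReply u z.1.1 z.1.2 z.2.2.1) z.2.2.2) = _
  have hout : ∀ I : Ack N K, ∑' z, coeffProb ρ₀ η μ Z h s.1 m A I (replyCoeff hρ₀ η μ B hX hZ hK I₀
      u (s.1, ⟨lowRounds h, s.2.ack⟩) I z) (z.1.2, simMessage PX PZ
        (s.1, ⟨lowRounds h, I.getD s.2.ack⟩) (batchReply u z.1.1 z.1.2 z.2.2.1) z.2.2.2) =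
      ∑ k, coeffProb ρ₀ η μ Z h s.1 m A I (replyCoeff hρ₀ η μ B hX hZ hK I₀ u
        (s.1, ⟨lowRounds h, s.2.ack⟩) I ((false, true), .inl none, k, .inl none)) (true, .inl ()) +
      ∑ k, ∑ x, coeffProb ρ₀ η μ Z h s.1 m A I (replyCoeff hρ₀ η μ B hX hZ hK I₀ u
        (s.1, ⟨lowRounds h, s.2.ack⟩) I ((true, false), .inl none, k, .inr x))
        (false, simMessage PX PZ (s.1, ⟨lowRounds h, I.getD s.2.ack⟩) (.leak k fun j => u j)
          (.inr x)) := by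
    intro I
    have hreq : ∀ {p : Bool × Bool} {y : SimOut N K} (k : Fin K) (y' : SimOut N K),
        simRequest B (s.1, ⟨lowRounds h, s.2.ack⟩) I p.1 p.2 y = 0 →
        replyCoeff hρ₀ η μ B hX hZ hK I₀ u (s.1, ⟨lowRounds h, s.2.ack⟩) I (p, y, k, y') =
          fun _ _ => 0 := fun {p y} k y' hy =>
      replyCoeff_eq_zero hρ₀ η μ B hX hZ hK I₀ fun C =>
        trace_reply_of_request_eq_zero hρ₀ η μ B hX hZ hK I₀ u (s.1, ⟨lowRounds h, s.2.ack⟩) I hy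
          k y' C
    have hresp : ∀ {p : Bool × Bool} {y : SimOut N K} (k : Fin K) (y' : SimOut N K),
        simRespond ρ₀ PX PZ hK (s.1, ⟨lowRounds h, I.getD s.2.ack⟩)
          (batchReply u p.1 p.2 k) y' = 0 →
        replyCoeff hρ₀ η μ B hX hZ hK I₀ u (s.1, ⟨lowRounds h, s.2.ack⟩) I (p, y, k, y') =
          fun _ _ => 0 := fun {p y} k y' hy =>
      replyCoeff_eq_zero hρ₀ η μ B hX hZ hK I₀ fun C =>
        trace_reply_of_respond_eq_zero hρ₀ η μ B hX hZ hK I₀ u (s.1, ⟨lowRounds h, s.2.ack⟩) I hy C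
    have hdiag : ∀ (c : Bool) (y : SimOut N K),
        simRequest B (s.1, ⟨lowRounds h, s.2.ack⟩) I c c y = 0 := by
      rintro c ((_ | _) | _)
      · simp [simRequest, requestWeight_eq_zero]
      · rfl
      · rfl
    refine tsum_outcome (g := fun z => coeffProb ρ₀ η μ Z h s.1 m A I (replyCoeff hρ₀ η μ B hX hZ hK
      I₀ u (s.1, ⟨lowRounds h, s.2.ack⟩) I z) (z.1.2, simMessage PX PZ
        (s.1, ⟨lowRounds h, I.getD s.2.ack⟩) (batchReply u z.1.1 z.1.2 z.2.2.1) z.2.2.2)) ?_ ?_ ?_ ?_ ?_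
    all_goals dsimp only
    · intro p y k y' hy
      rw [hreq k y' ?_]
      · exact coeffProb_zero ..
      · rcases y with (_ | _) | _
        · exact absurd rfl hy
        · rfl
        · rfl
    · intro y k y'
      rw [hreq (p := (false, false)) k y' (hdiag false y)]
      exact coeffProb_zero ..
    · intro y k y'
      rw [hreq (p := (true, true)) k y' (hdiag true y)]
      exact coeffProb_zero ..
    · intro k y' hy
      rw [hresp k y' ?_]
      · exact coeffProb_zero ..
      · rcases y' with (_ | _) | _
        · exact absurd rfl hy
        · rfl
        · rfl
    · intro k y'
      rw [hresp (p := (true, false)) k (.inl y') rfl]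
      exact coeffProb_zero ..
  rw [idealTerm, mul_add, Finset.mul_sum]
  refine (Finset.sum_congr rfl fun I _ => hout I).trans ?_
  rw [Finset.sum_add_distrib]
  congr 1
  · exact Finset.sum_congr rfl fun I _ =>
      sum_coeffProb_abort hρ₀ η μ B hX hZ hK I₀ Z h u m hA (s.1, ⟨lowRounds h, s.2.ack⟩) I
  · rw [sum_ack]
    refine (congrArg₂ (· + ·) ?_ (Finset.sum_congr rfl fun I _ => sum_coeffProb_leak hρ₀ η μ B hX hZ
      hK I₀ Z h u m A (s.1, ⟨lowRounds h, s.2.ack⟩) rfl I)).trans ((zero_add _).trans ?_)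
    · refine Finset.sum_eq_zero fun k _ => Finset.sum_eq_zero fun x _ => ?_
      have hz : replyCoeff hρ₀ η μ B hX hZ hK I₀ u (s.1, ⟨lowRounds h, s.2.ack⟩) none
          ((true, false), .inl none, k, .inr x) = fun _ _ => 0 :=
        replyCoeff_eq_zero hρ₀ η μ B hX hZ hK I₀ fun C =>
          trace_reply_of_request_eq_zero hρ₀ η μ B hX hZ hK I₀ u (s.1, ⟨lowRounds h, s.2.ack⟩) none
            (by simp [simRequest, requestWeight]) _ _ C
      rw [hz]
      exact coeffProb_zero ..
    · rw [Finset.mul_sum]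

end IdealWorld

/-! ### Averaging over the Sender's unitaries -/

section Averaging

variable {𝒰 : Subgroup (Matrix.unitaryGroup (Fin 2) ℂ)} {N K : ℕ}

section Measurability

variable (ρ₀ : Matrix (Fin 2) (Fin 2) ℂ) (Z : Distinguisher 𝒰 N K) (h : Path N)
  (u : Fin K → 𝒰) (m : Z.M) (A : Matrix (Fin Z.dim) (Fin Z.dim) ℂ)

theorem measurable_abortProb (I : Ack N K) :
    Measurable fun U : Fin N → 𝒰 => abortProb ρ₀ Z h U m A I :=
  measurable_pathProb ρ₀ Z h (fun i => measurable_pi_apply i) m A I measurable_const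

theorem measurable_passProb (I : KSubset N K) (σ : Equiv.Perm (Fin K)) :
    Measurable fun U : Fin N → 𝒰 => passProb ρ₀ Z h U u m A I σ := by
  refine measurable_pathProb ρ₀ Z h (fun i => measurable_pi_apply i) m A (some I)
    (measurable_const.prodMk (measurable_inr.comp (measurable_const.prodMk ?_)))
  unfold corrections
  fun_prop

theorem measurable_ackProb (I : Ack N K) :
    Measurable fun U : Fin N → 𝒰 => ackProb ρ₀ Z h U m A I := by
  have hU : ∀ i, Measurable fun U : Fin N → 𝒰 => U i := fun i => measurable_pi_apply i
  have hm := measurable_memAfter Z h hU (List.finRange N) (measurable_const (a := m))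
  have hA := measurable_opAfter Z h hU
    (τ := fun U i => pulse ρ₀ (U i) (h i).2.1)
    (fun i q r => (measurable_pulse ρ₀ _ q r).comp (hU i)) (List.finRange N)
    (measurable_const (a := m)) (A := fun _ => A) (fun _ _ => measurable_const)
  refine ENNReal.measurable_ofReal.comp (Complex.measurable_re.comp ?_)
  simp only [Matrix.trace, Matrix.diag]
  exact Finset.measurable_sum _ fun a _ =>
    measurable_op_apply (fun B a b => (Z.ack_meas I B a b).comp hm) hA _ _

theorem measurable_realTerm (B : Estimator N) (π : Equiv.Perm (Fin N)) :
    Measurable fun U : Fin N → 𝒰 => realTerm ρ₀ Z h U u m A B π :=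
  (measurable_abortProb ρ₀ Z h m A none).add <| Finset.measurable_sum _ fun I _ =>
    ((measurable_abortProb ρ₀ Z h m A (some I)).const_mul _).add
      (((Finset.measurable_sum _ fun σ _ =>
        measurable_passProb ρ₀ Z h u m A I σ).const_mul _).const_mul _)

end Measurability

variable [CompactSpace 𝒰]

/-- The law of independent Haar random unitaries. -/
abbrev haarPi (𝒰 : Subgroup (Matrix.unitaryGroup (Fin 2) ℂ)) [CompactSpace 𝒰] (N : ℕ) :
    Measure (Fin N → 𝒰) :=
  Measure.pi fun _ => haar 𝒰

/-- The map acts coordinatewise, by a translation, an inversion and another translation in low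
rounds and trivially elsewhere. Each preserves Haar measure. -/
theorem measurePreserving_twist (h : Path N) (PX PZ : 𝒰) (P : Fin N → Fin 2 × Fin 2)
    (v : Fin N → 𝒰) :
    MeasurePreserving (fun G => twist h (rotation PX PZ G P) v G) (haarPi 𝒰 N) (haarPi 𝒰 N) := by
  refine measurePreserving_pi (fun _ => haar 𝒰) (fun _ => haar 𝒰)
    (f := fun i g => if lowRounds h i then (g * (pauli PX PZ (P i))⁻¹)⁻¹ * v i else g) fun i => ?_
  by_cases hi : lowRounds h i = true
  · simp only [if_pos hi]
    exact (measurePreserving_mul_right (haar 𝒰) (v i)).comp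
      ((Measure.measurePreserving_inv (haar 𝒰)).comp
        (measurePreserving_mul_right (haar 𝒰) (pauli PX PZ (P i))⁻¹))
  · simp only [if_neg hi]
    exact MeasurePreserving.id _

/-- The targets `v` disappear on averaging, so the simulator's ignorance of the Sender's input
during the pulse rounds costs nothing. The `4 ^ N` Pauli outcomes cancel the factor `4⁻ᴺ`. -/
theorem lintegral_twist (h : Path N) (PX PZ : 𝒰) (v : Fin N → 𝒰) {f : (Fin N → 𝒰) → ℝ≥0∞}
    (hf : Measurable f) :
    ∫⁻ G, ∑ P, ((4 : ℝ≥0∞) ^ N)⁻¹ * f (twist h (rotation PX PZ G P) v G) ∂haarPi 𝒰 N =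
      ∫⁻ U, f U ∂haarPi 𝒰 N := by
  have hP := fun P => measurePreserving_twist h PX PZ P v
  have hm : ∀ P, Measurable fun G => f (twist h (rotation PX PZ G P) v G) :=
    fun P => hf.comp (hP P).measurable
  rw [lintegral_finsetSum _ fun P _ => (hm P).const_mul _]
  have h4 : (Fintype.card (Fin N → Fin 2 × Fin 2) : ℝ≥0∞) = 4 ^ N := by simp
  refine (Finset.sum_congr rfl fun P _ => (lintegral_const_mul _ (hm P)).trans
    (congrArg (((4 : ℝ≥0∞) ^ N)⁻¹ * ·) ((hP P).lintegral_comp hf))).trans ?_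
  rw [Finset.sum_const, Finset.card_univ, nsmul_eq_mul, h4, ← mul_assoc,
    ENNReal.mul_inv_cancel (by positivity) (by finiteness), one_mul]

variable (ρ₀ : Matrix (Fin 2) (Fin 2) ℂ) (Z : Distinguisher 𝒰 N K) (h : Path N)
  (u : Fin K → 𝒰) (m : Z.M) (A : Matrix (Fin Z.dim) (Fin Z.dim) ℂ)

/-- The average weight of a path followed by an abort. -/
def abortMean (I : Ack N K) : ℝ≥0∞ := ∫⁻ U, abortProb ρ₀ Z h U m A I ∂haarPi 𝒰 N

/-- The average weight of a path followed by acceptance. -/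
def passMean (I : KSubset N K) : ℝ≥0∞ :=
  (K.factorial : ℝ≥0∞)⁻¹ * ∑ σ, ∫⁻ U, passProb ρ₀ Z h U u m A I σ ∂haarPi 𝒰 N

/-- The average weight of a path with an acknowledgement. -/
def ackMean (I : Ack N K) : ℝ≥0∞ := ∫⁻ U, ackProb ρ₀ Z h U m A I ∂haarPi 𝒰 N

variable (B : Estimator N) (π : Equiv.Perm (Fin N))

theorem lintegral_realTerm :
    ∫⁻ U, realTerm ρ₀ Z h U u m A B π ∂haarPi 𝒰 N = abortMean ρ₀ Z h m A none +
      ∑ I : KSubset N K, (B (unpermute π I.1) false * abortMean ρ₀ Z h m A (some I) +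
        B (unpermute π I.1) true * passMean ρ₀ Z h u m A I) := by
  have ha := measurable_abortProb ρ₀ Z h m A
  have hp := measurable_passProb ρ₀ Z h u m A
  have hs := fun I : KSubset N K => Finset.measurable_sum Finset.univ fun σ _ => hp I σ
  have hI : ∀ I : KSubset N K, Measurable fun U : Fin N → 𝒰 =>
      B (unpermute π I.1) false * abortProb ρ₀ Z h U m A (some I) + B (unpermute π I.1) true *
        ((K.factorial : ℝ≥0∞)⁻¹ * ∑ σ, passProb ρ₀ Z h U u m A I σ) :=
    fun I => ((ha (some I)).const_mul _).add (((hs I).const_mul _).const_mul _)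
  simp only [realTerm, abortMean, passMean]
  rw [lintegral_add_left (ha none), lintegral_finsetSum _ fun I _ => hI I]
  congr 1
  refine Finset.sum_congr rfl fun I _ => ?_
  rw [lintegral_add_left ((ha (some I)).const_mul _), lintegral_const_mul _ (ha _),
    lintegral_const_mul _ ((hs I).const_mul _), lintegral_const_mul _ (hs I),
    lintegral_finsetSum _ fun σ _ => hp I σ]

variable (PX PZ : 𝒰)

theorem measurable_twist (P : Fin N → Fin 2 × Fin 2) (v : Fin N → 𝒰) :
    Measurable fun G : Fin N → 𝒰 => twist h (rotation PX PZ G P) v G :=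
  (measurePreserving_twist h PX PZ P v).measurable

theorem measurable_idealTerm :
    Measurable fun G : Fin N → 𝒰 => idealTerm ρ₀ B PX PZ Z h u m A π G :=
  (Finset.measurable_sum _ fun I _ => (Finset.measurable_sum _ fun P _ =>
    ((measurable_abortProb ρ₀ Z h m A I).comp
      (measurable_twist h PX PZ P 1)).const_mul _).const_mul _).add <|
  Finset.measurable_sum _ fun I _ => ((Finset.measurable_sum _ fun σ _ =>
    Finset.measurable_sum _ fun P _ => ((measurable_passProb ρ₀ Z h u m A I σ).comp
      (measurable_twist h PX PZ P (target I σ u))).const_mul _).const_mul _).const_mul _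

theorem lintegral_idealTerm :
    ∫⁻ G, idealTerm ρ₀ B PX PZ Z h u m A π G ∂haarPi 𝒰 N =
      ∑ I, ENNReal.ofReal (requestWeight B π (lowRounds h) I false true) *
        abortMean ρ₀ Z h m A I +
      ∑ I : KSubset N K, ENNReal.ofReal (requestWeight B π (lowRounds h) (some I) true false) *
        passMean ρ₀ Z h u m A I := by
  have ha := measurable_abortProb ρ₀ Z h m A
  have hp := measurable_passProb ρ₀ Z h u m A
  have ha' := fun I => Finset.measurable_sum (Finset.univ : Finset (Fin N → Fin 2 × Fin 2))
    fun P _ => ((ha I).comp (measurable_twist h PX PZ P 1)).const_mul (((4 : ℝ≥0∞) ^ N)⁻¹)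
  have hp' := fun I σ => Finset.measurable_sum (Finset.univ : Finset (Fin N → Fin 2 × Fin 2))
    fun P _ => ((hp I σ).comp (measurable_twist h PX PZ P (target I σ u))).const_mul
      (((4 : ℝ≥0∞) ^ N)⁻¹)
  have hs := fun I : KSubset N K => Finset.measurable_sum Finset.univ fun σ _ => hp' I σ
  simp only [Function.comp_apply] at ha' hp' hs
  simp only [idealTerm, abortMean, passMean]
  rw [lintegral_add_left (Finset.measurable_sum _ fun I _ => (ha' I).const_mul _),
    lintegral_finsetSum _ fun I _ => (ha' I).const_mul _,
    lintegral_finsetSum _ fun I _ => ((hs I).const_mul _).const_mul _]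
  congr 1
  · refine Finset.sum_congr rfl fun I _ => ?_
    rw [lintegral_const_mul _ (ha' I), lintegral_twist h PX PZ 1 (ha I)]
  · refine Finset.sum_congr rfl fun I _ => ?_
    rw [lintegral_const_mul _ ((hs I).const_mul _), lintegral_const_mul _ (hs I),
      lintegral_finsetSum _ fun σ _ => hp' I σ]
    simp_rw [fun σ => lintegral_twist h PX PZ (target I σ u) (hp I σ)]

/-- The average weight of a path after which the estimation accepts although all acknowledged rounds
had more than one photon. -/
def failTerm : ℝ≥0∞ :=
  ∑ I : KSubset N K, if HasLow (lowRounds h) I then 0 else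
    B (unpermute π I.1) true * ackMean ρ₀ Z h m A (some I)

variable {ρ₀ A}

theorem abortMean_le_ackMean (hρ₀ : IsDensity ρ₀) (hA : A.PosSemidef) (I : Ack N K) :
    abortMean ρ₀ Z h m A I ≤ ackMean ρ₀ Z h m A I :=
  lintegral_mono fun U => pathProb_le_ackProb hρ₀ Z h U m hA I _

theorem passMean_le_ackMean (hρ₀ : IsDensity ρ₀) (hA : A.PosSemidef) (I : KSubset N K) :
    passMean ρ₀ Z h u m A I ≤ ackMean ρ₀ Z h m A (some I) := by
  rw [passMean]
  calc _ ≤ (K.factorial : ℝ≥0∞)⁻¹ * ∑ _σ : Equiv.Perm (Fin K), ackMean ρ₀ Z h m A (some I) :=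
        mul_le_mul_right (Finset.sum_le_sum fun σ _ =>
          lintegral_mono fun U => pathProb_le_ackProb hρ₀ Z h U m hA (some I) _) _
    _ = _ := by
      rw [Finset.sum_const, Finset.card_univ, Fintype.card_perm, Fintype.card_fin, nsmul_eq_mul,
        ← mul_assoc, ENNReal.inv_mul_cancel (by exact_mod_cast K.factorial_ne_zero)
        (ENNReal.natCast_ne_top _), one_mul]

/-- This has the shape of `lintegral_realTerm`, with one change: on acceptance without a low
acknowledged round the simulator has to abort. -/
theorem lintegral_idealTerm_eq :
    ∫⁻ G, idealTerm ρ₀ B PX PZ Z h u m A π G ∂haarPi 𝒰 N = abortMean ρ₀ Z h m A none +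
      ∑ I : KSubset N K, (B (unpermute π I.1) false * abortMean ρ₀ Z h m A (some I) +
        B (unpermute π I.1) true * if HasLow (lowRounds h) I then passMean ρ₀ Z h u m A I
          else abortMean ρ₀ Z h m A (some I)) := by
  rw [lintegral_idealTerm, sum_ack, add_assoc, ← Finset.sum_add_distrib]
  congr 1
  · simp [requestWeight]
  · refine Finset.sum_congr rfl fun I _ => ?_
    have hne := fun b => (B (unpermute π I.1)).apply_ne_top b
    by_cases hl : HasLow (lowRounds h) I
    · simp [requestWeight, hl, ENNReal.ofReal_toReal (hne _)]
    · simp [requestWeight, hl, ENNReal.ofReal_add, ENNReal.ofReal_toReal (hne _), add_mul]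

/-- All terms coincide except those where the estimation accepts and no acknowledged round is low;
there either world contributes at most the weight of the acknowledgement. The reverse inequality has
the same reason. -/
theorem lintegral_realTerm_le (hρ₀ : IsDensity ρ₀) (hA : A.PosSemidef) :
    ∫⁻ U, realTerm ρ₀ Z h U u m A B π ∂haarPi 𝒰 N ≤
      ∫⁻ G, idealTerm ρ₀ B PX PZ Z h u m A π G ∂haarPi 𝒰 N + failTerm ρ₀ Z h m A B π := by
  rw [lintegral_realTerm, lintegral_idealTerm_eq, failTerm, add_assoc, ← Finset.sum_add_distrib]
  refine add_le_add le_rfl (Finset.sum_le_sum fun I _ => ?_)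
  by_cases hl : HasLow (lowRounds h) I
  · simp [hl]
  · simp only [hl, if_false]
    rw [add_assoc]
    exact add_le_add le_rfl ((mul_le_mul_right (passMean_le_ackMean Z h u m hρ₀ hA I) _).trans
      le_add_self)

theorem lintegral_idealTerm_le (hρ₀ : IsDensity ρ₀) (hA : A.PosSemidef) :
    ∫⁻ G, idealTerm ρ₀ B PX PZ Z h u m A π G ∂haarPi 𝒰 N ≤
      ∫⁻ U, realTerm ρ₀ Z h U u m A B π ∂haarPi 𝒰 N + failTerm ρ₀ Z h m A B π := by
  rw [lintegral_realTerm, lintegral_idealTerm_eq, failTerm, add_assoc, ← Finset.sum_add_distrib]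
  refine add_le_add le_rfl (Finset.sum_le_sum fun I _ => ?_)
  by_cases hl : HasLow (lowRounds h) I
  · simp [hl]
  · simp only [hl, if_false]
    rw [add_assoc]
    exact add_le_add le_rfl ((mul_le_mul_right (abortMean_le_ackMean Z h m hρ₀ hA _) _).trans
      le_add_self)

/-- The uniform law of the Sender's permutation. -/
abbrev permLaw (N : ℕ) : Measure (Equiv.Perm (Fin N)) :=
  (PMF.uniformOfFintype (Equiv.Perm (Fin N))).toMeasure

theorem lintegral_senderLaw {f : Path N → Equiv.Perm (Fin N) → (Fin N → 𝒰) → ℝ≥0∞}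
    (hf : ∀ h π, Measurable (f h π)) (w : Equiv.Perm (Fin N) → Path N → ℝ≥0∞) :
    ∫⁻ t, ∑' h, w t.1 h * f h t.1 t.2 ∂senderLaw 𝒰 N =
      ∫⁻ π, ∑' h, w π h * ∫⁻ U, f h π U ∂haarPi 𝒰 N ∂permLaw N := by
  rw [senderLaw, lintegral_prod]
  · refine lintegral_congr fun π => ?_
    refine (lintegral_tsum fun h => ((hf h π).const_mul (w π h)).aemeasurable).trans ?_
    exact tsum_congr fun h => lintegral_const_mul _ (hf h π)
  · exact (measurable_from_prod_countable_right fun π =>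
      Measurable.tsum fun h => (hf h π).const_mul (w π h)).aemeasurable

variable (η : ℝ≥0) (μ : Fin N → ℝ≥0)

theorem lintegral_play_realSystem :
    ∫⁻ t, play (realSystem 𝒰 K ρ₀ η μ B) Z u (List.finRange N) m t
      (A ⊗ₖ (realSystem 𝒰 K ρ₀ η μ B).state t) ∂(realSystem 𝒰 K ρ₀ η μ B).law =
    ∫⁻ π, ∑' h, pathWeight η μ π h * ∫⁻ U, realTerm ρ₀ Z h U u m A B π ∂haarPi 𝒰 N ∂permLaw N := by
  refine Eq.trans ?_ (lintegral_senderLaw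
    (fun h π => measurable_realTerm ρ₀ Z h u m A B π) (pathWeight η μ))
  exact lintegral_congr fun t => play_realSystem ρ₀ Z u m A η μ B t

variable {PX PZ}

theorem lintegral_play_idealSystem (hρ₀ : IsDensity ρ₀) (hA : A.PosSemidef)
    (hX : (PX.1 : Matrix (Fin 2) (Fin 2) ℂ) = pauliX)
    (hZ : (PZ.1 : Matrix (Fin 2) (Fin 2) ℂ) = pauliZ) (hK : 0 < K) (I₀ : KSubset N K) :
    ∫⁻ s, play (idealSystem ρ₀ (simulator hρ₀ η μ B hX hZ hK I₀)) Z u (List.finRange N) m s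
      (A ⊗ₖ (idealSystem ρ₀ (simulator hρ₀ η μ B hX hZ hK I₀)).state s)
      ∂(idealSystem ρ₀ (simulator hρ₀ η μ B hX hZ hK I₀)).law =
    ∫⁻ π, ∑' h, pathWeight η μ π h *
      ∫⁻ G, idealTerm ρ₀ B PX PZ Z h u m A π G ∂haarPi 𝒰 N ∂permLaw N := by
  refine Eq.trans ?_ (lintegral_senderLaw
    (fun h π => measurable_idealTerm ρ₀ Z h u m A B π PX PZ) (pathWeight η μ))
  refine Eq.trans (b := ∫⁻ s : SimState 𝒰 N K, ∑' h, pathWeight η μ s.1.1 h *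
    idealTerm ρ₀ B PX PZ Z h u m A s.1.1 s.1.2 ∂((senderLaw 𝒰 N).map fun t =>
      (t, (⟨fun _ => false, I₀⟩ : SimMem N K)))) ?_ ?_
  · exact lintegral_congr fun s => play_idealSystem hρ₀ η μ B hX hZ hK I₀ Z u m hA s
  · refine lintegral_map (measurable_simState fun π r => ?_) (by fun_prop)
    exact Measurable.tsum fun h => (measurable_idealTerm ρ₀ Z h u m A B π
      PX PZ).const_mul (pathWeight η μ π h)

end Averaging

/-! ### Thinning of the photon numbers -/

section Thinning

theorem prod_tsum {N : ℕ} (f : Fin N → ℕ → ℝ≥0∞) :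
    ∏ i, ∑' n, f i n = ∑' ν : Fin N → ℕ, ∏ i, f i (ν i) := by
  induction N with
  | zero => simp
  | succ N ih =>
    rw [Fin.prod_univ_succ, ih, ← (Fin.consEquiv fun _ => ℕ).tsum_eq, ENNReal.tsum_prod',
      ← ENNReal.tsum_mul_right]
    refine tsum_congr fun n => ?_
    rw [← ENNReal.tsum_mul_left]
    refine tsum_congr fun ν => ?_
    rw [Fin.prod_univ_succ]
    rfl

theorem tsum_option_nat (f : Option ℕ → ℝ≥0∞) : ∑' y, f y = f none + ∑' m, f (some m) := by
  rw [ENNReal.tsum_eq_add_tsum_ite none]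
  congr 1
  rw [← (Option.some_injective ℕ).tsum_eq]
  · simp
  · rintro (_ | m) hm
    · simp at hm
    · exact ⟨m, rfl⟩

/-- The conditional probability of the output of `WCPGenerator` given the photon number `ν` before
the losses. -/
def thin (η : ℝ≥0) (ν : ℕ) : Bool × ℕ × Option ℕ → ℝ≥0∞
  | (true, n, none) => if n = ν ∧ ν ≤ 1 then 1 else 0
  | (true, n, some m) => if m = ν ∧ 1 < ν ∧ n = 0 then 1 else 0
  | (false, n, none) => ENNReal.ofReal ((η : ℝ) ^ n * (1 - η) ^ (ν - n) * ν.choose n)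
  | (false, _, some _) => 0

theorem tsum_thin {η : ℝ≥0} (hη : η ≤ 1) (ν : ℕ) (c : Bool) :
    ∑' n, ∑' y, thin η ν (c, n, y) = 1 := by
  simp_rw [tsum_option_nat]
  cases c with
  | true =>
    simp only [thin]
    by_cases hν : ν ≤ 1
    · simp [hν, not_lt.2 hν]
    · rw [tsum_eq_single 0, tsum_eq_single ν]
      · simp [hν, not_le.1 hν]
      · intro m hm
        simp [hm]
      · intro n hn
        simp [hn, hν]
  | false =>
    have h1 : (0 : ℝ) ≤ 1 - η := sub_nonneg.2 (by exact_mod_cast hη)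
    simp only [thin, tsum_zero, add_zero]
    rw [tsum_eq_sum (s := Finset.range (ν + 1)), ← ENNReal.ofReal_sum_of_nonneg, ← add_pow]
    · simp
    · intro n _
      positivity
    · intro n hn
      rw [Nat.choose_eq_zero_of_lt (by simpa using hn)]
      simp

/-- Losses only remove photons, so a round that is not low had at least two to begin with, whichever
flag was set. -/
theorem two_le_of_thin_ne_zero {η : ℝ≥0} {ν : ℕ} {p : Bool × ℕ × Option ℕ} (hp : thin η ν p ≠ 0)
    (hl : ¬ isLow p.2.1 p.2.2 = true) : 2 ≤ ν := by
  obtain ⟨c, n, y⟩ := p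
  match c, y with
  | true, none =>
    simp only [thin, ne_eq, ite_eq_right_iff, not_forall] at hp
    simp only [isLow, Bool.and_eq_true, decide_eq_true_eq] at hl
    simp only [Option.isNone_none] at hl
    grind
  | true, some m =>
    simp only [thin, ne_eq, ite_eq_right_iff, not_forall] at hp
    grind
  | false, none =>
    simp only [isLow, Bool.and_eq_true, decide_eq_true_eq, Option.isNone_none, and_true,
      not_le] at hl
    by_contra hν
    refine hp ?_
    rw [thin, Nat.choose_eq_zero_of_lt (by omega)]
    simp
  | false, some m => exact absurd rfl hp

theorem hasSum_poisson_thinning (η μ : ℝ≥0) (n : ℕ) :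
    HasSum (fun ν : ℕ => Real.exp (-μ) * (μ : ℝ) ^ ν / ν.factorial *
      ((η : ℝ) ^ n * (1 - η) ^ (ν - n) * ν.choose n))
      (Real.exp (-(μ * η)) * ((μ : ℝ) * η) ^ n / n.factorial) := by
  -- The terms with `ν < n` vanish with the binomial coefficient; after the shift by `n` the
  -- exponential series of `μ (1 - η)` remains.
  rw [← hasSum_nat_add_iff' n, Finset.sum_eq_zero, sub_zero]
  · have h := (NormedSpace.expSeries_div_hasSum_exp ((μ : ℝ) * (1 - η))).mul_left
      (Real.exp (-μ) * ((μ : ℝ) * η) ^ n / n.factorial)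
    rw [← Real.exp_eq_exp_ℝ] at h
    convert! h using 1
    · funext k
      rw [Nat.add_sub_cancel, pow_add, mul_pow, mul_pow]
      have hc : (((k + n).choose n : ℕ) : ℝ) = (k + n).factorial / (k.factorial * n.factorial) := by
        rw [← Nat.choose_symm_add, Nat.cast_add_choose]
      rw [hc]
      field_simp
    · rw [show -((μ : ℝ) * η) = -μ + μ * (1 - η) by ring, Real.exp_add]
      ring
  · intro ν hν
    rw [Nat.choose_eq_zero_of_lt (by simpa using hν)]
    simp

/-- For either flag the source acts as if a photon number `ν` of mean `μ` had been drawn beforehand.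
An adaptive choice of flags is thus only processing of fixed photon numbers. -/
theorem ofReal_wcpWeight {η : ℝ≥0} (hη : η ≤ 1) (μ : ℝ≥0) (c : Bool) (n : ℕ) (y : Option ℕ) :
    ENNReal.ofReal (wcpWeight η μ c n y) =
      ∑' ν, ProbabilityTheory.poissonMeasure μ {ν} * thin η ν (c, n, y) := by
  match c, y with
  | true, none =>
    rw [tsum_eq_single n]
    · by_cases hn : 1 < n
      · simp [wcpWeight, thin, hn, not_le.2 hn]
      · simp [wcpWeight, thin, hn, not_lt.1 hn, wcpMean]
    · intro ν hν
      simp [thin, Ne.symm hν]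
  | true, some m =>
    rw [tsum_eq_single m]
    · by_cases hn : 1 < m ∧ n = 0
      · simp [wcpWeight, thin, hn, wcpMean]
      · simp [wcpWeight, thin, hn]
    · intro ν hν
      simp [thin, Ne.symm hν]
  | false, none =>
    have h1 : (0 : ℝ) ≤ 1 - η := sub_nonneg.2 (by exact_mod_cast hη)
    have h := hasSum_poisson_thinning η μ n
    simp only [wcpWeight, wcpMean, thin, Bool.false_eq_true, false_and, if_false,
      ProbabilityTheory.poissonMeasure_real_singleton,
      ProbabilityTheory.poissonMeasure_singleton, NNReal.coe_mul]
    rw [← h.tsum_eq, ENNReal.ofReal_tsum_of_nonneg (fun ν => by positivity) h.summable]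
    exact tsum_congr fun ν => ENNReal.ofReal_mul (by positivity)
  | false, some m => simp [wcpWeight, thin]

theorem photonLaw_singleton {N : ℕ} (μ : Fin N → ℝ≥0) (ν : Fin N → ℕ) :
    photonLaw μ {ν} = ∏ i, ProbabilityTheory.poissonMeasure (μ i) {ν i} :=
  Measure.pi_singleton _ _

theorem pathWeight_eq_tsum {N : ℕ} {η : ℝ≥0} (hη : η ≤ 1) (μ : Fin N → ℝ≥0)
    (π : Equiv.Perm (Fin N)) (h : Path N) :
    pathWeight η μ π h = ∑' ν, photonLaw (permuted μ π) {ν} * ∏ i, thin η (ν i) (h i) := by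
  rw [pathWeight]
  refine (Finset.prod_congr rfl fun i _ => ofReal_wcpWeight hη (permuted μ π i) (h i).1 (h i).2.1
    (h i).2.2).trans ((prod_tsum _).trans (tsum_congr fun ν => ?_))
  rw [Finset.prod_mul_distrib, photonLaw_singleton]

theorem photonLaw_permuted_singleton {N : ℕ} (μ : Fin N → ℝ≥0) (π : Equiv.Perm (Fin N))
    (ν : Fin N → ℕ) : photonLaw (permuted μ π) {ν} = photonLaw μ {ν ∘ π} := by
  rw [photonLaw_singleton, photonLaw_singleton, ← Equiv.prod_comp π]
  simp [permuted]

end Thinning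

/-! ### Reduction to acknowledgements for given photon numbers -/

section Reduction

variable {𝒰 : Subgroup (Matrix.unitaryGroup (Fin 2) ℂ)} [CompactSpace 𝒰] {N K : ℕ}

/-- `1` on acceptance of a set of pulses with at least two photons, averaged over the randomness of
the estimation. -/
def badAccept (B : Estimator N) (ν : Fin N → ℕ) (I : Finset (Fin N)) : ℝ≥0∞ :=
  if ∀ i ∈ I, 2 ≤ ν i then B I true else 0

/-- The probability of an acknowledgement, for given photon numbers before the losses. -/
def ackGiven (η : ℝ≥0) (ρ₀ : Matrix (Fin 2) (Fin 2) ℂ) (Z : Distinguisher 𝒰 N K) (m : Z.M)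
    (A : Matrix (Fin Z.dim) (Fin Z.dim) ℂ) (ν : Fin N → ℕ) (I : KSubset N K) : ℝ≥0∞ :=
  ∑' h : Path N, (∏ i, thin η (ν i) (h i)) * ackMean ρ₀ Z h m A (some I)

/-- For fixed `ν`, `thin` is a probability law for each flag, so probability is conserved along the
interaction. -/
theorem sum_ackGiven_le {η : ℝ≥0} (hη : η ≤ 1) {ρ₀ : Matrix (Fin 2) (Fin 2) ℂ}
    (hρ₀ : IsDensity ρ₀) (Z : Distinguisher 𝒰 N K) (m : Z.M)
    {A : Matrix (Fin Z.dim) (Fin Z.dim) ℂ} (hA : IsDensity A) (ν : Fin N → ℕ) :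
    ∑ I, ackGiven η ρ₀ Z m A ν I ≤ 1 := by
  have hmeas := fun h I => measurable_ackProb ρ₀ Z h m A (some I)
  calc ∑ I, ackGiven η ρ₀ Z m A ν I
      = ∫⁻ U, ∑' h : Path N, (∏ i, thin η (ν i) (h i)) *
          ∑ I : KSubset N K, ackProb ρ₀ Z h U m A (some I) ∂haarPi 𝒰 N := by
        rw [lintegral_tsum fun h =>
          ((Finset.measurable_sum _ fun I _ => hmeas h I).const_mul _).aemeasurable]
        simp only [ackGiven]
        rw [← Summable.tsum_finsetSum fun _ _ => ENNReal.summable]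
        refine tsum_congr fun h => ?_
        rw [lintegral_const_mul _ (Finset.measurable_sum _ fun I _ => hmeas h I),
          lintegral_finsetSum _ fun I _ => hmeas h I, Finset.mul_sum]
        rfl
    _ ≤ ∫⁻ U, 1 ∂haarPi 𝒰 N := by
        refine lintegral_mono fun U => le_trans (ENNReal.tsum_le_tsum fun h => ?_)
          (tsum_ackProb_le hρ₀ Z U (fun i c => (tsum_thin hη (ν i) c).le) m hA)
        rw [sum_ack]
        exact mul_le_mul_right le_add_self _
    _ = 1 := by simp

/-- Up to the acknowledgement the distinguisher learns about `π` only through the photon numbers.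
Conditioned on `ν`, its choice `ackGiven` is therefore independent of `π`. -/
theorem tsum_pathWeight_mul_failTerm_le {η : ℝ≥0} (hη : η ≤ 1) (ρ₀ : Matrix (Fin 2) (Fin 2) ℂ)
    (μ : Fin N → ℝ≥0) (B : Estimator N) (Z : Distinguisher 𝒰 N K) (m : Z.M)
    (A : Matrix (Fin Z.dim) (Fin Z.dim) ℂ) (π : Equiv.Perm (Fin N)) :
    ∑' h, pathWeight η μ π h * failTerm ρ₀ Z h m A B π ≤ ∑' ν, photonLaw μ {ν ∘ π} *
      ∑ I : KSubset N K, badAccept B (ν ∘ π) (unpermute π I.1) * ackGiven η ρ₀ Z m A ν I := by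
  have hterm : ∀ (ν : Fin N → ℕ) (h : Path N),
      (∏ i, thin η (ν i) (h i)) * failTerm ρ₀ Z h m A B π ≤
      ∑ I : KSubset N K, badAccept B (ν ∘ π) (unpermute π I.1) *
        ((∏ i, thin η (ν i) (h i)) * ackMean ρ₀ Z h m A (some I)) := by
    intro ν h
    rw [failTerm, Finset.mul_sum]
    refine Finset.sum_le_sum fun I _ => ?_
    by_cases hl : HasLow (lowRounds h) I
    · simp [hl]
    rw [if_neg hl]
    by_cases hz : ∏ i, thin η (ν i) (h i) = 0
    · simp [hz]
    rw [badAccept, if_pos]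
    · exact le_of_eq (by ring)
    · intro i hi
      simp only [unpermute, Finset.mem_map, Equiv.coe_toEmbedding] at hi
      obtain ⟨j, hj, rfl⟩ := hi
      have hj' : ∃ k, kept I k = j := by
        have : j ∈ Set.range (I.1.orderEmbOfFin I.2) := by
          rw [Finset.range_orderEmbOfFin]
          exact hj
        exact this
      obtain ⟨k, rfl⟩ := hj'
      have hk : π (π⁻¹ (kept I k)) = kept I k := by simp
      rw [Function.comp_apply, hk]
      exact two_le_of_thin_ne_zero (Finset.prod_ne_zero_iff.1 hz _ (Finset.mem_univ _))
        fun hlow => hl ⟨k, hlow⟩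
  simp_rw [pathWeight_eq_tsum hη, ← ENNReal.tsum_mul_right, mul_assoc]
  rw [ENNReal.tsum_comm]
  refine ENNReal.tsum_le_tsum fun ν => ?_
  rw [ENNReal.tsum_mul_left, photonLaw_permuted_singleton]
  refine mul_le_mul_right ((ENNReal.tsum_le_tsum fun h => hterm ν h).trans (le_of_eq ?_)) _
  rw [Summable.tsum_finsetSum fun _ _ => ENNReal.summable]
  exact Finset.sum_congr rfl fun I _ => ENNReal.tsum_mul_left

end Reduction

/-! ### The security game -/

section Game

variable {N K : ℕ}

/-- The numbers of pulses in `I` with `k` photons. -/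
def profile (ν : Fin N → ℕ) (I : Finset (Fin N)) : ℕ →₀ ℕ := ∑ i ∈ I, Finsupp.single (ν i) 1

theorem profile_apply (ν : Fin N → ℕ) (I : Finset (Fin N)) (k : ℕ) :
    profile ν I k = (I.filter fun i => ν i = k).card := by
  rw [profile, Finsupp.finsetSum_apply, Finset.card_filter]
  exact Finset.sum_congr rfl fun i _ => Finsupp.single_apply

theorem profile_univ (ν : Fin N → ℕ) : profile ν Finset.univ = counts ν := rfl

theorem profile_le_counts (ν : Fin N → ℕ) (I : Finset (Fin N)) : profile ν I ≤ counts ν :=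
  Finset.sum_le_sum_of_subset (Finset.subset_univ I)

theorem degree_profile (ν : Fin N → ℕ) (I : Finset (Fin N)) : (profile ν I).degree = I.card := by
  simp [profile, Finsupp.degree_single]

theorem profile_comp (ν : Fin N → ℕ) (τ : Equiv.Perm (Fin N)) (I : Finset (Fin N)) :
    profile (ν ∘ τ) (unpermute τ I) = profile ν I := by
  simp [profile, unpermute]

theorem mem_unpermute {π : Equiv.Perm (Fin N)} {I : Finset (Fin N)} {i : Fin N} :
    i ∈ unpermute π I ↔ π i ∈ I :=
  Finset.mem_map_equiv

theorem unpermute_univ (τ : Equiv.Perm (Fin N)) : unpermute τ Finset.univ = Finset.univ := by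
  simp [unpermute]

theorem counts_comp (ν : Fin N → ℕ) (τ : Equiv.Perm (Fin N)) : counts (ν ∘ τ) = counts ν := by
  rw [← profile_univ, ← profile_univ, ← profile_comp ν τ, unpermute_univ]

theorem exists_counts_eq {c : ℕ →₀ ℕ} (hc : c.degree = N) : ∃ ν : Fin N → ℕ, counts ν = c := by
  obtain ⟨l, hl⟩ := Quot.exists_rep (Finsupp.toMultiset c)
  have hcard : l.length = N := by
    have h := Finsupp.card_toMultiset c
    rw [← hl] at h
    rw [← hc, Finsupp.degree_apply]
    exact h
  subst hcard
  refine ⟨l.get, Finsupp.ext fun k => ?_⟩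
  rw [← profile_univ, profile_apply, ← Finsupp.count_toMultiset, ← hl]
  have h : (Multiset.map l.get Finset.univ.val) = Quot.mk _ l := by
    rw [Fin.univ_val_map, List.ofFn_get]
    rfl
  rw [← h, Multiset.count_map, Finset.card_def, Finset.filter_val]
  simp only [eq_comm]

/-- Pulses are classified by photon number and membership in the set. The hypotheses say that all
classes have equal sizes, so the classes can be matched bijectively. -/
theorem exists_perm_of_profile_eq {ν ν' : Fin N → ℕ} {I I' : Finset (Fin N)}
    (hc : counts ν = counts ν') (hp : profile ν I = profile ν' I') :
    ∃ τ : Equiv.Perm (Fin N), ν' = ν ∘ τ ∧ I' = unpermute τ I := by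
  classical
  have hcard : ∀ p : ℕ × Bool, Fintype.card {i // (ν' i, decide (i ∈ I')) = p} =
      Fintype.card {i // (ν i, decide (i ∈ I)) = p} := by
    have hin : ∀ (ν : Fin N → ℕ) (I : Finset (Fin N)) (k : ℕ),
        Fintype.card {i // (ν i, decide (i ∈ I)) = (k, true)} = profile ν I k := by
      intro ν I k
      rw [profile_apply, Fintype.card_subtype]
      congr 1
      ext i
      simp [and_comm]
    have hout : ∀ (ν : Fin N → ℕ) (I : Finset (Fin N)) (k : ℕ), profile ν I k +
        Fintype.card {i // (ν i, decide (i ∈ I)) = (k, false)} = counts ν k := by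
      intro ν I k
      rw [← profile_univ, profile_apply, profile_apply, Fintype.card_subtype, ← Finset.card_union_of_disjoint]
      · congr 1
        ext i
        by_cases hi : i ∈ I <;> simp [hi]
      · rw [Finset.disjoint_left]
        intro i hi hi'
        simp_all
    rintro ⟨k, _ | _⟩
    · have h1 := hout ν I k
      have h2 := hout ν' I' k
      rw [hc, hp] at h1
      omega
    · rw [hin, hin, hp]
  let τ : Equiv.Perm (Fin N) := Equiv.ofFiberEquiv fun p => Fintype.equivOfCardEq (hcard p)
  have hτ : ∀ i, (ν (τ i), decide (τ i ∈ I)) = (ν' i, decide (i ∈ I')) := fun i =>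
    Equiv.ofFiberEquiv_map (fun p => Fintype.equivOfCardEq (hcard p)) i
  refine ⟨τ, funext fun i => (Prod.mk.inj (hτ i)).1.symm, ?_⟩
  ext i
  have h := (Prod.mk.inj (hτ i)).2
  rw [decide_eq_decide] at h
  rw [mem_unpermute, h]

/-- The weight of acceptance of a bad set in a random arrangement of the pulses. -/
def orbitWeight (μ : Fin N → ℝ≥0) (B : Estimator N) (ν : Fin N → ℕ) (I : Finset (Fin N)) : ℝ≥0∞ :=
  ∑ π : Equiv.Perm (Fin N), (N.factorial : ℝ≥0∞)⁻¹ *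
    (photonLaw μ {ν ∘ π} * badAccept B (ν ∘ π) (unpermute π I))

theorem unpermute_mul (τ π : Equiv.Perm (Fin N)) (I : Finset (Fin N)) :
    unpermute (τ * π) I = unpermute π (unpermute τ I) := by
  simp only [unpermute, Finset.map_map]
  congr 1

theorem orbitWeight_comp (μ : Fin N → ℝ≥0) (B : Estimator N) (ν : Fin N → ℕ)
    (I : Finset (Fin N)) (τ : Equiv.Perm (Fin N)) :
    orbitWeight μ B (ν ∘ τ) (unpermute τ I) = orbitWeight μ B ν I := by
  rw [orbitWeight, orbitWeight]
  refine Fintype.sum_equiv (Equiv.mulLeft τ) _ _ fun π => ?_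
  rw [Equiv.coe_mulLeft, unpermute_mul, Equiv.Perm.coe_mul, Function.comp_assoc]

/-- The average over all permutations forgets which pulses are chosen and keeps only the numbers in
each class. This is why a map from counts to counts captures every attack. -/
theorem orbitWeight_eq_of_profile_eq (μ : Fin N → ℝ≥0) (B : Estimator N) {ν ν' : Fin N → ℕ}
    {I I' : Finset (Fin N)} (hc : counts ν = counts ν') (hp : profile ν I = profile ν' I') :
    orbitWeight μ B ν I = orbitWeight μ B ν' I' := by
  obtain ⟨τ, rfl, rfl⟩ := exists_perm_of_profile_eq hc hp
  exact (orbitWeight_comp μ B ν I τ).symm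

open Classical in
/-- The sets of pulses with a given profile. -/
def profileSets (ν : Fin N → ℕ) (d : ℕ →₀ ℕ) : Finset (Finset (Fin N)) :=
  Finset.univ.filter fun I => ∀ k, (I.filter fun i => ν i = k).card = d k

theorem mem_profileSets {ν : Fin N → ℕ} {d : ℕ →₀ ℕ} {I : Finset (Fin N)} :
    I ∈ profileSets ν d ↔ profile ν I = d := by
  simp only [profileSets, Finset.mem_filter_univ, DFunLike.ext_iff, profile_apply]

theorem gameSimFail_eq (μ : Fin N → ℝ≥0) (B : Estimator N) (D : (ℕ →₀ ℕ) → (ℕ →₀ ℕ)) :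
    gameSimFail μ B D = ∑' ν, photonLaw μ {ν} *
      unifAvg (profileSets ν (D (counts ν))) (badAccept B ν) := by
  rw [gameSimFail, lintegral_countable']
  refine tsum_congr fun ν => ?_
  rw [mul_comm]
  congr 1
  simp only [unifAvg]
  congr 1
  refine Finset.sum_congr rfl fun I hI => ?_
  have hI' := mem_profileSets.1 hI
  rw [badAccept]
  -- Taking no pulse with zero or one photon means that all pulses taken have at least two.
  refine if_congr ?_ rfl rfl
  rw [← hI', profile_apply, profile_apply, Finset.card_eq_zero, Finset.card_eq_zero,
    Finset.filter_eq_empty_iff, Finset.filter_eq_empty_iff]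
  refine ⟨fun h i hi => ?_, fun h => ⟨fun i hi => ?_, fun i hi => ?_⟩⟩
  · have h0 := h.1 hi
    have h1 := h.2 hi
    omega
  · have := h i hi
    omega
  · have := h i hi
    omega

theorem unifAvg_mul_left {α : Type} (s : Finset α) (c : ℝ≥0∞) (f : α → ℝ≥0∞) :
    unifAvg s (fun a => c * f a) = c * unifAvg s f := by
  rw [unifAvg, unifAvg, ← Finset.mul_sum, mul_div_assoc]

theorem sum_unifAvg {α ι : Type} (s : Finset α) (t : Finset ι) (f : ι → α → ℝ≥0∞) :
    unifAvg s (fun a => ∑ i ∈ t, f i a) = ∑ i ∈ t, unifAvg s (f i) := by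
  simp only [unifAvg, div_eq_mul_inv]
  rw [Finset.sum_comm, Finset.sum_mul]

theorem le_unifAvg {α : Type} {s : Finset α} (hs : s.Nonempty) {c : ℝ≥0∞} {f : α → ℝ≥0∞}
    (h : ∀ a ∈ s, c ≤ f a) : c ≤ unifAvg s f := by
  rw [unifAvg, ENNReal.le_div_iff_mul_le (.inl (by simpa using hs.ne_empty))
    (.inl (ENNReal.natCast_ne_top _)), mul_comm, ← nsmul_eq_mul, ← Finset.sum_const]
  exact Finset.sum_le_sum h

theorem unifAvg_map {α β : Type} (s : Finset α) (e : α ↪ β) (f : β → ℝ≥0∞) :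
    unifAvg (s.map e) f = unifAvg s fun a => f (e a) := by
  rw [unifAvg, unifAvg, Finset.sum_map, Finset.card_map]

theorem unpermute_mem_profileSets {ν : Fin N → ℕ} {d : ℕ →₀ ℕ} {I : Finset (Fin N)}
    (π : Equiv.Perm (Fin N)) :
    unpermute π I ∈ profileSets (ν ∘ π) d ↔ I ∈ profileSets ν d := by
  rw [mem_profileSets, mem_profileSets, profile_comp]

theorem unpermute_bijective (π : Equiv.Perm (Fin N)) :
    Function.Bijective (unpermute π : Finset (Fin N) → Finset (Fin N)) := by
  refine ⟨Finset.map_injective _, fun I => ⟨I.map π.toEmbedding, ?_⟩⟩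
  rw [unpermute, Finset.map_map]
  convert Finset.map_refl
  ext i
  simp

theorem unifAvg_profileSets_comp (ν : Fin N → ℕ) (d : ℕ →₀ ℕ) (π : Equiv.Perm (Fin N))
    (f : Finset (Fin N) → ℝ≥0∞) :
    unifAvg (profileSets (ν ∘ π) d) f = unifAvg (profileSets ν d) fun I => f (unpermute π I) := by
  have hinj := (unpermute_bijective π).1
  have h : profileSets (ν ∘ π) d = (profileSets ν d).map ⟨unpermute π, hinj⟩ := by
    ext I
    obtain ⟨J, rfl⟩ := (unpermute_bijective π).2 I
    rw [unpermute_mem_profileSets, ← Finset.mem_map' ⟨unpermute π, hinj⟩]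
    rfl
  rw [h, unifAvg_map]
  rfl

/-- Relabelling the pulses by any fixed `π` leaves the value of the game unchanged, so it may be
averaged over all `π`. -/
theorem gameSimFail_eq_orbitWeight (μ : Fin N → ℝ≥0) (B : Estimator N)
    (D : (ℕ →₀ ℕ) → (ℕ →₀ ℕ)) :
    gameSimFail μ B D = ∑' ν, unifAvg (profileSets ν (D (counts ν))) (orbitWeight μ B ν) := by
  have hπ : ∀ π : Equiv.Perm (Fin N), gameSimFail μ B D = ∑' ν, photonLaw μ {ν ∘ π} *
      unifAvg (profileSets ν (D (counts ν))) fun I => badAccept B (ν ∘ π) (unpermute π I) := by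
    intro π
    rw [gameSimFail_eq, ← (Equiv.arrowCongr π.symm (Equiv.refl ℕ)).tsum_eq]
    refine tsum_congr fun ν => ?_
    change photonLaw μ {ν ∘ π} * unifAvg (profileSets (ν ∘ π) (D (counts (ν ∘ π)))) _ = _
    rw [counts_comp, unifAvg_profileSets_comp]
    rfl
  have havg : gameSimFail μ B D =
      ∑ _π : Equiv.Perm (Fin N), (N.factorial : ℝ≥0∞)⁻¹ * gameSimFail μ B D := by
    rw [Finset.sum_const, Finset.card_univ, Fintype.card_perm, Fintype.card_fin, nsmul_eq_mul,
      ← mul_assoc, ENNReal.mul_inv_cancel (by exact_mod_cast N.factorial_ne_zero)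
      (ENNReal.natCast_ne_top _), one_mul]
  rw [havg]
  refine (Finset.sum_congr rfl fun π _ => congrArg _ (hπ π)).trans ?_
  simp_rw [← ENNReal.tsum_mul_left]
  rw [← Summable.tsum_finsetSum fun _ _ => ENNReal.summable]
  refine tsum_congr fun ν => ?_
  unfold orbitWeight
  rw [sum_unifAvg]
  simp_rw [unifAvg_mul_left]

theorem exists_strategy [Nonempty (KSubset N K)] (μ : Fin N → ℝ≥0) (B : Estimator N) :
    ∃ D, IsStrategy N K D ∧ ∀ ν : Fin N → ℕ, (profileSets ν (D (counts ν))).Nonempty ∧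
      ∀ I ∈ profileSets ν (D (counts ν)), ∀ I' : KSubset N K,
        orbitWeight μ B ν I'.1 ≤ orbitWeight μ B ν I := by
  classical
  choose R hR using fun (c : ℕ →₀ ℕ) (hc : ∃ ν : Fin N → ℕ, counts ν = c) => hc
  choose J hJ using fun ν : Fin N → ℕ => Finite.exists_max fun I : KSubset N K =>
    orbitWeight μ B ν I.1
  -- For each count vector a representative arrangement is fixed, and `D` returns the profile of a
  -- set of size `K` of maximal orbit weight. Vectors that are no counts of `N` pulses are
  -- unconstrained and get `0`.
  refine ⟨fun c => if hc : ∃ ν : Fin N → ℕ, counts ν = c then profile (R c hc) (J (R c hc)).1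
    else 0, fun c hc => ?_, fun ν => ?_⟩
  · dsimp only
    rw [dif_pos (exists_counts_eq hc), degree_profile]
    exact ⟨(profile_le_counts _ _).trans (hR _ _).le, (J _).2⟩
  · have hc : ∃ ν' : Fin N → ℕ, counts ν' = counts ν := ⟨ν, rfl⟩
    dsimp only
    rw [dif_pos hc]
    have hν := hR (counts ν) hc
    have hmax := hJ (R (counts ν) hc)
    generalize R (counts ν) hc = ν₀ at hν hmax ⊢
    -- The maximum was taken at the representative `ν₀`; a permutation `τ` carries the comparison to
    -- `ν`, which has the same counts.
    obtain ⟨τ, hτ, -⟩ := exists_perm_of_profile_eq (I := ∅) (I' := ∅) hν rfl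
    refine ⟨⟨unpermute τ (J ν₀).1, ?_⟩, fun I hI I' => ?_⟩
    · rw [mem_profileSets, hτ, profile_comp]
    · rw [← orbitWeight_eq_of_profile_eq μ B hν (mem_profileSets.1 hI).symm]
      obtain ⟨I'', hI''⟩ := (unpermute_bijective τ).2 I'.1
      have hcard : I''.card = K := by
        rw [← I'.2, ← hI'', unpermute, Finset.card_map]
      rw [← hI'', hτ, orbitWeight_comp]
      exact hmax ⟨I'', hcard⟩

/-- A randomised rule `q` earns, for each `ν`, a subconvex combination of orbit weights, hence at
most the largest one. The same `D` serves all `q`. -/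
theorem exists_strategy_le_gameSimFail [Nonempty (KSubset N K)] (μ : Fin N → ℝ≥0)
    (B : Estimator N) : ∃ D, IsStrategy N K D ∧ ∀ q : (Fin N → ℕ) → KSubset N K → ℝ≥0∞,
      (∀ ν, ∑ I, q ν I ≤ 1) → ∑ π : Equiv.Perm (Fin N), (N.factorial : ℝ≥0∞)⁻¹ *
        ∑' ν, photonLaw μ {ν ∘ π} * ∑ I, badAccept B (ν ∘ π) (unpermute π I.1) * q ν I ≤
          gameSimFail μ B D := by
  obtain ⟨D, hD, h⟩ := exists_strategy (K := K) μ B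
  refine ⟨D, hD, fun q hq => ?_⟩
  simp_rw [gameSimFail_eq_orbitWeight, ← ENNReal.tsum_mul_left]
  rw [← Summable.tsum_finsetSum fun _ _ => ENNReal.summable]
  refine ENNReal.tsum_le_tsum fun ν => le_unifAvg (h ν).1 fun I hI => ?_
  calc _ = ∑ I', q ν I' * orbitWeight μ B ν I'.1 := by
        simp_rw [orbitWeight, Finset.mul_sum]
        rw [Finset.sum_comm]
        exact Finset.sum_congr rfl fun I' _ => Finset.sum_congr rfl fun π _ => by ring
    _ ≤ ∑ I', q ν I' * orbitWeight μ B ν I :=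
        Finset.sum_le_sum fun I' _ => mul_le_mul_right ((h ν).2 I hI I') _
    _ ≤ _ := by
        rw [← Finset.sum_mul]
        exact (mul_le_mul_left (hq ν) _).trans (one_mul _).le

end Game

/-! ### Correctness -/

section Correctness

variable {𝒰 : Subgroup (Matrix.unitaryGroup (Fin 2) ℂ)} {N K : ℕ}

theorem firstQubit_pulse {ρ₀ : Matrix (Fin 2) (Fin 2) ℂ} (hρ₀ : IsDensity ρ₀) (U : 𝒰) {n : ℕ}
    (hn : 1 ≤ n) : firstQubit n (pulse ρ₀ U n) = conjU U ρ₀ := by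
  obtain ⟨n, rfl⟩ := Nat.exists_eq_add_of_le' hn
  ext a b
  have h := (isDensity_pulse hρ₀ U n).2
  simp only [Matrix.trace, Matrix.diag, pulse, prodState, Matrix.of_apply] at h
  simp only [firstQubit, pulse, prodState, Matrix.of_apply, Fin.prod_univ_succ, Fin.cons_zero,
    Fin.cons_succ]
  rw [← Finset.mul_sum, h, mul_one]

/-- The correction undoes the random unitary of the kept photon and applies `u (σ j)`, and the qubit
is then moved to position `σ j`. -/
theorem honestOutput_eq {ρ₀ : Matrix (Fin 2) (Fin 2) ℂ} (hρ₀ : IsDensity ρ₀) (u : Fin K → 𝒰)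
    (U : Fin N → 𝒰) {n : Fin N → ℕ} {I : KSubset N K} (hI : ∀ i ∈ I.1, 1 ≤ n i)
    (σ : Equiv.Perm (Fin K)) :
    honestOutput ρ₀ u U n I σ = prodState fun i => conjU (u i) ρ₀ := by
  rw [honestOutput]
  congr 1
  funext i
  dsimp only
  have hj : 1 ≤ n (kept I (σ⁻¹ i)) := hI _ (Finset.orderEmbOfFin_mem _ _ _)
  have hσ : σ (σ⁻¹ i) = i := by simp
  rw [firstQubit_pulse hρ₀ _ hj, ← conjU_mul, corrections, inv_mul_cancel_right, hσ]

/-- The rounds with at least one photon. -/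
def photonRounds (n : Fin N → ℕ) : Finset (Fin N) := Finset.univ.filter fun i => 1 ≤ n i

theorem photonRounds_comp (n : Fin N → ℕ) (π : Equiv.Perm (Fin N)) :
    photonRounds (n ∘ π) = unpermute π (photonRounds n) := by
  ext i
  simp [photonRounds, mem_unpermute]

/-- The probability that the correctness game returns `Abort` for given photon numbers. -/
def abortGiven (K : ℕ) (B : Estimator N) (n : Fin N → ℕ) : ℝ≥0∞ :=
  if (photonRounds n).card < K then 1
  else unifAvg ((photonRounds n).powersetCard K) fun I => B I false

theorem abortGiven_comp (B : Estimator N) (n : Fin N → ℕ) (π : Equiv.Perm (Fin N)) :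
    abortGiven K B (n ∘ π) = if (photonRounds n).card < K then 1
      else unifAvg (Finset.univ.filter fun I : KSubset N K => I.1 ⊆ photonRounds n) fun I =>
        B (unpermute π I.1) false := by
  have hinj : Function.Injective fun I : KSubset N K => unpermute π I.1 :=
    (unpermute_bijective π).1.comp Subtype.val_injective
  have h : (photonRounds (n ∘ π)).powersetCard K =
      (Finset.univ.filter fun I : KSubset N K => I.1 ⊆ photonRounds n).map ⟨_, hinj⟩ := by
    ext I
    obtain ⟨J, rfl⟩ := (unpermute_bijective π).2 I
    rw [Finset.mem_powersetCard, photonRounds_comp]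
    simp only [Finset.mem_map, Finset.mem_filter_univ, Function.Embedding.coeFn_mk, unpermute,
      Finset.map_subset_map, Finset.card_map]
    refine ⟨fun hJ => ⟨⟨J, hJ.2⟩, hJ.1, rfl⟩, ?_⟩
    rintro ⟨J', hJ', heq⟩
    obtain rfl := Finset.map_injective _ heq
    exact ⟨hJ', J'.2⟩
  rw [abortGiven, h, unifAvg_map]
  simp [photonRounds_comp, unpermute]

theorem gameCorAbort_eq (η : ℝ≥0) (μ : Fin N → ℝ≥0) (B : Estimator N) :
    gameCorAbort K η μ B = ∑' n, abortGiven K B n * photonLaw (fun i => μ i * η) {n} :=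
  lintegral_countable' _

/-- Undoing `π` on photon numbers drawn with permuted intensities restores the original law, so
every `π` gives the same abort probability. -/
theorem lintegral_abortGiven_comp (η : ℝ≥0) (μ : Fin N → ℝ≥0) (B : Estimator N)
    (π : Equiv.Perm (Fin N)) :
    ∫⁻ n, abortGiven K B (n ∘ π) ∂photonLaw (fun i => wcpMean η (permuted μ π i) false) =
      gameCorAbort K η μ B := by
  rw [gameCorAbort_eq, lintegral_countable',
    ← (Equiv.arrowCongr π.symm (Equiv.refl ℕ)).tsum_eq fun n => abortGiven K B n * _]
  refine tsum_congr fun n => ?_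
  exact congrArg (abortGiven K B (n ∘ π) * ·)
    (photonLaw_permuted_singleton (fun i => μ i * η) π n)

theorem unifAvg_mono {α : Type} {s : Finset α} {f g : α → ℝ≥0∞} (h : ∀ a ∈ s, f a ≤ g a) :
    unifAvg s f ≤ unifAvg s g :=
  ENNReal.div_le_div_right (Finset.sum_le_sum h) _

theorem unifAvg_add {α : Type} (s : Finset α) (f g : α → ℝ≥0∞) :
    unifAvg s (fun a => f a + g a) = unifAvg s f + unifAvg s g := by
  rw [unifAvg, Finset.sum_add_distrib, ENNReal.add_div]
  rfl

theorem unifAvg_const {α : Type} {s : Finset α} (hs : s.Nonempty) (c : ℝ≥0∞) :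
    unifAvg s (fun _ => c) = c := by
  rw [unifAvg, Finset.sum_const, nsmul_eq_mul, mul_comm,
    ENNReal.mul_div_cancel_right (by simpa using hs.ne_empty) (ENNReal.natCast_ne_top _)]

theorem estimator_add_eq_one (B : Estimator N) (I : Finset (Fin N)) : B I false + B I true = 1 := by
  have h := (B I).tsum_coe
  rwa [tsum_fintype, Fintype.sum_bool, add_comm] at h

/-- `F` mixes the guess `a` after an abort with the ideal guess `g`, and `a` has weight
`abortGiven`; two numbers in `[0, 1]` differ by at most `1`. -/
theorem honest_bounds (B : Estimator N) (π : Equiv.Perm (Fin N)) (n : Fin N → ℕ) {a g : ℝ≥0∞}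
    (ha : a ≤ 1) (hg : g ≤ 1) {F : ℝ≥0∞}
    (hF : F = if (photonRounds n).card < K then a
      else unifAvg (Finset.univ.filter fun I : KSubset N K => I.1 ⊆ photonRounds n) fun I =>
        B (unpermute π I.1) false * a + B (unpermute π I.1) true * g) :
    F ≤ g + abortGiven K B (n ∘ π) ∧ g ≤ F + abortGiven K B (n ∘ π) := by
  rw [hF, abortGiven_comp]
  by_cases hJ : (photonRounds n).card < K
  · simp only [if_pos hJ]
    exact ⟨ha.trans le_add_self, hg.trans le_add_self⟩
  · simp only [if_neg hJ]
    have hne : (Finset.univ.filter fun I : KSubset N K => I.1 ⊆ photonRounds n).Nonempty := by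
      obtain ⟨I, hI, hc⟩ := Finset.exists_subset_card_eq (not_lt.1 hJ)
      exact ⟨⟨I, hc⟩, by simpa using hI⟩
    constructor
    · rw [← unifAvg_const hne g, ← unifAvg_add, unifAvg_const hne g]
      refine unifAvg_mono fun I _ => ?_
      rw [add_comm g]
      refine add_le_add (mul_le_of_le_one_right' ha) (mul_le_of_le_one_left' ?_)
      rw [← estimator_add_eq_one B (unpermute π I.1)]
      exact le_add_self
    · rw [← unifAvg_add]
      refine le_unifAvg hne fun I _ => ?_
      calc g = B (unpermute π I.1) false * g + B (unpermute π I.1) true * g := by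
            rw [← add_mul, estimator_add_eq_one, one_mul]
        _ ≤ B (unpermute π I.1) false + B (unpermute π I.1) true * g :=
            add_le_add (mul_le_of_le_one_right' hg) le_rfl
        _ ≤ _ := by
            rw [add_comm]
            exact add_le_add le_add_self le_rfl

variable [CompactSpace 𝒰]

instance : IsProbabilityMeasure (senderLaw 𝒰 N) := by
  unfold senderLaw
  infer_instance

instance (r : Fin N → ℝ≥0) : IsProbabilityMeasure (photonLaw r) := by
  unfold photonLaw
  infer_instance

theorem lintegral_le_add_gameCorAbort {M : Type} [MeasurableSpace M] (ν : Measure M)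
    [IsProbabilityMeasure ν] (η : ℝ≥0) (μ : Fin N → ℝ≥0) (B : Estimator N)
    {f g : M → Equiv.Perm (Fin N) × (Fin N → 𝒰) → (Fin N → ℕ) → ℝ≥0∞}
    (h : ∀ m s n, f m s n ≤ g m s n + abortGiven K B (n ∘ s.1)) :
    ∫⁻ m, ∫⁻ s, ∫⁻ n, f m s n ∂photonLaw (fun i => wcpMean η (permuted μ s.1 i) false)
        ∂(senderLaw 𝒰 N) ∂ν ≤
      ∫⁻ m, ∫⁻ s, ∫⁻ n, g m s n ∂photonLaw (fun i => wcpMean η (permuted μ s.1 i) false)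
        ∂(senderLaw 𝒰 N) ∂ν + gameCorAbort K η μ B := by
  -- Only the constant summand needs to be measurable, so nothing is required of `F`.
  have hconst : ∀ {X : Type} [MeasurableSpace X] (κ : Measure X) [IsProbabilityMeasure κ]
      (F : X → ℝ≥0∞), ∫⁻ x, (F x + gameCorAbort K η μ B) ∂κ =
        ∫⁻ x, F x ∂κ + gameCorAbort K η μ B := fun κ _ F => by
    rw [lintegral_add_right _ measurable_const, lintegral_const, measure_univ, mul_one]
  rw [← hconst]
  refine lintegral_mono fun m => ?_
  dsimp only
  rw [← hconst]
  refine lintegral_mono fun s => (lintegral_mono fun n => h m s n).trans ?_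
  rw [lintegral_add_right _ Measurable.of_discrete, lintegral_abortGiven_comp]

theorem honestReal_bounds {ρ₀ : Matrix (Fin 2) (Fin 2) ℂ} (hρ₀ : IsDensity ρ₀) (η : ℝ≥0)
    (μ : Fin N → ℝ≥0) (B : Estimator N) (Z : HonestDistinguisher 𝒰 K) :
    honestReal ρ₀ η μ B Z ≤ honestIdeal ρ₀ Z + gameCorAbort K η μ B ∧
      honestIdeal ρ₀ Z ≤ honestReal ρ₀ η μ B Z + gameCorAbort K η μ B := by
  have hout : ∀ m, IsDensity (Z.state m ⊗ₖ prodState fun i : Fin K => conjU (Z.input m i) ρ₀) :=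
    fun m => ⟨(Z.state_density m).1.kronecker
      (posSemidef_prodState _ fun i => posSemidef_conjU _ hρ₀.1), by
      simp [Matrix.trace_kronecker, trace_prodState, trace_conjU, hρ₀.2, (Z.state_density m).2]⟩
  have hn : ∀ m (s : Equiv.Perm (Fin N) × (Fin N → 𝒰)) n, _ := fun m s n =>
    honest_bounds (K := K) B s.1 n (prob_le_one (Z.guessAbort_effect m) (Z.state_density m))
      (prob_le_one (Z.guess_effect m) (hout m)) (F := if (photonRounds n).card < K then
        prob (Z.guessAbort m) (Z.state m)
      else unifAvg (Finset.univ.filter fun I : KSubset N K => I.1 ⊆ photonRounds n) fun I =>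
        B (unpermute s.1 I.1) false * prob (Z.guessAbort m) (Z.state m) +
        B (unpermute s.1 I.1) true *
          unifAvg Finset.univ fun σ : Equiv.Perm (Fin K) =>
            prob (Z.guess m) (Z.state m ⊗ₖ honestOutput ρ₀ (Z.input m) s.2 n I σ)) <| by
      refine if_congr Iff.rfl rfl ?_
      simp only [unifAvg]
      congr 1
      refine Finset.sum_congr rfl fun I hI => ?_
      congr 2
      have hI' : ∀ i ∈ I.1, 1 ≤ n i := fun i hi => by
        simpa [photonRounds] using (Finset.mem_filter.1 hI).2 hi
      simp_rw [honestOutput_eq hρ₀ (Z.input m) s.2 hI']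
      exact unifAvg_const Finset.univ_nonempty _
  have hideal : honestIdeal ρ₀ Z = ∫⁻ m, ∫⁻ s : Equiv.Perm (Fin N) × (Fin N → 𝒰), ∫⁻ _n,
      prob (Z.guess m) (Z.state m ⊗ₖ prodState fun i : Fin K => conjU (Z.input m i) ρ₀)
      ∂photonLaw (fun i => wcpMean η (permuted μ s.1 i) false) ∂(senderLaw 𝒰 N) ∂Z.law := by
    simp only [lintegral_const, measure_univ, mul_one]
    rfl
  rw [hideal]
  exact ⟨lintegral_le_add_gameCorAbort Z.law η μ B fun m s n => (hn m s n).1,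
    lintegral_le_add_gameCorAbort Z.law η μ B fun m s n => (hn m s n).2⟩

theorem abs_toReal_sub_le {a b : ℝ≥0∞} {ε : ℝ≥0} (hab : a ≤ b + ε) (hba : b ≤ a + ε) :
    |a.toReal - b.toReal| ≤ ε := by
  by_cases ha : a = ⊤
  · have hb : b = ⊤ := by
      by_contra hb
      exact (ENNReal.add_ne_top.2 ⟨hb, ENNReal.coe_ne_top⟩) (top_le_iff.1 (ha ▸ hab))
    simp [ha, hb]
  · have hb : b ≠ ⊤ := fun hb =>
      (ENNReal.add_ne_top.2 ⟨ha, ENNReal.coe_ne_top⟩) (top_le_iff.1 (hb ▸ hba))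
    have h1 := ENNReal.toReal_mono (by finiteness) hab
    have h2 := ENNReal.toReal_mono (by finiteness) hba
    rw [ENNReal.toReal_add (by finiteness) (by finiteness), ENNReal.coe_toReal] at h1 h2
    rw [abs_le]
    constructor <;> linarith

end Correctness

/-! ### Security -/

section Security

variable {𝒰 : Subgroup (Matrix.unitaryGroup (Fin 2) ℂ)} [CompactSpace 𝒰] {N K : ℕ}

theorem lintegral_permLaw (f : Equiv.Perm (Fin N) → ℝ≥0∞) :
    ∫⁻ π, f π ∂permLaw N = ∑ π, (N.factorial : ℝ≥0∞)⁻¹ * f π := by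
  rw [lintegral_fintype]
  refine Finset.sum_congr rfl fun π _ => ?_
  rw [PMF.toMeasure_apply_singleton _ _ (MeasurableSet.singleton π), PMF.uniformOfFintype_apply,
    Fintype.card_perm, Fintype.card_fin, mul_comm]

theorem lintegral_failTerm_le {ρ₀ : Matrix (Fin 2) (Fin 2) ℂ} (hρ₀ : IsDensity ρ₀) {η : ℝ≥0}
    (hη : η ≤ 1) {μ : Fin N → ℝ≥0} {B : Estimator N} {ε : ℝ≥0∞}
    (hsec : ∀ D : (ℕ →₀ ℕ) → (ℕ →₀ ℕ), IsStrategy N K D → gameSimFail μ B D ≤ ε)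
    [Nonempty (KSubset N K)] (Z : Distinguisher 𝒰 N K) (m : Z.M) :
    ∫⁻ π, ∑' h, pathWeight η μ π h * failTerm ρ₀ Z h m (Z.state m) B π ∂permLaw N ≤ ε := by
  obtain ⟨D, hD, hle⟩ := exists_strategy_le_gameSimFail (K := K) μ B
  rw [lintegral_permLaw]
  refine le_trans (Finset.sum_le_sum fun π _ => mul_le_mul_right
    (tsum_pathWeight_mul_failTerm_le hη ρ₀ μ B Z m (Z.state m) π) _) ((hle _ fun ν =>
      sum_ackGiven_le hη hρ₀ Z m (Z.state_density m) ν).trans (hsec D hD))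

theorem lintegral_tsum_add_le {f g e : Equiv.Perm (Fin N) → Path N → ℝ≥0∞}
    {w : Equiv.Perm (Fin N) → Path N → ℝ≥0∞} (h : ∀ π p, f π p ≤ g π p + e π p) {ε : ℝ≥0∞}
    (he : ∫⁻ π, ∑' p, w π p * e π p ∂permLaw N ≤ ε) :
    ∫⁻ π, ∑' p, w π p * f π p ∂permLaw N ≤ ∫⁻ π, ∑' p, w π p * g π p ∂permLaw N + ε := by
  refine le_trans ?_ (add_le_add le_rfl he)
  rw [← lintegral_add_left Measurable.of_discrete]
  refine lintegral_mono fun π => ?_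
  dsimp only
  rw [← ENNReal.tsum_add]
  refine ENNReal.tsum_le_tsum fun p => ?_
  rw [← mul_add]
  exact mul_le_mul_right (h π p) _

/-- The bound `ε` already holds for every initial classical memory `m`, because the optimal map `D`
does not depend on it; integration over `m` then preserves it. -/
theorem acceptProb_bounds {ρ₀ : Matrix (Fin 2) (Fin 2) ℂ} (hρ₀ : IsDensity ρ₀) {η : ℝ≥0}
    (hη : η ≤ 1) {μ : Fin N → ℝ≥0} {B : Estimator N} {ε : ℝ≥0∞}
    (hsec : ∀ D : (ℕ →₀ ℕ) → (ℕ →₀ ℕ), IsStrategy N K D → gameSimFail μ B D ≤ ε) {PX PZ : 𝒰}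
    (hX : (PX.1 : Matrix (Fin 2) (Fin 2) ℂ) = pauliX)
    (hZ : (PZ.1 : Matrix (Fin 2) (Fin 2) ℂ) = pauliZ) (hK : 0 < K) (I₀ : KSubset N K)
    (Z : Distinguisher 𝒰 N K) :
    acceptProb (realSystem 𝒰 K ρ₀ η μ B) Z ≤
        acceptProb (idealSystem ρ₀ (simulator hρ₀ η μ B hX hZ hK I₀)) Z + ε ∧
      acceptProb (idealSystem ρ₀ (simulator hρ₀ η μ B hX hZ hK I₀)) Z ≤
        acceptProb (realSystem 𝒰 K ρ₀ η μ B) Z + ε := by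
  have : Nonempty (KSubset N K) := ⟨I₀⟩
  have hfail := lintegral_failTerm_le hρ₀ hη hsec Z
  have hconst : ∀ f : Z.M → ℝ≥0∞, ∫⁻ m, (f m + ε) ∂Z.law = ∫⁻ m, f m ∂Z.law + ε := fun f => by
    rw [lintegral_add_right _ measurable_const, lintegral_const, measure_univ, mul_one]
  constructor
  · refine le_trans (lintegral_mono fun m => ?_) (hconst _).le
    have hA := (Z.state_density m).1
    refine (lintegral_play_realSystem Z (Z.input m) m B η μ).le.trans (le_trans ?_ (add_le_add
      (lintegral_play_idealSystem Z (Z.input m) m B η μ hρ₀ hA hX hZ hK I₀).ge le_rfl))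
    exact lintegral_tsum_add_le
      (fun π h => lintegral_realTerm_le Z h (Z.input m) m B π PX PZ hρ₀ hA) (hfail m)
  · refine le_trans (lintegral_mono fun m => ?_) (hconst _).le
    have hA := (Z.state_density m).1
    refine (lintegral_play_idealSystem Z (Z.input m) m B η μ hρ₀ hA hX hZ hK I₀).le.trans (le_trans
      ?_ (add_le_add (lintegral_play_realSystem Z (Z.input m) m B η μ).ge le_rfl))
    exact lintegral_tsum_add_le
      (fun π h => lintegral_idealTerm_le Z h (Z.input m) m B π PX PZ hρ₀ hA) (hfail m)

end Security

end

end WCP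

theorem mainTheorem1
    (𝒰 : Subgroup (Matrix.unitaryGroup (Fin 2) ℂ)) [CompactSpace 𝒰]
    (hX : ∃ U ∈ 𝒰, (U : Matrix (Fin 2) (Fin 2) ℂ) = pauliX)
    (hZ : ∃ U ∈ 𝒰, (U : Matrix (Fin 2) (Fin 2) ℂ) = pauliZ)
    (ρ₀ : Matrix (Fin 2) (Fin 2) ℂ) (hρ₀ : IsDensity ρ₀)
    (η : ℝ≥0) (hη : η ≤ 1)
    (N K : ℕ) (hK : 0 < K) (hKN : K ≤ N)
    (μ : Fin N → ℝ≥0) (B : Estimator N) (ε : ℝ≥0)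
    (hcor : gameCorAbort K η μ B ≤ ε)
    (hsec : ∀ D : (ℕ →₀ ℕ) → (ℕ →₀ ℕ), IsStrategy N K D → gameSimFail μ B D ≤ ε) :
    Constructs 𝒰 K ρ₀ η μ B ε := by
  obtain ⟨X, hX𝒰, hX⟩ := hX
  obtain ⟨Z, hZ𝒰, hZ⟩ := hZ
  -- Some set of `K` rounds is needed to fill the simulator's record and to have candidates for the
  -- maximising strategy.
  obtain ⟨I₀, -, hI₀⟩ := Finset.exists_subset_card_eq
    (show K ≤ (Finset.univ : Finset (Fin N)).card by simpa using hKN)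
  refine ⟨fun W => ?_, simulator hρ₀ η μ B (PX := ⟨X, hX𝒰⟩) (PZ := ⟨Z, hZ𝒰⟩) hX hZ hK ⟨I₀, hI₀⟩,
    fun W => ?_⟩
  · have h := honestReal_bounds hρ₀ η μ B W
    exact abs_toReal_sub_le (h.1.trans (add_le_add le_rfl hcor))
      (h.2.trans (add_le_add le_rfl hcor))
  · have h := acceptProb_bounds hρ₀ hη hsec (PX := ⟨X, hX𝒰⟩) (PZ := ⟨Z, hZ𝒰⟩) hX hZ hK ⟨I₀, hI₀⟩ W
    exact abs_toReal_sub_le h.1 h.2
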